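/- There is a universal constant $C$ such that the following holds. Let $g\in L^1\cap L^\infty(\mathbb R^3)$, $g\ge 0$, $\int_{\mathbb R^3} g\,dx>0$. For every $\alpha\in(0,1)$ there is a constant $C_{\alpha,g}\ge 0$ depending only on $\alpha$ and $g$ such that, for every $\rho\ge 0$ with $\|\rho\|_{L^1(\mathbb R^3)}=1$ and $\rho\in L^{5/3}(\mathbb R^3)$, the following is true. Let $\dot W^{1,2}(\mathbb R^3)=\{h\in L^6(\mathbb R^3):\nabla h\in L^2(\mathbb R^3)\}$. The problem $$-\Delta \bar U=\rho,\qquad \lim_{|x|\to\infty}\bar U(x)=0$$ has a unique solution $\bar U\in\dot W^{1,2}(\mathbb R^3)$ (uniqueness up to null sets; the equation holds in the sense of distributions), and there is a distributional solution $\widehat U\in \dot W^{1,2}(\mathbb R^3)\cap C^1(\mathbb R^3)$, the same for all $\alpha$, of $$\Delta \widehat U=\frac{g\,e^{\widehat U+\bar U}}{\int_{\mathbb R^3} g\,e^{\widehat U+\bar U}\,dx},\qquad 0<\int_{\mathbb R^3} g\,e^{\widehat U+\bar U}\,dx<\infty ,$$ which, with $\widehat E=-\nabla\widehat U$, satisfies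 $$\|\widehat U\|_{L^{3,\infty}(\mathbb R^3)}\le C,\qquad \|\widehat E\|_{L^{3/2,\infty}(\mathbb R^3)}\le C,$$ $$\|\widehat U\|_{C^{1,\alpha}(\mathbb R^3)}\le \exp\!\Big[C_{\alpha,g}\Big(1+\|\rho\|_{L^{5/3}(\mathbb R^3)}^{5/6}\Big)\Big]\qquad\text{for all }\alpha\in(0,1).$$ Here $\|f\|_{L^{p,\infty}}=\sup_{t>0}t\,|\{|f|>t\}|^{1/p}$ and $\|u\|_{C^{1,\alpha}}=\sup|u|+\sup|\nabla u|+\sup_{x\ne y}\frac{|\nabla u(x)-\nabla u(y)|}{|x-y|^\alpha}$. -/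

import Mathlib

open MeasureTheory Filter Topology
open scoped NNReal ENNReal ContDiff

noncomputable section

namespace VPME

/-- Physical space `ℝ³` with its Euclidean structure. -/
abbrev R3 : Type := EuclideanSpace ℝ (Fin 3)

/-- The weak Lebesgue (quasi-)norm `‖f‖_{L^{p,∞}} = sup_{t > 0} t |{|f| > t}|^{1/p}`. -/
def weakLpNorm {F : Type*} [NormedAddCommGroup F] (p : ℝ) (f : R3 → F) : ℝ≥0∞ :=
  ⨆ t : ℝ≥0, (t : ℝ≥0∞) * volume {x : R3 | (t : ℝ≥0∞) < ‖f x‖ₑ} ^ (1 / p)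

/-- The norm `‖u‖_{C^{1,α}} = sup |u| + sup |∇u| + [∇u]_{C^{0,α}}` of a `C¹` function `u`. -/
def c1AlphaNorm (α : ℝ≥0) (u : R3 → ℝ) : ℝ≥0∞ :=
  (⨆ x, ‖u x‖ₑ) + (⨆ x, ‖gradient u x‖ₑ) + eHolderNorm α (gradient u)

/-- Test functions: smooth and compactly supported. -/
def IsTestFunction (φ : R3 → ℝ) : Prop :=
  ContDiff ℝ ∞ φ ∧ HasCompactSupport φ

/-- The vector field `F` is the weak (distributional) gradient of `u`. -/
def HasWeakGradient (u : R3 → ℝ) (F : R3 → R3) : Prop :=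
  LocallyIntegrable u ∧ LocallyIntegrable F ∧
    ∀ φ : R3 → ℝ, IsTestFunction φ → ∀ v : R3,
      ∫ x, u x * fderiv ℝ φ x v = -∫ x, inner ℝ (F x) v * φ x

/-- The homogeneous Sobolev space: `u ∈ L⁶` with weak gradient in `L²`. -/
def MemHomSobolev (u : R3 → ℝ) : Prop :=
  MemLp u 6 ∧ ∃ F : R3 → R3, MemLp F 2 ∧ HasWeakGradient u F

/-- `Δ u = f` in the sense of distributions on `ℝ³`. -/
def IsPoissonSolution (u f : R3 → ℝ) : Prop :=
  LocallyIntegrable u ∧ LocallyIntegrable f ∧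
    ∀ φ : R3 → ℝ, IsTestFunction φ →
      ∫ x, u x * Laplacian.laplacian φ x = ∫ x, f x * φ x

/-- `U` is a homogeneous Sobolev solution of `-Δ U = ρ`, `U(x) → 0` as `|x| → ∞`.
As `U` is determined only almost everywhere, the limit is taken up to null sets. -/
def IsSingularPotential (ρ U : R3 → ℝ) : Prop :=
  MemHomSobolev U ∧ IsPoissonSolution U (fun x => -ρ x) ∧
    Tendsto U (cocompact R3 ⊓ ae volume) (𝓝 0)

/-- `Uhat` is a homogeneous Sobolev solution, in the sense of distributions, of
`Δ Uhat = g exp (Uhat + Ubar) / ∫ g exp (Uhat + Ubar)`, where the integral in the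
denominator is finite and positive. -/
def IsFixedChargeSolution (g Ubar Uhat : R3 → ℝ) : Prop :=
  MemHomSobolev Uhat ∧
    Integrable (fun x => g x * Real.exp (Uhat x + Ubar x)) ∧
    0 < ∫ x, g x * Real.exp (Uhat x + Ubar x) ∧
    IsPoissonSolution Uhat (fun x =>
      g x * Real.exp (Uhat x + Ubar x) / ∫ y, g y * Real.exp (Uhat y + Ubar y))

/-- The electric field `E = -∇U` of a (differentiable) potential. -/
def electricField (U : R3 → ℝ) (x : R3) : R3 := -gradient U x

end VPME

end

open MeasureTheory Filter Topology
open scoped NNReal ENNReal ContDiff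

noncomputable section

namespace VPME

/-! Write `w = g e^{Ū}` and `Û = -v`. The problem becomes `v = (-Δ)⁻¹(t w e^{-v})` with `t ∫ w
e^{-v} = 1`, so `v` is the Newtonian potential of a nonnegative charge `f = t w e^{-v}` of mass one.

Estimates. The kernels of `v` and `∇v` are dominated by `‖z‖⁻¹` and `‖z‖⁻²`, which map the unit ball
of `L¹` into `L^{3,∞}` and `L^{3/2,∞}` (`exists_weak_rieszPotential_le`); only the mass of `f`
enters, so these bounds are universal. The `C^{1,α}` norm is linear in the larger of the `L¹` and
`L^∞` norms of `f` (`exists_c1AlphaNorm_newton_le`). Since `v ≥ 0`, one has `f ≤ t g e^{Ū}`.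
Splitting the potential of `ρ` at radius `‖ρ‖_{5/3}^{-5/6}` gives `Ū ≤ c ‖ρ‖_{5/3}^{5/6}`
(`exists_rieszPotential_le_five_thirds`), and `t` is bounded in terms of `g` alone. This yields the
exponential bound.

Existence. The operator `(-Δ)⁻¹` is positive and `v ↦ e^{-v}` is decreasing, so for fixed `t` the
equation is of monotone type. Up to a constant `(-Δ)⁻¹` restricted to the weight `w` is `D†D`, where
`D : L²(w dx) → L²(dx)` is convolution with `‖z‖⁻²`; the equation becomes `z = D(n(D†z))`, and a
relaxed iteration for it is a contraction (`exists_eq_of_lipschitz_antitone`). The charge `Φ(t) = t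
∫ w e^{-v_t}` is continuous and vanishes at `t = 0`. If it were below one at `t = T`, symmetry of
the Newtonian potential would bound `∫ g v_T` by `sup (-Δ)⁻¹g`, and Jensen's inequality for `g dx`,
together with `g ≤ w`, would force `Φ(T) ≥ 1` for an explicit `T` depending on `g` only. The
intermediate value theorem then gives charge one (`exists_mean_field`).

Uniqueness of `Ū`. A distributional harmonic function tending to zero is zero
(`ae_eq_zero_of_laplacian_eq_zero`): test it against the Newtonian potential of a test function, cut
off at radius `R`; the error has size `R⁻³` on a region of volume comparable to `R³`. -/

/-! ### Riesz potentials: pointwise and weak-type bounds. -/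

/-- The Riesz kernel `‖z‖^{-s}` with values in `[0, ⊤]`. -/
def rieszKernel (s : ℝ) (z : R3) : ℝ≥0∞ := ENNReal.ofReal (‖z‖ ^ (-s))

/-- The Riesz potential of `|f|`, with kernel `‖z‖^{-s}`. -/
def rieszPotential (s : ℝ) (f : R3 → ℝ) (x : R3) : ℝ≥0∞ :=
  ∫⁻ y, rieszKernel s (x - y) * ‖f y‖ₑ

@[fun_prop]
lemma measurable_rieszKernel (s : ℝ) : Measurable (rieszKernel s) := by
  unfold rieszKernel; fun_prop

lemma rieszKernel_neg (s : ℝ) (z : R3) : rieszKernel s (-z) = rieszKernel s z := by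
  simp [rieszKernel]

lemma rieszKernel_sub_comm (s : ℝ) (x y : R3) : rieszKernel s (x - y) = rieszKernel s (y - x) := by
  rw [← rieszKernel_neg, neg_sub]

lemma finrank_R3 : Module.finrank ℝ R3 = 3 := by simp

lemma lintegral_comp_smul_R3 (f : R3 → ℝ≥0∞) {R : ℝ} (hR : 0 < R) :
    ∫⁻ z, f z = ENNReal.ofReal (R ^ 3) * ∫⁻ z, f (R • z) := by
  have h := Measure.map_addHaar_smul (volume : Measure R3) hR.ne'
  have hm : MeasurableEmbedding (fun z : R3 => R • z) :=
    (Homeomorph.smulOfNeZero R hR.ne').measurableEmbedding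
  have h2 := hm.lintegral_map (μ := volume) f
  rw [h, lintegral_smul_measure, finrank_R3, abs_of_pos (by positivity),
    ENNReal.ofReal_inv_of_pos (by positivity)] at h2
  rw [← h2, smul_eq_mul, ← mul_assoc, ENNReal.mul_inv_cancel, one_mul]
  · simpa using pow_pos hR 3
  · simp

lemma rieszKernel_smul (s : ℝ) {R : ℝ} (hR : 0 < R) (z : R3) :
    rieszKernel s (R • z) = ENNReal.ofReal (R ^ (-s)) * rieszKernel s z := by
  rw [rieszKernel, norm_smul, Real.norm_of_nonneg hR.le, Real.mul_rpow hR.le (norm_nonneg _),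
    ENNReal.ofReal_mul (by positivity), rieszKernel]

/-- By homogeneity the constant is the integral over the unit ball, finite because `s < 3`. -/
lemma exists_lintegral_ball_rieszKernel {s : ℝ} (hs : s < 3) :
    ∃ C : ℝ≥0, ∀ R : ℝ, 0 < R →
      ∫⁻ z in Metric.ball (0 : R3) R, rieszKernel s z = C * ENNReal.ofReal (R ^ (3 - s)) := by
  have hfin : ∫⁻ z in Metric.ball (0 : R3) 1, rieszKernel s z < ⊤ := by
    have : IntegrableOn (fun z : R3 => ‖z‖ ^ (-s)) (Metric.ball 0 1) volume := by
      refine integrableOn_ball_of_norm_le_rpow (C := 1) (α := s) (by simp) (by simpa using hs) ?_ ?_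
      · refine ae_of_all _ fun x => ?_
        rw [Real.norm_of_nonneg (by positivity), one_mul]
      · exact (by fun_prop : Measurable fun z : R3 => ‖z‖ ^ (-s)).aestronglyMeasurable
    have h2 := this.lintegral_lt_top
    exact h2
  refine ⟨(∫⁻ z in Metric.ball (0 : R3) 1, rieszKernel s z).toNNReal, fun R hR => ?_⟩
  rw [ENNReal.coe_toNNReal hfin.ne, ← lintegral_indicator measurableSet_ball,
    lintegral_comp_smul_R3 _ hR, ← lintegral_indicator measurableSet_ball]
  have : ∀ z : R3, (Metric.ball (0 : R3) R).indicator (rieszKernel s) (R • z) =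
      ENNReal.ofReal (R ^ (-s)) * (Metric.ball (0 : R3) 1).indicator (rieszKernel s) z := by
    intro z
    have hiff : R • z ∈ Metric.ball (0 : R3) R ↔ z ∈ Metric.ball (0 : R3) 1 := by
      simp only [mem_ball_zero_iff, norm_smul, Real.norm_of_nonneg hR.le]
      constructor
      · intro h; nlinarith
      · intro h; nlinarith
    by_cases hz : z ∈ Metric.ball (0 : R3) 1
    · rw [Set.indicator_of_mem hz, Set.indicator_of_mem (hiff.2 hz), rieszKernel_smul s hR]
    · rw [Set.indicator_of_notMem hz, Set.indicator_of_notMem (fun h => hz (hiff.1 h)), mul_zero]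
  simp_rw [this]
  rw [lintegral_const_mul _ ((measurable_rieszKernel s).indicator measurableSet_ball),
    ← mul_assoc, mul_comm, ← ENNReal.ofReal_mul (by positivity)]
  congr 2
  rw [← Real.rpow_natCast, ← Real.rpow_add hR]
  congr 1

lemma lintegral_compl_ball_rieszKernel_lt_top {s : ℝ} (hs : 3 < s) {R : ℝ} (hR : 0 < R) :
    ∫⁻ z in (Metric.ball (0 : R3) R)ᶜ, rieszKernel s z < ⊤ := by
  have h1 := finite_integral_one_add_norm (E := R3) (μ := volume) (r := s) (by simpa using hs)
  have hc : ∀ z ∈ (Metric.ball (0 : R3) R)ᶜ, rieszKernel s z ≤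
      ENNReal.ofReal ((1 + R⁻¹) ^ s) * ENNReal.ofReal ((1 + ‖z‖) ^ (-s)) := by
    intro z hz
    have hz' : R ≤ ‖z‖ := by simpa using hz
    have hz0 : 0 < ‖z‖ := hR.trans_le hz'
    rw [← ENNReal.ofReal_mul (by positivity)]
    refine ENNReal.ofReal_le_ofReal ?_
    rw [Real.rpow_neg (by positivity), Real.rpow_neg (by positivity), ← div_eq_mul_inv,
      ← Real.div_rpow (by positivity) (by positivity), ← Real.inv_rpow (by positivity)]
    refine Real.rpow_le_rpow (by positivity) ?_ (by linarith)
    rw [le_div_iff₀ (by positivity), inv_mul_le_iff₀ hz0]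
    have : 1 ≤ R⁻¹ * ‖z‖ := by rw [inv_mul_eq_div, le_div_iff₀ hR]; linarith
    nlinarith
  calc _ ≤ ∫⁻ z in (Metric.ball (0 : R3) R)ᶜ,
        ENNReal.ofReal ((1 + R⁻¹) ^ s) * ENNReal.ofReal ((1 + ‖z‖) ^ (-s)) :=
        setLIntegral_mono' measurableSet_ball.compl hc
    _ ≤ ∫⁻ z, ENNReal.ofReal ((1 + R⁻¹) ^ s) * ENNReal.ofReal ((1 + ‖z‖) ^ (-s)) :=
        setLIntegral_le_lintegral _ _
    _ < ⊤ := by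
        rw [lintegral_const_mul _ (by fun_prop)]
        exact ENNReal.mul_lt_top ENNReal.ofReal_lt_top h1

lemma rieszKernel_le_of_le {s : ℝ} (hs : 0 ≤ s) {R : ℝ} (hR : 0 < R) {z : R3} (hz : R ≤ ‖z‖) :
    rieszKernel s z ≤ ENNReal.ofReal (R ^ (-s)) :=
  ENNReal.ofReal_le_ofReal (Real.rpow_le_rpow_of_nonpos hR hz (by linarith))

/-- The kernel splits into its part near the origin and a bounded part. -/
lemma rieszKernel_le_indicator_add {s : ℝ} (hs : 0 ≤ s) {R : ℝ} (hR : 0 < R) (z : R3) :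
    rieszKernel s z ≤
      (Metric.ball (0 : R3) R).indicator (rieszKernel s) z + ENNReal.ofReal (R ^ (-s)) := by
  by_cases hz : z ∈ Metric.ball (0 : R3) R
  · rw [Set.indicator_of_mem hz]; exact le_self_add
  · rw [Set.indicator_of_notMem hz, zero_add]
    exact rieszKernel_le_of_le hs hR (by simpa using hz)

lemma rieszPotential_le_near_add {s : ℝ} (hs : 0 ≤ s) {R : ℝ} (hR : 0 < R) {f : R3 → ℝ}
    (hf : AEStronglyMeasurable f) (x : R3) :
    rieszPotential s f x ≤
      (∫⁻ y, (Metric.ball (0 : R3) R).indicator (rieszKernel s) (x - y) * ‖f y‖ₑ) +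
        ENNReal.ofReal (R ^ (-s)) * eLpNorm f 1 volume := by
  rw [eLpNorm_one_eq_lintegral_enorm, ← lintegral_const_mul'' _ hf.enorm,
    ← lintegral_add_right' _ (hf.enorm.const_mul _)]
  refine lintegral_mono fun y => ?_
  rw [← add_mul]
  gcongr
  exact rieszKernel_le_indicator_add hs hR _

lemma lintegral_sub_left_R3 (f : R3 → ℝ≥0∞) (x : R3) : ∫⁻ y, f (x - y) = ∫⁻ y, f y :=
  lintegral_sub_left_eq_self f x

lemma measurable_nearKernel_sub (s R : ℝ) (x : R3) :
    Measurable fun y => (Metric.ball (0 : R3) R).indicator (rieszKernel s) (x - y) :=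
  ((measurable_rieszKernel s).indicator measurableSet_ball).comp (measurable_const.sub measurable_id)

lemma exists_rieszPotential_le {s : ℝ} (hs : 0 ≤ s) (hs3 : s < 3) :
    ∃ C : ℝ≥0, ∀ f : R3 → ℝ, AEStronglyMeasurable f → ∀ x,
      rieszPotential s f x ≤ C * eLpNorm f ⊤ volume + eLpNorm f 1 volume := by
  obtain ⟨C, hC⟩ := exists_lintegral_ball_rieszKernel hs3
  refine ⟨C, fun f hf x => (rieszPotential_le_near_add hs one_pos hf x).trans ?_⟩
  have h1 := hC 1 one_pos
  rw [Real.one_rpow, ENNReal.ofReal_one, mul_one, ← lintegral_indicator measurableSet_ball] at h1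
  rw [Real.one_rpow, ENNReal.ofReal_one, one_mul]
  gcongr
  rw [← h1, ← lintegral_sub_left_R3 ((Metric.ball (0 : R3) 1).indicator (rieszKernel s)) x,
    ← lintegral_mul_const _ (measurable_nearKernel_sub s 1 x)]
  refine lintegral_mono_ae ?_
  filter_upwards [enorm_ae_le_eLpNormEssSup f volume] with y hy
  rw [eLpNorm_exponent_top]
  gcongr

/-- Splitting the Newtonian potential at radius `R` and using Hölder's inequality near the pole. -/
lemma exists_rieszPotential_one_le :
    ∃ C : ℝ≥0, ∀ f : R3 → ℝ, AEStronglyMeasurable f → ∀ R : ℝ, 0 < R → ∀ x,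
      (∫⁻ y, (Metric.ball (0 : R3) R).indicator (rieszKernel 1) (x - y) * ‖f y‖ₑ) ≤
        C * ENNReal.ofReal (R ^ (1 / 5 : ℝ)) * eLpNorm f (5 / 3) volume := by
  obtain ⟨C, hC⟩ := exists_lintegral_ball_rieszKernel (s := 5 / 2) (by norm_num)
  refine ⟨C ^ (2 / 5 : ℝ), fun f hf R hR x => ?_⟩
  have hpq : Real.HolderConjugate (5 / 2) (5 / 3) := by
    rw [Real.holderConjugate_iff]; norm_num
  refine (ENNReal.lintegral_mul_le_Lp_mul_Lq volume hpq ?_ hf.enorm).trans ?_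
  · exact (measurable_nearKernel_sub 1 R x).aemeasurable
  -- The exponent conjugate to `5/3` is `5/2`, and `‖z‖^{-5/2}` is still locally integrable; the
  -- power `R^{1/2}` becomes `R^{1/5}` after taking the `2/5`-th root.
  have e1 : (∫⁻ y, (Metric.ball (0 : R3) R).indicator (rieszKernel 1) (x - y) ^ (5 / 2 : ℝ)) =
      C * ENNReal.ofReal (R ^ (1 / 2 : ℝ)) := by
    rw [lintegral_sub_left_R3
      (fun y => (Metric.ball (0 : R3) R).indicator (rieszKernel 1) y ^ (5 / 2 : ℝ)) x]
    have := hC R hR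
    rw [← lintegral_indicator measurableSet_ball] at this
    rw [show (1 / 2 : ℝ) = 3 - 5 / 2 by norm_num, ← this]
    refine lintegral_congr fun z => ?_
    by_cases hz : z ∈ Metric.ball (0 : R3) R
    · rw [Set.indicator_of_mem hz, Set.indicator_of_mem hz, rieszKernel, rieszKernel,
        ENNReal.ofReal_rpow_of_nonneg (by positivity) (by norm_num),
        ← Real.rpow_mul (norm_nonneg _)]
      norm_num
    · rw [Set.indicator_of_notMem hz, Set.indicator_of_notMem hz]
      simp
  rw [e1, eLpNorm_eq_lintegral_rpow_enorm_toReal (by simp)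
    (ENNReal.div_ne_top (by simp) (by simp))]
  have h53 : (5 / 3 : ℝ≥0∞).toReal = 5 / 3 := by simp
  rw [h53, ENNReal.mul_rpow_of_nonneg _ _ (by norm_num),
    ENNReal.ofReal_rpow_of_nonneg (by positivity) (by norm_num), ← Real.rpow_mul hR.le,
    ENNReal.coe_rpow_of_nonneg _ (by norm_num)]
  norm_num

lemma rieszPotential_congr_ae {s : ℝ} {f g : R3 → ℝ} (h : f =ᵐ[volume] g) :
    rieszPotential s f = rieszPotential s g := by
  ext x
  refine lintegral_congr_ae ?_
  filter_upwards [h] with y hy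
  rw [hy]

lemma measurable_rieszPotential (s : ℝ) {f : R3 → ℝ} (hf : AEStronglyMeasurable f) :
    Measurable (rieszPotential s f) := by
  rw [rieszPotential_congr_ae hf.ae_eq_mk]
  have hm : Measurable (hf.mk f) := hf.stronglyMeasurable_mk.measurable
  unfold rieszPotential
  refine Measurable.lintegral_prod_right' (f := fun p : R3 × R3 =>
    rieszKernel s (p.1 - p.2) * ‖hf.mk f p.2‖ₑ) ?_
  fun_prop

lemma lintegral_mul_comm_swap {f : R3 → ℝ} (hf : AEStronglyMeasurable f) {k h : R3 → ℝ≥0∞}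
    (hk : Measurable k) (hh : Measurable h) :
    ∫⁻ x, h x * ∫⁻ y, k (x - y) * ‖f y‖ₑ = ∫⁻ y, (∫⁻ x, k (x - y) * h x) * ‖f y‖ₑ := by
  have e1 : ∀ x, ∫⁻ y, k (x - y) * ‖f y‖ₑ = ∫⁻ y, k (x - y) * ‖hf.mk f y‖ₑ := fun x =>
    lintegral_congr_ae (by filter_upwards [hf.ae_eq_mk] with y hy; rw [hy])
  have e2 : ∫⁻ y, (∫⁻ x, k (x - y) * h x) * ‖f y‖ₑ =
      ∫⁻ y, (∫⁻ x, k (x - y) * h x) * ‖hf.mk f y‖ₑ :=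
    lintegral_congr_ae (by filter_upwards [hf.ae_eq_mk] with y hy; rw [hy])
  have hm : Measurable (hf.mk f) := hf.stronglyMeasurable_mk.measurable
  rw [e2]
  simp_rw [e1]
  calc ∫⁻ x, h x * ∫⁻ y, k (x - y) * ‖hf.mk f y‖ₑ
      = ∫⁻ x, ∫⁻ y, h x * (k (x - y) * ‖hf.mk f y‖ₑ) := by
        refine lintegral_congr fun x => ?_
        rw [lintegral_const_mul _ (by fun_prop)]
    _ = ∫⁻ y, ∫⁻ x, h x * (k (x - y) * ‖hf.mk f y‖ₑ) :=
        lintegral_lintegral_swap (by fun_prop)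
    _ = _ := by
        refine lintegral_congr fun y => ?_
        rw [← lintegral_mul_const _ (by fun_prop)]
        refine lintegral_congr fun x => ?_
        ring

/-- Among sets of given volume the integral of the kernel is controlled as for a ball. -/
lemma exists_setLIntegral_rieszKernel_le {s : ℝ} (hs : 0 ≤ s) (hs3 : s < 3) :
    ∃ C : ℝ≥0, ∀ (A : Set R3) (V : ℝ), 0 < V → volume A = ENNReal.ofReal V → ∀ y,
      ∫⁻ x in A, rieszKernel s (x - y) ≤ C * ENNReal.ofReal (V ^ (1 - s / 3)) := by
  obtain ⟨C, hC⟩ := exists_lintegral_ball_rieszKernel hs3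
  refine ⟨C + 1, fun A V hV hA y => ?_⟩
  -- At this radius the ball has volume comparable to `V`, and the near and far contributions scale
  -- alike.
  set R : ℝ := V ^ (1 / 3 : ℝ) with hRdef
  have hR : 0 < R := by positivity
  calc ∫⁻ x in A, rieszKernel s (x - y)
      ≤ ∫⁻ x in A, ((Metric.ball (0 : R3) R).indicator (rieszKernel s) (x - y) +
          ENNReal.ofReal (R ^ (-s))) :=
        lintegral_mono fun x => rieszKernel_le_indicator_add hs hR _
    _ = (∫⁻ x in A, (Metric.ball (0 : R3) R).indicator (rieszKernel s) (x - y)) +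
          ENNReal.ofReal (R ^ (-s)) * volume A := by
        rw [lintegral_add_right _ measurable_const]; simp
    _ ≤ (∫⁻ x, (Metric.ball (0 : R3) R).indicator (rieszKernel s) (x - y)) +
          ENNReal.ofReal (R ^ (-s)) * volume A := by
        gcongr; exact Measure.restrict_le_self
    _ = C * ENNReal.ofReal (R ^ (3 - s)) + ENNReal.ofReal (R ^ (-s)) * ENNReal.ofReal V := by
        rw [lintegral_sub_right_eq_self (μ := volume), lintegral_indicator measurableSet_ball,
          hC R hR, hA]
    _ = (C + 1 : ℝ≥0) * ENNReal.ofReal (V ^ (1 - s / 3)) := by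
        have e1 : R ^ (3 - s) = V ^ (1 - s / 3) := by
          rw [hRdef, ← Real.rpow_mul hV.le]; congr 1; ring
        have e2 : R ^ (-s) * V = V ^ (1 - s / 3) := by
          rw [hRdef, ← Real.rpow_mul hV.le, ← Real.rpow_add_one hV.ne']; congr 1; ring
        rw [← ENNReal.ofReal_mul (by positivity), e1, e2]
        push_cast
        rw [add_mul, one_mul]

/-- Weak-type bound: the kernel `‖z‖^{-s}` maps the unit ball of `L¹` to `L^{3/s,∞}`. -/
lemma exists_weak_rieszPotential_le {s : ℝ} (hs : 0 < s) (hs3 : s < 3) :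
    ∃ C : ℝ≥0, ∀ f : R3 → ℝ, AEStronglyMeasurable f → eLpNorm f 1 volume ≤ 1 → ∀ t : ℝ≥0,
      (t : ℝ≥0∞) * volume {x | (t : ℝ≥0∞) < rieszPotential s f x} ^ (s / 3) ≤ C := by
  obtain ⟨C, hC⟩ := exists_setLIntegral_rieszKernel_le hs.le hs3
  refine ⟨C, fun f hf hf1 t => ?_⟩
  have hmeas := measurable_rieszPotential s hf
  set S : Set R3 := {x | (t : ℝ≥0∞) < rieszPotential s f x} with hS
  have hSm : MeasurableSet S := measurableSet_lt measurable_const hmeas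
  -- The level set is not known to have finite measure, so it is cut to balls and the bound passes
  -- to the increasing union.
  have key : ∀ n : ℕ, (t : ℝ≥0∞) * volume (S ∩ Metric.ball 0 n) ^ (s / 3) ≤ C := by
    intro n
    set A := S ∩ Metric.ball (0 : R3) n
    have hAm : MeasurableSet A := hSm.inter measurableSet_ball
    have hfin : volume A ≠ ⊤ :=
      (measure_mono Set.inter_subset_right |>.trans_lt measure_ball_lt_top).ne
    by_cases h0 : volume A = 0
    · rw [h0, ENNReal.zero_rpow_of_pos (by positivity)]; simp
    set V := (volume A).toReal
    have hV : 0 < V := ENNReal.toReal_pos h0 hfin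
    have hAV : volume A = ENNReal.ofReal V := (ENNReal.ofReal_toReal hfin).symm
    -- Chebyshev on `A`, then Tonelli: the kernel is integrated over `A` first, where only the
    -- volume of `A` matters. Division by `V^{1 - s/3}` gives the claim.
    have h1 : (t : ℝ≥0∞) * ENNReal.ofReal V ≤ C * ENNReal.ofReal (V ^ (1 - s / 3)) := by
      calc (t : ℝ≥0∞) * ENNReal.ofReal V = ∫⁻ x in A, (t : ℝ≥0∞) := by
            rw [setLIntegral_const, hAV]
        _ ≤ ∫⁻ x in A, rieszPotential s f x :=
            setLIntegral_mono' hAm fun x hx => (le_of_lt hx.1)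
        _ = ∫⁻ x, A.indicator 1 x * ∫⁻ y, rieszKernel s (x - y) * ‖f y‖ₑ := by
            rw [← lintegral_indicator hAm]
            refine lintegral_congr fun x => ?_
            by_cases hx : x ∈ A <;> simp [hx, rieszPotential]
        _ = ∫⁻ y, (∫⁻ x, rieszKernel s (x - y) * A.indicator 1 x) * ‖f y‖ₑ :=
            lintegral_mul_comm_swap hf (measurable_rieszKernel s)
              (measurable_one.indicator hAm)
        _ ≤ ∫⁻ y, (C * ENNReal.ofReal (V ^ (1 - s / 3))) * ‖f y‖ₑ := by
            refine lintegral_mono fun y => ?_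
            gcongr
            refine le_trans (le_of_eq ?_) (hC A V hV hAV y)
            rw [← lintegral_indicator hAm]
            refine lintegral_congr fun x => ?_
            by_cases hx : x ∈ A <;> simp [hx]
        _ ≤ C * ENNReal.ofReal (V ^ (1 - s / 3)) := by
            rw [lintegral_const_mul'' _ hf.enorm, ← eLpNorm_one_eq_lintegral_enorm]
            exact mul_le_of_le_one_right zero_le hf1
    have h2 : ENNReal.ofReal (V ^ (1 - s / 3)) ≠ 0 := by
      simpa using Real.rpow_pos_of_pos hV _
    rw [hAV, ENNReal.ofReal_rpow_of_pos hV]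
    refine (ENNReal.mul_le_mul_iff_left h2 ENNReal.ofReal_ne_top).1 ?_
    rw [mul_assoc, ← ENNReal.ofReal_mul (by positivity), ← Real.rpow_add hV]
    simpa using h1
  have hmono : Monotone fun n : ℕ => S ∩ Metric.ball (0 : R3) n := fun a b hab =>
    Set.inter_subset_inter_right _ (Metric.ball_subset_ball (by exact_mod_cast hab))
  have hU : ⋃ n : ℕ, S ∩ Metric.ball (0 : R3) n = S := by
    rw [← Set.inter_iUnion, Metric.iUnion_ball_nat, Set.inter_univ]
  have hlim := tendsto_measure_iUnion_atTop (μ := (volume : Measure R3)) hmono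
  rw [hU] at hlim
  have h3 := (ENNReal.continuous_rpow_const (y := s / 3)).continuousAt.tendsto.comp hlim
  have h4 := ENNReal.Tendsto.const_mul (a := (t : ℝ≥0∞)) h3 (Or.inr ENNReal.coe_ne_top)
  exact le_of_tendsto' h4 key

/-! ### Composition of Riesz kernels and the energy identity. -/

/-- `∫ ‖z‖⁻² ‖e - z‖⁻² dz` for any unit vector `e`. -/
def rieszCompConst : ℝ≥0∞ :=
  ∫⁻ z, rieszKernel 2 z * rieszKernel 2 (EuclideanSpace.single (0 : Fin 3) (1 : ℝ) - z)

lemma rieszKernel_two_le_four (z : R3) (hz : (1 / 2 : ℝ) ≤ ‖z‖) :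
    rieszKernel 2 z ^ 2 ≤ (Metric.ball (0 : R3) (1 / 2))ᶜ.indicator (rieszKernel 4) z := by
  rw [Set.indicator_of_mem (by simpa using hz), rieszKernel, rieszKernel,
    ← ENNReal.ofReal_pow (by positivity), ← Real.rpow_natCast, ← Real.rpow_mul (norm_nonneg _)]
  norm_num

/-- The two poles are at distance one, so at most one of them is within `1/2` of a given point. Near
a pole the other factor is at most `4`; away from both, the product is at most the square of the
larger factor, and `‖z‖⁻⁴` is integrable at infinity. -/
lemma rieszCompConst_ne_top : rieszCompConst ≠ ⊤ := by
  set e : R3 := EuclideanSpace.single (0 : Fin 3) (1 : ℝ) with he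
  have hne : ‖e‖ = 1 := by simp [he]
  set b : R3 → ℝ≥0∞ := (Metric.ball (0 : R3) (1 / 2)).indicator (rieszKernel 2)
  set t : R3 → ℝ≥0∞ := (Metric.ball (0 : R3) (1 / 2))ᶜ.indicator (rieszKernel 4)
  have hb : Measurable b := (measurable_rieszKernel 2).indicator measurableSet_ball
  have ht : Measurable t := (measurable_rieszKernel 4).indicator measurableSet_ball.compl
  have hbfin : ∫⁻ z, b z < ⊤ := by
    obtain ⟨C, hC⟩ := exists_lintegral_ball_rieszKernel (s := 2) (by norm_num)
    rw [lintegral_indicator measurableSet_ball, hC _ (by norm_num)]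
    exact ENNReal.mul_lt_top ENNReal.coe_lt_top ENNReal.ofReal_lt_top
  have htfin : ∫⁻ z, t z < ⊤ := by
    rw [lintegral_indicator measurableSet_ball.compl]
    exact lintegral_compl_ball_rieszKernel_lt_top (by norm_num) (by norm_num)
  have hfar : ∀ w : R3, (1 / 2 : ℝ) ≤ ‖w‖ → rieszKernel 2 w ≤ 4 := by
    intro w hw
    refine (rieszKernel_le_of_le (by norm_num) (by norm_num) hw).trans ?_
    rw [Real.rpow_neg (by norm_num)]
    norm_num
  have hle : ∀ z, rieszKernel 2 z * rieszKernel 2 (e - z) ≤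
      4 * b z + 4 * b (e - z) + (t z + t (e - z)) := by
    intro z
    have htri : 1 ≤ ‖z‖ + ‖e - z‖ := by
      calc 1 = ‖z + (e - z)‖ := by rw [add_sub_cancel, hne]
        _ ≤ _ := norm_add_le _ _
    by_cases h1 : z ∈ Metric.ball (0 : R3) (1 / 2)
    · have h1' : ‖z‖ < 1 / 2 := by simpa using h1
      have : b z = rieszKernel 2 z := Set.indicator_of_mem h1 _
      rw [← this, mul_comm]
      refine le_trans ?_ le_self_add
      refine le_trans ?_ le_self_add
      gcongr
      exact hfar _ (by linarith)
    by_cases h2 : e - z ∈ Metric.ball (0 : R3) (1 / 2)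
    · have : b (e - z) = rieszKernel 2 (e - z) := Set.indicator_of_mem h2 _
      rw [← this]
      refine le_trans ?_ le_self_add
      refine le_trans ?_ le_add_self
      gcongr
      exact hfar _ (by simpa using h1)
    · refine le_trans ?_ le_add_self
      have h1' := rieszKernel_two_le_four z (by simpa using h1)
      have h2' := rieszKernel_two_le_four (e - z) (by simpa using h2)
      rcases le_total (rieszKernel 2 z) (rieszKernel 2 (e - z)) with h | h
      · calc _ ≤ rieszKernel 2 (e - z) ^ 2 := by rw [sq]; gcongr
          _ ≤ _ := h2'.trans le_add_self
      · calc _ ≤ rieszKernel 2 z ^ 2 := by rw [sq]; gcongr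
          _ ≤ _ := h1'.trans le_self_add
  refine (lt_of_le_of_lt (lintegral_mono hle) ?_).ne
  have hb' : Measurable fun z => b (e - z) := hb.comp (by fun_prop)
  have ht' : Measurable fun z => t (e - z) := ht.comp (by fun_prop)
  rw [lintegral_add_left (by fun_prop), lintegral_add_left (by fun_prop),
    lintegral_add_left (by fun_prop), lintegral_const_mul _ hb, lintegral_const_mul _ hb',
    lintegral_sub_left_R3 b, lintegral_sub_left_R3 t]
  exact ENNReal.add_lt_top.2 ⟨ENNReal.add_lt_top.2 ⟨ENNReal.mul_lt_top (by simp) hbfin,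
    ENNReal.mul_lt_top (by simp) hbfin⟩, ENNReal.add_lt_top.2 ⟨htfin, htfin⟩⟩

lemma rieszKernel_ne_zero (s : ℝ) {z : R3} (hz : z ≠ 0) : rieszKernel s z ≠ 0 := by
  have : 0 < ‖z‖ := norm_pos_iff.2 hz
  simpa [rieszKernel] using Real.rpow_pos_of_pos this _

lemma rieszCompConst_ne_zero : rieszCompConst ≠ 0 := by
  intro h
  unfold rieszCompConst at h
  rw [lintegral_eq_zero_iff (by fun_prop)] at h
  have h0 : ∀ᵐ z : R3, z ≠ 0 := by simp [ae_iff]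
  have h1 : ∀ᵐ z : R3, z ≠ EuclideanSpace.single (0 : Fin 3) (1 : ℝ) := by simp [ae_iff]
  have : ∀ᵐ z : R3, False := by
    filter_upwards [h, h0, h1] with z hz hz0 hz1
    exact mul_ne_zero (rieszKernel_ne_zero 2 hz0)
      (rieszKernel_ne_zero 2 (sub_ne_zero.2 hz1.symm)) hz
  simp at this
  exact NeZero.ne _ this

/-- The reflection in the hyperplane orthogonal to `v - w` is a measure-preserving isometry carrying
`v` to `w`. -/
lemma rieszComp_of_norm_eq {v w : R3} (h : ‖v‖ = ‖w‖) :
    ∫⁻ z, rieszKernel 2 z * rieszKernel 2 (v - z) =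
      ∫⁻ z, rieszKernel 2 z * rieszKernel 2 (w - z) := by
  set T := (Submodule.span ℝ {v - w})ᗮ.reflection
  have hT : T v = w := Submodule.reflection_sub h
  have hmp : MeasurePreserving T volume volume := T.measurePreserving
  rw [← hmp.lintegral_comp (f := fun z => rieszKernel 2 z * rieszKernel 2 (w - z)) (by fun_prop)]
  refine lintegral_congr fun z => ?_
  rw [← hT, ← map_sub, rieszKernel, rieszKernel, rieszKernel, rieszKernel, T.norm_map, T.norm_map]

/-- The composition formula `‖·‖⁻² * ‖·‖⁻² = c ‖·‖⁻¹`. -/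
lemma rieszKernel_comp {x y : R3} (hxy : x ≠ y) :
    ∫⁻ z, rieszKernel 2 (x - z) * rieszKernel 2 (z - y) =
      rieszCompConst * rieszKernel 1 (x - y) := by
  have hr : 0 < ‖x - y‖ := norm_pos_iff.2 (sub_ne_zero.2 hxy)
  set r := ‖x - y‖ with hrdef
  set e : R3 := EuclideanSpace.single (0 : Fin 3) (1 : ℝ) with he
  have hne : ‖e‖ = 1 := by simp [he]
  calc ∫⁻ z, rieszKernel 2 (x - z) * rieszKernel 2 (z - y)
      = ∫⁻ z, rieszKernel 2 z * rieszKernel 2 ((x - y) - z) := by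
        rw [← lintegral_add_right_eq_self _ y]
        refine lintegral_congr fun z => ?_
        rw [add_sub_cancel_right, mul_comm]
        congr 2
        abel
    _ = ∫⁻ z, rieszKernel 2 z * rieszKernel 2 (r • e - z) :=
        rieszComp_of_norm_eq (by rw [norm_smul, hne, Real.norm_of_nonneg hr.le, mul_one])
    _ = ENNReal.ofReal (r ^ 3) *
          ∫⁻ z, rieszKernel 2 (r • z) * rieszKernel 2 (r • e - r • z) :=
        lintegral_comp_smul_R3 _ hr
    _ = ENNReal.ofReal (r ^ 3) * ∫⁻ z, (ENNReal.ofReal (r ^ (-2 : ℝ)) * ENNReal.ofReal (r ^ (-2 : ℝ))) *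
          (rieszKernel 2 z * rieszKernel 2 (e - z)) := by
        congr 1
        refine lintegral_congr fun z => ?_
        rw [← smul_sub, rieszKernel_smul 2 hr, rieszKernel_smul 2 hr]
        ring
    _ = rieszCompConst * rieszKernel 1 (x - y) := by
        rw [lintegral_const_mul _ (by fun_prop), ← mul_assoc, mul_comm, rieszCompConst,
          ← ENNReal.ofReal_mul (by positivity), ← ENNReal.ofReal_mul (by positivity), rieszKernel,
          ← hrdef, ← Real.rpow_natCast, ← Real.rpow_add hr, ← Real.rpow_add hr]
        norm_num
        rfl

lemma lintegral_rieszKernel_mul_rieszPotential_two {f : R3 → ℝ} (hf : AEStronglyMeasurable f)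
    (y : R3) : ∫⁻ x, rieszKernel 2 (x - y) * rieszPotential 2 f x =
      rieszCompConst * rieszPotential 1 f y := by
  calc ∫⁻ x, rieszKernel 2 (x - y) * rieszPotential 2 f x
      = ∫⁻ z, (∫⁻ x, rieszKernel 2 (x - z) * rieszKernel 2 (x - y)) * ‖f z‖ₑ :=
        lintegral_mul_comm_swap hf (measurable_rieszKernel 2) (by fun_prop)
    _ = ∫⁻ z, rieszCompConst * (rieszKernel 1 (y - z) * ‖f z‖ₑ) := by
        have h0 : ∀ᵐ z : R3, z ≠ y := by simp [ae_iff]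
        refine lintegral_congr_ae ?_
        filter_upwards [h0] with z hz
        rw [← mul_assoc, rieszKernel_sub_comm 1 y z, ← rieszKernel_comp hz]
        congr 1
        refine lintegral_congr fun x => ?_
        rw [rieszKernel_sub_comm]
    _ = _ := by
        rw [lintegral_const_mul'' _ (by fun_prop)]
        rfl

/-- The kernel `‖z‖⁻²` is a square root of `‖z‖⁻¹` under convolution, so the square norm of the
potential of order two is the Coulomb energy. This replaces Sobolev and Calderón–Zygmund theory when
the field has to be placed in `L²`. -/
lemma lintegral_rieszPotential_two_sq {f : R3 → ℝ} (hf : AEStronglyMeasurable f) :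
    ∫⁻ x, rieszPotential 2 f x ^ 2 = rieszCompConst * ∫⁻ y, rieszPotential 1 f y * ‖f y‖ₑ := by
  have hm := measurable_rieszPotential 2 hf
  calc ∫⁻ x, rieszPotential 2 f x ^ 2
      = ∫⁻ x, rieszPotential 2 f x * ∫⁻ y, rieszKernel 2 (x - y) * ‖f y‖ₑ := by
        refine lintegral_congr fun x => ?_
        rw [sq]; rfl
    _ = ∫⁻ y, (∫⁻ x, rieszKernel 2 (x - y) * rieszPotential 2 f x) * ‖f y‖ₑ :=
        lintegral_mul_comm_swap hf (measurable_rieszKernel 2) hm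
    _ = ∫⁻ y, rieszCompConst * (rieszPotential 1 f y * ‖f y‖ₑ) := by
        refine lintegral_congr fun y => ?_
        rw [lintegral_rieszKernel_mul_rieszPotential_two hf, mul_assoc]
    _ = _ := by
        have h2 : AEMeasurable (fun y => rieszPotential 1 f y * ‖f y‖ₑ) :=
          (measurable_rieszPotential 1 hf).aemeasurable.mul hf.enorm
        rw [lintegral_const_mul'' _ h2]

lemma lintegral_rieszPotential_two_sq_lt_top {f : R3 → ℝ} (hf : Integrable f) {P : ℝ≥0}
    (hP : ∀ x, rieszPotential 1 f x ≤ P) : ∫⁻ x, rieszPotential 2 f x ^ 2 < ⊤ := by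
  rw [lintegral_rieszPotential_two_sq hf.1]
  refine ENNReal.mul_lt_top rieszCompConst_ne_top.lt_top ?_
  calc _ ≤ ∫⁻ y, P * ‖f y‖ₑ := lintegral_mono fun y => by gcongr; exact hP y
    _ = P * ∫⁻ y, ‖f y‖ₑ := lintegral_const_mul'' _ hf.1.enorm
    _ < ⊤ := ENNReal.mul_lt_top ENNReal.coe_lt_top hf.2

/-! ### The sixth-power bound for potentials. -/

/-- Hölder's inequality with respect to the measure `|f| dy`. -/
lemma lintegral_mul_pow_six_le {f : R3 → ℝ} (hf : AEStronglyMeasurable f) {t : R3 → ℝ≥0∞}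
    (ht : Measurable t) :
    (∫⁻ y, t y * ‖f y‖ₑ) ^ 6 ≤ (∫⁻ y, ‖f y‖ₑ) ^ 5 * ∫⁻ y, t y ^ 6 * ‖f y‖ₑ := by
  have hpq : Real.HolderConjugate (6 / 5) 6 := by
    rw [Real.holderConjugate_iff]; norm_num
  have h := ENNReal.lintegral_mul_le_Lp_mul_Lq volume hpq
    (f := fun y => ‖f y‖ₑ ^ (5 / 6 : ℝ)) (g := fun y => ‖f y‖ₑ ^ (1 / 6 : ℝ) * t y)
    (hf.enorm.pow_const _) ((hf.enorm.pow_const _).mul ht.aemeasurable)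
  have e1 : ∀ y, ((fun y => ‖f y‖ₑ ^ (5 / 6 : ℝ)) * fun y => ‖f y‖ₑ ^ (1 / 6 : ℝ) * t y) y =
      t y * ‖f y‖ₑ := by
    intro y
    simp only [Pi.mul_apply]
    rw [← mul_assoc, ← ENNReal.rpow_add_of_nonneg _ _ (by norm_num) (by norm_num), mul_comm]
    norm_num
  have e2 : ∀ y, (‖f y‖ₑ ^ (5 / 6 : ℝ)) ^ (6 / 5 : ℝ) = ‖f y‖ₑ := by
    intro y; rw [← ENNReal.rpow_mul]; norm_num
  have e3 : ∀ y, (‖f y‖ₑ ^ (1 / 6 : ℝ) * t y) ^ (6 : ℝ) = t y ^ 6 * ‖f y‖ₑ := by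
    intro y
    rw [ENNReal.mul_rpow_of_nonneg _ _ (by norm_num), ← ENNReal.rpow_mul, mul_comm]
    norm_num
  rw [lintegral_congr e1, lintegral_congr e2, lintegral_congr e3] at h
  calc _ ≤ ((∫⁻ y, ‖f y‖ₑ) ^ (1 / (6 / 5) : ℝ) *
        (∫⁻ y, t y ^ 6 * ‖f y‖ₑ) ^ (1 / 6 : ℝ)) ^ 6 := by gcongr
    _ = _ := by
        rw [mul_pow, ← ENNReal.rpow_natCast, ← ENNReal.rpow_natCast, ← ENNReal.rpow_mul,
          ← ENNReal.rpow_mul, ← ENNReal.rpow_natCast]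
        norm_num

/-- The near part of the potential is bounded by `P` and integrable, hence in `L⁶`. The far kernel
is itself in `L⁶` because `‖z‖⁻⁶` is integrable at infinity, and convolution with an integrable
function keeps it there. -/
lemma lintegral_rieszPotential_one_pow_six_lt_top {f : R3 → ℝ} (hf : Integrable f) {P : ℝ≥0}
    (hP : ∀ x, rieszPotential 1 f x ≤ P) : ∫⁻ x, rieszPotential 1 f x ^ 6 < ⊤ := by
  set b : R3 → ℝ≥0∞ := (Metric.ball (0 : R3) 1).indicator (rieszKernel 1)
  set t : R3 → ℝ≥0∞ := (Metric.ball (0 : R3) 1)ᶜ.indicator (rieszKernel 1)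
  have hb : Measurable b := (measurable_rieszKernel 1).indicator measurableSet_ball
  have ht : Measurable t := (measurable_rieszKernel 1).indicator measurableSet_ball.compl
  have hbt : ∀ z, rieszKernel 1 z = b z + t z := fun z =>
    (congrFun (Set.indicator_self_add_compl (Metric.ball (0 : R3) 1) (rieszKernel 1)) z).symm
  have hbfin : ∫⁻ z, b z < ⊤ := by
    obtain ⟨C, hC⟩ := exists_lintegral_ball_rieszKernel (s := 1) (by norm_num)
    rw [lintegral_indicator measurableSet_ball, hC _ (by norm_num)]
    exact ENNReal.mul_lt_top ENNReal.coe_lt_top ENNReal.ofReal_lt_top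
  have htfin : ∫⁻ z, t z ^ 6 < ⊤ := by
    have : ∀ z, t z ^ 6 = (Metric.ball (0 : R3) 1)ᶜ.indicator (rieszKernel 6) z := by
      intro z
      by_cases hz : z ∈ (Metric.ball (0 : R3) 1)ᶜ
      · simp only [t]
        rw [Set.indicator_of_mem hz, Set.indicator_of_mem hz, rieszKernel, rieszKernel,
          ← ENNReal.ofReal_pow (by positivity), ← Real.rpow_natCast,
          ← Real.rpow_mul (norm_nonneg _)]
        norm_num
      · simp only [t]
        rw [Set.indicator_of_notMem hz, Set.indicator_of_notMem hz]
        simp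
    rw [lintegral_congr this, lintegral_indicator measurableSet_ball.compl]
    exact lintegral_compl_ball_rieszKernel_lt_top (by norm_num) (by norm_num)
  set N : R3 → ℝ≥0∞ := fun x => ∫⁻ y, b (x - y) * ‖f y‖ₑ
  set F : R3 → ℝ≥0∞ := fun x => ∫⁻ y, t (x - y) * ‖f y‖ₑ
  set T : R3 → ℝ≥0∞ := fun x => ∫⁻ y, t (x - y) ^ 6 * ‖f y‖ₑ
  set Q : ℝ≥0∞ := ∫⁻ y, ‖f y‖ₑ
  have hQ : Q < ⊤ := hf.2
  have hsplit : ∀ x, rieszPotential 1 f x = N x + F x := by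
    intro x
    have h2 : AEMeasurable (fun y => b (x - y) * ‖f y‖ₑ) :=
      (by fun_prop : Measurable fun y => b (x - y)).aemeasurable.mul hf.1.enorm
    change _ = (∫⁻ y, b (x - y) * ‖f y‖ₑ) + ∫⁻ y, t (x - y) * ‖f y‖ₑ
    rw [← lintegral_add_left' h2]
    refine lintegral_congr fun y => ?_
    rw [hbt, add_mul]
  have hswap : ∀ k : R3 → ℝ≥0∞, Measurable k →
      ∫⁻ x, ∫⁻ y, k (x - y) * ‖f y‖ₑ = (∫⁻ z, k z) * Q := by
    intro k hk
    have := lintegral_mul_comm_swap hf.1 hk measurable_one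
    simp only [Pi.one_apply, one_mul, mul_one] at this
    rw [this]
    simp_rw [lintegral_sub_right_eq_self (μ := (volume : Measure R3))]
    rw [lintegral_const_mul'' _ hf.1.enorm]
  have hle : ∀ x, rieszPotential 1 f x ^ 6 ≤ 64 * (P ^ 5 * N x) + 64 * (Q ^ 5 * T x) := by
    intro x
    have hN : N x ≤ P := le_trans (hsplit x ▸ le_self_add) (hP x)
    have hF : F x ^ 6 ≤ Q ^ 5 * T x := lintegral_mul_pow_six_le hf.1 (ht.comp (by fun_prop))
    have hN6 : N x ^ 6 ≤ P ^ 5 * N x := by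
      rw [pow_succ]; gcongr
    rw [hsplit x]
    rcases le_total (N x) (F x) with h | h
    · calc (N x + F x) ^ 6 ≤ (F x + F x) ^ 6 := by gcongr
        _ = 64 * F x ^ 6 := by ring
        _ ≤ 64 * (Q ^ 5 * T x) := by gcongr
        _ ≤ _ := le_add_self
    · calc (N x + F x) ^ 6 ≤ (N x + N x) ^ 6 := by gcongr
        _ = 64 * N x ^ 6 := by ring
        _ ≤ 64 * (P ^ 5 * N x) := by gcongr
        _ ≤ _ := le_self_add
  have hNm : AEMeasurable N := by
    have hm : Measurable (hf.1.mk f) := hf.1.stronglyMeasurable_mk.measurable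
    have e1 : N = fun x => ∫⁻ y, b (x - y) * ‖hf.1.mk f y‖ₑ := by
      ext x
      exact lintegral_congr_ae (by filter_upwards [hf.1.ae_eq_mk] with y hy; rw [hy])
    rw [e1]
    exact (Measurable.lintegral_prod_right' (f := fun p : R3 × R3 =>
      b (p.1 - p.2) * ‖hf.1.mk f p.2‖ₑ) (by fun_prop)).aemeasurable
  refine (lintegral_mono hle).trans_lt ?_
  have hc1 : (64 * P ^ 5 : ℝ≥0∞) ≠ ⊤ := by finiteness
  have hc2 : (64 * Q ^ 5 : ℝ≥0∞) ≠ ⊤ := by finiteness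
  simp_rw [← mul_assoc]
  rw [lintegral_add_left' (hNm.const_mul _), lintegral_const_mul'' _ hNm,
    lintegral_const_mul' _ _ hc2, hswap b hb, hswap _ (ht.pow_const 6)]
  exact ENNReal.add_lt_top.2 ⟨ENNReal.mul_lt_top hc1.lt_top (ENNReal.mul_lt_top hbfin hQ),
    ENNReal.mul_lt_top hc2.lt_top (ENNReal.mul_lt_top htfin hQ)⟩

/-! ### The Newtonian potential, its gradient and Hölder regularity. -/

/-- The Newtonian kernel `1 / (4π‖z‖)`. -/
def newtonKernel (z : R3) : ℝ := (4 * Real.pi)⁻¹ * ‖z‖⁻¹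

/-- The gradient of the Newtonian kernel. -/
def newtonGrad (z : R3) : R3 := -((4 * Real.pi)⁻¹ * (‖z‖ ^ 3)⁻¹) • z

/-- The Newtonian potential of `f`. -/
def newton (f : R3 → ℝ) (x : R3) : ℝ := ∫ y, newtonKernel (x - y) * f y

/-- The gradient of the Newtonian potential of `f`. -/
def newtonField (f : R3 → ℝ) (x : R3) : R3 := ∫ y, f y • newtonGrad (x - y)

@[fun_prop]
lemma measurable_newtonKernel : Measurable newtonKernel := by
  unfold newtonKernel; fun_prop

@[fun_prop]
lemma measurable_newtonGrad : Measurable newtonGrad := by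
  unfold newtonGrad; fun_prop

lemma four_pi_inv_le_one : (4 * Real.pi)⁻¹ ≤ 1 := by
  refine inv_le_one_of_one_le₀ ?_
  linarith [Real.pi_gt_three]

lemma newtonKernel_nonneg (z : R3) : 0 ≤ newtonKernel z := by
  unfold newtonKernel; positivity

lemma newtonKernel_sub_comm (x y : R3) : newtonKernel (x - y) = newtonKernel (y - x) := by
  rw [newtonKernel, newtonKernel, norm_sub_rev]

lemma newtonGrad_neg (z : R3) : newtonGrad (-z) = -newtonGrad z := by
  simp [newtonGrad]

lemma rieszKernel_one_eq (z : R3) : rieszKernel 1 z = ENNReal.ofReal ‖z‖⁻¹ := by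
  rw [rieszKernel, Real.rpow_neg_one]

lemma enorm_newtonKernel (z : R3) :
    ‖newtonKernel z‖ₑ = ENNReal.ofReal (4 * Real.pi)⁻¹ * rieszKernel 1 z := by
  rw [Real.enorm_of_nonneg (newtonKernel_nonneg z), newtonKernel,
    ENNReal.ofReal_mul (by positivity), rieszKernel_one_eq]

lemma enorm_newtonKernel_le (z : R3) : ‖newtonKernel z‖ₑ ≤ rieszKernel 1 z := by
  rw [enorm_newtonKernel]
  exact mul_le_of_le_one_left zero_le (by simpa using four_pi_inv_le_one)

lemma norm_newtonGrad_le (z : R3) : ‖newtonGrad z‖ ≤ ‖z‖ ^ (-2 : ℝ) := by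
  rcases eq_or_ne z 0 with rfl | hz
  · simp [newtonGrad]
  have h : 0 < ‖z‖ := norm_pos_iff.2 hz
  rw [newtonGrad, norm_smul, norm_neg, Real.norm_of_nonneg (by positivity), Real.rpow_neg h.le]
  calc (4 * Real.pi)⁻¹ * (‖z‖ ^ 3)⁻¹ * ‖z‖ ≤ 1 * (‖z‖ ^ 3)⁻¹ * ‖z‖ := by
        gcongr; exact four_pi_inv_le_one
    _ = _ := by
        norm_num
        field_simp

lemma enorm_newtonGrad_le (z : R3) : ‖newtonGrad z‖ₑ ≤ rieszKernel 2 z := by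
  rw [← ofReal_norm]
  exact ENNReal.ofReal_le_ofReal (norm_newtonGrad_le z)

/-- The first-order Taylor remainder of `1/‖z‖`. -/
lemma abs_inv_norm_taylor_le {z h : R3} (hz : z ≠ 0) (hzh : z + h ≠ 0) :
    |‖z + h‖⁻¹ - ‖z‖⁻¹ + (‖z‖ ^ 3)⁻¹ * inner ℝ z h| ≤
      ‖h‖ ^ 2 * ((‖z‖ ^ 2 * ‖z + h‖)⁻¹ + (‖z‖ ^ 3)⁻¹) := by
  have ha : 0 < ‖z‖ := norm_pos_iff.2 hz
  have hb : 0 < ‖z + h‖ := norm_pos_iff.2 hzh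
  have hab : |‖z + h‖ - ‖z‖| ≤ ‖h‖ := by
    simpa using abs_norm_sub_norm_le (z + h) z
  have hin : inner ℝ z h = (‖z + h‖ ^ 2 - ‖z‖ ^ 2 - ‖h‖ ^ 2) / 2 := by
    rw [norm_add_sq_real]; ring
  rw [hin]
  generalize ‖z‖ = a at *
  generalize ‖z + h‖ = b at *
  generalize ‖h‖ = r at *
  have hsq : (b - a) ^ 2 ≤ r ^ 2 := sq_le_sq' (by linarith [(abs_le.1 hab).1]) (abs_le.1 hab).2
  -- Only the side lengths `a`, `b`, `r` of the triangle enter. This identity displays the remainder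
  -- as quadratic in `b - a` and `r`, and `|b - a| ≤ r`.
  have e : b⁻¹ - a⁻¹ + (a ^ 3)⁻¹ * ((b ^ 2 - a ^ 2 - r ^ 2) / 2) =
      (b - a) ^ 2 * ((a ^ 2 * b)⁻¹ + (2 * a ^ 3)⁻¹) - r ^ 2 * (2 * a ^ 3)⁻¹ := by
    field_simp; ring
  have e2 : r ^ 2 * ((a ^ 2 * b)⁻¹ + (a ^ 3)⁻¹) =
      r ^ 2 * ((a ^ 2 * b)⁻¹ + (2 * a ^ 3)⁻¹) + r ^ 2 * (2 * a ^ 3)⁻¹ := by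
    field_simp; ring
  rw [e, e2]
  have h1 : (b - a) ^ 2 * ((a ^ 2 * b)⁻¹ + (2 * a ^ 3)⁻¹) ≤
      r ^ 2 * ((a ^ 2 * b)⁻¹ + (2 * a ^ 3)⁻¹) := by gcongr
  have h2 : 0 ≤ (b - a) ^ 2 * ((a ^ 2 * b)⁻¹ + (2 * a ^ 3)⁻¹) := by positivity
  have h3 : 0 ≤ r ^ 2 * (2 * a ^ 3)⁻¹ := by positivity
  rw [abs_le]
  constructor <;> linarith

lemma inv_le_rpow_mul_rpow {α a r c : ℝ} (hα : 0 ≤ α) (ha : 0 < a) (har : a ≤ c * r) :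
    a⁻¹ ≤ (c * r) ^ (1 + α) * a ^ (-(2 + α)) := by
  calc a⁻¹ = a ^ (1 + α) * a ^ (-(2 + α)) := by
        rw [← Real.rpow_add ha, ← Real.rpow_neg_one]; congr 1; ring
    _ ≤ _ := by gcongr

lemma rpow_one_add_le {α c r : ℝ} (hα1 : α ≤ 1) (hc : 1 ≤ c) (hr : 0 ≤ r) :
    (c * r) ^ (1 + α) ≤ c ^ 2 * r ^ (1 + α) := by
  rw [Real.mul_rpow (by linarith) hr]
  gcongr
  rw [← Real.rpow_natCast]
  exact Real.rpow_le_rpow_of_exponent_le hc (by push_cast; linarith)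

/-- The quadratic remainder carries the singularity `‖z‖⁻³`, which is not locally integrable.
Trading part of the power of `‖h‖` lowers it to `‖z‖^{-(2+α)}`, integrable near the pole once `α <
1`. -/
lemma abs_inv_norm_taylor_le_rpow {α : ℝ} (hα : 0 ≤ α) (hα1 : α ≤ 1) {z h : R3} (hz : z ≠ 0)
    (hzh : z + h ≠ 0) :
    |‖z + h‖⁻¹ - ‖z‖⁻¹ + (‖z‖ ^ 3)⁻¹ * inner ℝ z h| ≤
      9 * ‖h‖ ^ (1 + α) * (‖z‖ ^ (-(2 + α)) + ‖z + h‖ ^ (-(2 + α))) := by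
  have ha : 0 < ‖z‖ := norm_pos_iff.2 hz
  have hb : 0 < ‖z + h‖ := norm_pos_iff.2 hzh
  have hr : 0 ≤ ‖h‖ := norm_nonneg h
  have hA : 0 ≤ ‖z‖ ^ (-(2 + α)) := by positivity
  have hB : 0 ≤ ‖z + h‖ ^ (-(2 + α)) := by positivity
  have hH : 0 ≤ ‖h‖ ^ (1 + α) := by positivity
  -- For `h` short compared with `z`, `‖z + h‖` is comparable to `‖z‖` and the quadratic bound
  -- interpolates. Otherwise `‖z‖` and `‖z + h‖` are at most multiples of `‖h‖`, and the three terms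
  -- are estimated separately.
  by_cases hc : 2 * ‖h‖ ≤ ‖z‖
  · refine (abs_inv_norm_taylor_le hz hzh).trans ?_
    have hb2 : ‖z‖ / 2 ≤ ‖z + h‖ := by
      have := norm_sub_norm_le z (-h)
      rw [norm_neg, sub_neg_eq_add] at this
      linarith
    have h1 : (‖z‖ ^ 2 * ‖z + h‖)⁻¹ ≤ 2 * (‖z‖ ^ 3)⁻¹ := by
      calc (‖z‖ ^ 2 * ‖z + h‖)⁻¹ ≤ (‖z‖ ^ 2 * (‖z‖ / 2))⁻¹ := by gcongr
        _ = _ := by field_simp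
    have h2 : ‖h‖ ^ 2 * (‖z‖ ^ 3)⁻¹ ≤ ‖h‖ ^ (1 + α) * ‖z‖ ^ (-(2 + α)) := by
      have e1 : ‖h‖ ^ 2 = ‖h‖ ^ (1 + α) * ‖h‖ ^ (1 - α) := by
        rw [← Real.rpow_add_of_nonneg hr (by linarith) (by linarith), ← Real.rpow_natCast]
        congr 1; push_cast; ring
      have e2 : (‖z‖ ^ 3)⁻¹ = ‖z‖ ^ (-(2 + α)) * ‖z‖ ^ (-(1 - α)) := by
        rw [← Real.rpow_add ha, ← Real.rpow_natCast, ← Real.rpow_neg ha.le]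
        congr 1; push_cast; ring
      have e3 : ‖h‖ ^ (1 - α) * ‖z‖ ^ (-(1 - α)) ≤ 1 := by
        rw [Real.rpow_neg ha.le, ← div_eq_mul_inv]
        refine div_le_one_of_le₀ ?_ (by positivity)
        gcongr
        linarith
      rw [e1, e2]
      calc _ = ‖h‖ ^ (1 + α) * ‖z‖ ^ (-(2 + α)) * (‖h‖ ^ (1 - α) * ‖z‖ ^ (-(1 - α))) := by ring
        _ ≤ ‖h‖ ^ (1 + α) * ‖z‖ ^ (-(2 + α)) * 1 := by gcongr
        _ = _ := mul_one _
    calc ‖h‖ ^ 2 * ((‖z‖ ^ 2 * ‖z + h‖)⁻¹ + (‖z‖ ^ 3)⁻¹)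
        ≤ ‖h‖ ^ 2 * (2 * (‖z‖ ^ 3)⁻¹ + (‖z‖ ^ 3)⁻¹) := by gcongr
      _ = 3 * (‖h‖ ^ 2 * (‖z‖ ^ 3)⁻¹) := by ring
      _ ≤ 3 * (‖h‖ ^ (1 + α) * ‖z‖ ^ (-(2 + α))) := by gcongr
      _ ≤ _ := by nlinarith [mul_nonneg hH hA, mul_nonneg hH hB]
  · push Not at hc
    have hb3 : ‖z + h‖ ≤ 3 * ‖h‖ := by linarith [norm_add_le z h]
    have h1 := (inv_le_rpow_mul_rpow hα hb hb3).trans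
      (mul_le_mul_of_nonneg_right (rpow_one_add_le hα1 (by norm_num) hr) hB)
    have h2 := (inv_le_rpow_mul_rpow hα ha hc.le).trans
      (mul_le_mul_of_nonneg_right (rpow_one_add_le hα1 (by norm_num) hr) hA)
    have h3 : (‖z‖ ^ 3)⁻¹ * |inner ℝ z h| ≤ 4 * ‖h‖ ^ (1 + α) * ‖z‖ ^ (-(2 + α)) := by
      have hi : |inner ℝ z h| ≤ ‖z‖ * ‖h‖ := abs_real_inner_le_norm z h
      have hcr : ‖z‖ ^ α ≤ 2 * ‖h‖ ^ α := by
        calc ‖z‖ ^ α ≤ (2 * ‖h‖) ^ α := by gcongr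
          _ = 2 ^ α * ‖h‖ ^ α := Real.mul_rpow (by norm_num) hr
          _ ≤ 2 ^ (1 : ℝ) * ‖h‖ ^ α := by
              gcongr
              norm_num
          _ = _ := by rw [Real.rpow_one]
      calc (‖z‖ ^ 3)⁻¹ * |inner ℝ z h| ≤ (‖z‖ ^ 3)⁻¹ * (‖z‖ * ‖h‖) := by gcongr
        _ = ‖h‖ * ‖z‖ ^ (-2 : ℝ) := by
            rw [Real.rpow_neg ha.le]; norm_num; field_simp
        _ = ‖h‖ * (‖z‖ ^ α * ‖z‖ ^ (-(2 + α))) := by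
            rw [← Real.rpow_add ha]; congr 2; ring
        _ ≤ ‖h‖ * ((2 * ‖h‖ ^ α) * ‖z‖ ^ (-(2 + α))) := by gcongr
        _ = 2 * (‖h‖ ^ (1 + α) * ‖z‖ ^ (-(2 + α))) := by
            rw [Real.rpow_add_of_nonneg hr (by norm_num) hα, Real.rpow_one]; ring
        _ ≤ _ := by nlinarith [mul_nonneg hH hA]
    have hia : 0 ≤ ‖z‖⁻¹ := by positivity
    have hib : 0 ≤ ‖z + h‖⁻¹ := by positivity
    calc |‖z + h‖⁻¹ - ‖z‖⁻¹ + (‖z‖ ^ 3)⁻¹ * inner ℝ z h|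
        ≤ |‖z + h‖⁻¹ - ‖z‖⁻¹| + |(‖z‖ ^ 3)⁻¹ * inner ℝ z h| := abs_add_le _ _
      _ ≤ (‖z + h‖⁻¹ + ‖z‖⁻¹) + (‖z‖ ^ 3)⁻¹ * |inner ℝ z h| := by
          rw [abs_mul, abs_of_nonneg (a := (‖z‖ ^ 3)⁻¹) (by positivity)]
          gcongr
          rw [abs_le]; constructor <;> linarith
      _ ≤ _ := by nlinarith [mul_nonneg hH hA, mul_nonneg hH hB]

lemma abs_newtonKernel_taylor_le {α : ℝ} (hα : 0 ≤ α) (hα1 : α ≤ 1) {z h : R3} (hz : z ≠ 0)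
    (hzh : z + h ≠ 0) :
    |newtonKernel (z + h) - newtonKernel z - inner ℝ (newtonGrad z) h| ≤
      ‖h‖ ^ (1 + α) * (‖z‖ ^ (-(2 + α)) + ‖z + h‖ ^ (-(2 + α))) := by
  have e : newtonKernel (z + h) - newtonKernel z - inner ℝ (newtonGrad z) h =
      (4 * Real.pi)⁻¹ * (‖z + h‖⁻¹ - ‖z‖⁻¹ + (‖z‖ ^ 3)⁻¹ * inner ℝ z h) := by
    rw [newtonGrad, inner_smul_left, newtonKernel, newtonKernel]
    simp
    ring
  rw [e, abs_mul, abs_of_nonneg (a := (4 * Real.pi)⁻¹) (by positivity)]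
  have h9 : (4 * Real.pi)⁻¹ * 9 ≤ 1 := by
    rw [inv_mul_le_iff₀ (by positivity)]
    linarith [Real.pi_gt_three]
  calc _ ≤ (4 * Real.pi)⁻¹ * (9 * ‖h‖ ^ (1 + α) * (‖z‖ ^ (-(2 + α)) + ‖z + h‖ ^ (-(2 + α)))) := by
        gcongr; exact abs_inv_norm_taylor_le_rpow hα hα1 hz hzh
    _ = ((4 * Real.pi)⁻¹ * 9) * (‖h‖ ^ (1 + α) * (‖z‖ ^ (-(2 + α)) + ‖z + h‖ ^ (-(2 + α)))) := by
        ring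
    _ ≤ _ := mul_le_of_le_one_left (by positivity) h9

lemma integrable_newtonKernel_mul {f : R3 → ℝ} (hf : AEStronglyMeasurable f) {x : R3}
    (h : rieszPotential 1 f x ≠ ⊤) : Integrable fun y => newtonKernel (x - y) * f y := by
  refine ⟨(by fun_prop : Measurable fun y => newtonKernel (x - y)).aestronglyMeasurable.mul hf, ?_⟩
  refine lt_of_le_of_lt (lintegral_mono fun y => ?_) h.lt_top
  rw [enorm_mul]
  gcongr
  exact enorm_newtonKernel_le _

lemma integrable_smul_newtonGrad {f : R3 → ℝ} (hf : AEStronglyMeasurable f) {x : R3}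
    (h : rieszPotential 2 f x ≠ ⊤) : Integrable fun y => f y • newtonGrad (x - y) := by
  refine ⟨hf.smul (by fun_prop : Measurable fun y => newtonGrad (x - y)).aestronglyMeasurable, ?_⟩
  refine lt_of_le_of_lt (lintegral_mono fun y => ?_) h.lt_top
  rw [enorm_smul, mul_comm]
  gcongr
  exact enorm_newtonGrad_le _

lemma enorm_newton_le (f : R3 → ℝ) (x : R3) : ‖newton f x‖ₑ ≤ rieszPotential 1 f x := by
  refine (enorm_integral_le_lintegral_enorm _).trans (lintegral_mono fun y => ?_)
  rw [enorm_mul]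
  gcongr
  exact enorm_newtonKernel_le _

lemma enorm_newtonField_le (f : R3 → ℝ) (x : R3) :
    ‖newtonField f x‖ₑ ≤ rieszPotential 2 f x := by
  refine (enorm_integral_le_lintegral_enorm _).trans (lintegral_mono fun y => ?_)
  rw [enorm_smul, mul_comm]
  gcongr
  exact enorm_newtonGrad_le _

lemma newton_nonneg {f : R3 → ℝ} (hf : ∀ᵐ y, 0 ≤ f y) (x : R3) : 0 ≤ newton f x := by
  refine integral_nonneg_of_ae ?_
  filter_upwards [hf] with y hy
  exact mul_nonneg (newtonKernel_nonneg _) hy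

lemma newton_congr_ae {f g : R3 → ℝ} (h : f =ᵐ[volume] g) : newton f = newton g := by
  ext x
  refine integral_congr_ae ?_
  filter_upwards [h] with y hy
  rw [hy]

lemma newtonField_congr_ae {f g : R3 → ℝ} (h : f =ᵐ[volume] g) :
    newtonField f = newtonField g := by
  ext1 x
  refine integral_congr_ae ?_
  filter_upwards [h] with y hy
  rw [hy]

lemma stronglyMeasurable_newton {f : R3 → ℝ} (hf : AEStronglyMeasurable f) :
    StronglyMeasurable (newton f) := by
  rw [newton_congr_ae hf.ae_eq_mk]
  have hm : Measurable (hf.mk f) := hf.stronglyMeasurable_mk.measurable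
  exact StronglyMeasurable.integral_prod_right' (f := fun p : R3 × R3 =>
    newtonKernel (p.1 - p.2) * hf.mk f p.2) (by fun_prop : Measurable _).stronglyMeasurable

lemma stronglyMeasurable_newtonField {f : R3 → ℝ} (hf : AEStronglyMeasurable f) :
    StronglyMeasurable (newtonField f) := by
  rw [newtonField_congr_ae hf.ae_eq_mk]
  have hm : Measurable (hf.mk f) := hf.stronglyMeasurable_mk.measurable
  exact StronglyMeasurable.integral_prod_right' (f := fun p : R3 × R3 =>
    hf.mk f p.2 • newtonGrad (p.1 - p.2)) (by fun_prop : Measurable _).stronglyMeasurable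

/-- Integrating the kernel's Taylor estimate against `f` leaves Riesz potentials of order `2 + α` at
`x` and `x + h`. Both differentiability and the Hölder bound for the gradient come from this one
inequality. -/
lemma abs_newton_taylor_le {α : ℝ} (hα : 0 ≤ α) (hα1 : α ≤ 1) {f : R3 → ℝ}
    (hf : AEStronglyMeasurable f) (h1 : ∀ x, rieszPotential 1 f x ≠ ⊤)
    (h2 : ∀ x, rieszPotential 2 f x ≠ ⊤) {P : ℝ≥0}
    (hP : ∀ x, rieszPotential (2 + α) f x ≤ P) (x h : R3) :
    |newton f (x + h) - newton f x - inner ℝ (newtonField f x) h| ≤ 2 * P * ‖h‖ ^ (1 + α) := by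
  have i1 := integrable_newtonKernel_mul hf (h1 (x + h))
  have i2 := integrable_newtonKernel_mul hf (h1 x)
  have i3 := integrable_smul_newtonGrad hf (h2 x)
  have e3 : inner ℝ (newtonField f x) h = ∫ y, inner ℝ (newtonGrad (x - y)) h * f y := by
    rw [newtonField, real_inner_comm, ← integral_inner i3]
    refine integral_congr_ae (ae_of_all _ fun y => ?_)
    simp only
    rw [inner_smul_right, real_inner_comm, mul_comm]
  have i4 : Integrable fun y => inner ℝ (newtonGrad (x - y)) h * f y := by
    refine (i3.const_inner h).congr (ae_of_all _ fun y => ?_)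
    simp only
    rw [inner_smul_right, real_inner_comm, mul_comm]
  have e : newton f (x + h) - newton f x - inner ℝ (newtonField f x) h =
      ∫ y, (newtonKernel (x + h - y) - newtonKernel (x - y) -
        inner ℝ (newtonGrad (x - y)) h) * f y := by
    have i12 : Integrable fun y => newtonKernel (x + h - y) * f y - newtonKernel (x - y) * f y :=
      i1.sub i2
    rw [e3, newton, newton, ← integral_sub i1 i2, ← integral_sub i12 i4]
    refine integral_congr_ae (ae_of_all _ fun y => ?_)
    simp only
    ring
  have hmeas := measurable_rieszPotential (2 + α) hf
  have hle : ‖newton f (x + h) - newton f x - inner ℝ (newtonField f x) h‖ₑ ≤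
      ENNReal.ofReal (‖h‖ ^ (1 + α)) * (P + P) := by
    rw [e]
    calc _ ≤ ∫⁻ y, ENNReal.ofReal (‖h‖ ^ (1 + α)) * (rieszKernel (2 + α) (x - y) * ‖f y‖ₑ +
          rieszKernel (2 + α) (x + h - y) * ‖f y‖ₑ) := by
          refine (enorm_integral_le_lintegral_enorm _).trans ?_
          have n1 : ∀ᵐ y : R3, y ≠ x := by simp [ae_iff]
          have n2 : ∀ᵐ y : R3, y ≠ x + h := by simp [ae_iff]
          refine lintegral_mono_ae ?_
          filter_upwards [n1, n2] with y hy1 hy2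
          have hz : x - y ≠ 0 := sub_ne_zero.2 hy1.symm
          have hzh : x + h - y = (x - y) + h := by abel
          have hz2 : (x - y) + h ≠ 0 := by rw [← hzh]; exact sub_ne_zero.2 hy2.symm
          rw [enorm_mul, ← add_mul, ← mul_assoc, hzh]
          gcongr
          rw [rieszKernel, rieszKernel, ← ENNReal.ofReal_add (by positivity) (by positivity),
            ← ENNReal.ofReal_mul (by positivity), Real.enorm_eq_ofReal_abs]
          exact ENNReal.ofReal_le_ofReal (abs_newtonKernel_taylor_le hα hα1 hz hz2)
      _ = ENNReal.ofReal (‖h‖ ^ (1 + α)) *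
          (rieszPotential (2 + α) f x + rieszPotential (2 + α) f (x + h)) := by
          have m1 : AEMeasurable fun y => rieszKernel (2 + α) (x - y) * ‖f y‖ₑ :=
            (by fun_prop : Measurable fun y => rieszKernel (2 + α) (x - y)).aemeasurable.mul hf.enorm
          rw [lintegral_const_mul' _ _ ENNReal.ofReal_ne_top, lintegral_add_left' m1]
          rfl
      _ ≤ _ := by gcongr <;> exact hP _
  have hfin : ENNReal.ofReal (‖h‖ ^ (1 + α)) * (P + P) =
      ENNReal.ofReal (2 * P * ‖h‖ ^ (1 + α)) := by
    rw [mul_comm, ENNReal.ofReal_mul (by positivity), ENNReal.ofReal_mul (by positivity)]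
    simp [two_mul]
  rw [hfin, Real.enorm_eq_ofReal_abs] at hle
  exact (ENNReal.ofReal_le_ofReal_iff (by positivity)).1 hle

/-- A uniform Taylor estimate of order `1 + α` forces the gradient to be `α`-Hölder. -/
lemma norm_sub_le_of_taylor {α A : ℝ} (hα : 0 ≤ α) (hα1 : α ≤ 1) {u : R3 → ℝ} {E : R3 → R3}
    (hT : ∀ x h, |u (x + h) - u x - inner ℝ (E x) h| ≤ A * ‖h‖ ^ (1 + α)) (x h : R3) :
    ‖E (x + h) - E x‖ ≤ 6 * A * ‖h‖ ^ α := by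
  have hA : 0 ≤ A := by
    have := (abs_nonneg _).trans (hT 0 (EuclideanSpace.single (0 : Fin 3) (1 : ℝ)))
    simpa using this
  rcases eq_or_ne (E (x + h) - E x) 0 with hD | hD
  · rw [hD, norm_zero]; positivity
  rcases eq_or_ne h 0 with rfl | hh
  · simp at hD
  have hr : 0 < ‖h‖ := norm_pos_iff.2 hh
  have hDpos : 0 < ‖E (x + h) - E x‖ := norm_pos_iff.2 hD
  set D := E (x + h) - E x with hDdef
  -- The increment points along `D` and has the length of `h`. Expanding `u (x + h + k)` from `x +
  -- h` and from `x`, and `u (x + h)` from `x`, makes the values of `u` cancel; the errors add up to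
  -- `1 + 4 + 1 = 6`.
  set k : R3 := (‖h‖ / ‖D‖) • D with hk
  have hkn : ‖k‖ = ‖h‖ := by
    rw [hk, norm_smul, Real.norm_of_nonneg (by positivity)]; field_simp
  have hDk : inner ℝ D k = ‖h‖ * ‖D‖ := by
    rw [hk, inner_smul_right, real_inner_self_eq_norm_sq]; field_simp
  have t1 := hT (x + h) k
  have t2 := hT x (h + k)
  have t3 := hT x h
  have hhk : ‖h + k‖ ^ (1 + α) ≤ 4 * ‖h‖ ^ (1 + α) := by
    calc ‖h + k‖ ^ (1 + α) ≤ (2 * ‖h‖) ^ (1 + α) := by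
          gcongr
          linarith [norm_add_le h k]
      _ ≤ 2 ^ 2 * ‖h‖ ^ (1 + α) := rpow_one_add_le hα1 (by norm_num) hr.le
      _ = _ := by norm_num
  have t2' := t2.trans (mul_le_mul_of_nonneg_left hhk hA)
  rw [hkn] at t1
  rw [inner_add_right, ← add_assoc] at t2'
  have hsplit : inner ℝ D k = inner ℝ (E (x + h)) k - inner ℝ (E x) k := inner_sub_left _ _ _
  have hfinal : ‖h‖ * ‖D‖ ≤ 6 * A * ‖h‖ ^ (1 + α) := by
    rw [← hDk, hsplit]
    linarith [(abs_le.1 t1).1, (abs_le.1 t2').2, (abs_le.1 t3).1]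
  rw [Real.rpow_add hr, Real.rpow_one] at hfinal
  have : ‖h‖ * ‖D‖ ≤ ‖h‖ * (6 * A * ‖h‖ ^ α) := by linarith
  exact le_of_mul_le_mul_left this hr

lemma hasGradientAt_of_taylor {α A : ℝ} (hα : 0 < α) {u : R3 → ℝ} {E : R3 → R3}
    (h : ∀ x h, |u (x + h) - u x - inner ℝ (E x) h| ≤ A * ‖h‖ ^ (1 + α)) (x : R3) :
    HasGradientAt u (E x) x := by
  rw [hasGradientAt_iff_isLittleO_nhds_zero]
  refine Asymptotics.IsBigO.trans_isLittleO (g := fun h : R3 => ‖h‖ ^ (1 + α))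
    (Asymptotics.IsBigO.of_bound A (Eventually.of_forall fun k => ?_)) ?_
  · rw [Real.norm_eq_abs, Real.norm_of_nonneg (by positivity)]
    exact h x k
  · have : Tendsto (fun h : R3 => ‖h‖ ^ α) (𝓝 0) (𝓝 0) := by
      have := (continuous_norm.rpow_const (p := α) (fun _ => Or.inr hα.le)).tendsto (0 : R3)
      simpa [Real.zero_rpow hα.ne'] using this
    have h2 : (fun h : R3 => ‖h‖ * ‖h‖ ^ α) =o[𝓝 0] fun h : R3 => ‖h‖ * 1 :=
      (Asymptotics.isBigO_refl _ _).mul_isLittleO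
        ((Asymptotics.isLittleO_one_iff ℝ).2 this)
    refine (h2.congr (fun k => ?_) (fun k => mul_one _)).trans_isBigO
      (Asymptotics.isBigO_norm_left.2 (Asymptotics.isBigO_refl _ _))
    rw [Real.rpow_add_of_nonneg (norm_nonneg _) (by norm_num) hα.le, Real.rpow_one]

lemma exists_rieszPotential_le_of_le {s : ℝ} (hs : 0 ≤ s) (hs3 : s < 3) :
    ∃ C : ℝ≥0, ∀ (f : R3 → ℝ) (M : ℝ≥0), AEStronglyMeasurable f → eLpNorm f 1 volume ≤ M →
      eLpNorm f ⊤ volume ≤ M → ∀ x, rieszPotential s f x ≤ (C * M : ℝ≥0) := by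
  obtain ⟨C, hC⟩ := exists_rieszPotential_le hs hs3
  refine ⟨C + 1, fun f M hf h1 h2 x => (hC f hf x).trans ?_⟩
  push_cast
  rw [add_mul, one_mul]
  gcongr

lemma rieszPotential_lt_top {s : ℝ} (hs : 0 ≤ s) (hs3 : s < 3) {f : R3 → ℝ} (h1 : MemLp f 1)
    (h2 : MemLp f ⊤) : ∃ P : ℝ≥0, ∀ x, rieszPotential s f x ≤ P := by
  obtain ⟨C, hC⟩ := exists_rieszPotential_le hs hs3
  have hfin : C * eLpNorm f ⊤ volume + eLpNorm f 1 volume ≠ ⊤ :=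
    ENNReal.add_ne_top.2 ⟨ENNReal.mul_ne_top ENNReal.coe_ne_top h2.2.ne, h1.2.ne⟩
  exact ⟨_, fun x => (hC f h1.1 x).trans (ENNReal.coe_toNNReal hfin).ge⟩

lemma exists_newton_taylor {α : ℝ} (hα : 0 ≤ α) (hα1 : α < 1) {f : R3 → ℝ} (h1 : MemLp f 1)
    (h2 : MemLp f ⊤) : ∃ A : ℝ, ∀ x h,
      |newton f (x + h) - newton f x - inner ℝ (newtonField f x) h| ≤ A * ‖h‖ ^ (1 + α) := by
  obtain ⟨P1, hP1⟩ := rieszPotential_lt_top (s := 1) (by norm_num) (by norm_num) h1 h2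
  obtain ⟨P2, hP2⟩ := rieszPotential_lt_top (s := 2) (by norm_num) (by norm_num) h1 h2
  obtain ⟨P, hP⟩ := rieszPotential_lt_top (s := 2 + α) (by linarith) (by linarith) h1 h2
  exact ⟨2 * P, abs_newton_taylor_le hα hα1.le h1.1
    (fun x => ((hP1 x).trans_lt ENNReal.coe_lt_top).ne)
    (fun x => ((hP2 x).trans_lt ENNReal.coe_lt_top).ne) hP⟩

lemma hasGradientAt_newton {f : R3 → ℝ} (h1 : MemLp f 1) (h2 : MemLp f ⊤) (x : R3) :
    HasGradientAt (newton f) (newtonField f x) x := by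
  obtain ⟨A, hA⟩ := exists_newton_taylor (α := 1 / 2) (by norm_num) (by norm_num) h1 h2
  exact hasGradientAt_of_taylor (by norm_num) hA x

lemma gradient_newton {f : R3 → ℝ} (h1 : MemLp f 1) (h2 : MemLp f ⊤) :
    gradient (newton f) = newtonField f :=
  gradient_eq (hasGradientAt_newton h1 h2)

lemma holderWith_of_norm_add_sub_le {E : R3 → R3} {α C : ℝ≥0}
    (h : ∀ x h, ‖E (x + h) - E x‖ ≤ C * ‖h‖ ^ (α : ℝ)) : HolderWith C α E := by
  intro x y
  have := h y (x - y)
  rw [add_sub_cancel, ← dist_eq_norm, ← dist_eq_norm] at this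
  rw [edist_dist, edist_dist, ENNReal.ofReal_rpow_of_nonneg dist_nonneg (by positivity)]
  calc _ ≤ ENNReal.ofReal (C * dist x y ^ (α : ℝ)) := ENNReal.ofReal_le_ofReal this
    _ = _ := by rw [ENNReal.ofReal_mul (by positivity)]; simp

lemma contDiff_newton {f : R3 → ℝ} (h1 : MemLp f 1) (h2 : MemLp f ⊤) :
    ContDiff ℝ 1 (newton f) := by
  obtain ⟨A, hA⟩ := exists_newton_taylor (α := 1 / 2) (by norm_num) (by norm_num) h1 h2
  have hH : HolderWith (6 * A).toNNReal (1 / 2) (newtonField f) := by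
    have e : ((1 / 2 : ℝ≥0) : ℝ) = 1 / 2 := by norm_num
    refine holderWith_of_norm_add_sub_le fun x h => ?_
    refine (norm_sub_le_of_taylor (by norm_num) (by norm_num) hA x h).trans ?_
    rw [e]
    gcongr
    exact Real.le_coe_toNNReal _
  have hc : Continuous (newtonField f) := hH.continuous (by norm_num)
  rw [contDiff_one_iff_fderiv]
  have hg := hasGradientAt_newton h1 h2
  refine ⟨fun x => (hg x).differentiableAt, ?_⟩
  have : fderiv ℝ (newton f) = fun x => InnerProductSpace.toDual ℝ R3 (newtonField f x) := by
    ext1 x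
    exact (hg x).hasFDerivAt.fderiv
  rw [this]
  exact (InnerProductSpace.toDual ℝ R3).continuous.comp hc

/-- Global `C^{1,α}` estimate for Newtonian potentials of bounded integrable densities. -/
lemma exists_c1AlphaNorm_newton_le {α : ℝ≥0} (hα1 : α < 1) :
    ∃ C : ℝ≥0, ∀ (f : R3 → ℝ) (M : ℝ≥0), MemLp f 1 → MemLp f ⊤ → eLpNorm f 1 volume ≤ M →
      eLpNorm f ⊤ volume ≤ M → c1AlphaNorm α (newton f) ≤ (C * M : ℝ≥0) := by
  have hα1' : (α : ℝ) < 1 := by exact_mod_cast hα1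
  obtain ⟨C1, hC1⟩ := exists_rieszPotential_le_of_le (s := 1) (by norm_num) (by norm_num)
  obtain ⟨C2, hC2⟩ := exists_rieszPotential_le_of_le (s := 2) (by norm_num) (by norm_num)
  obtain ⟨C3, hC3⟩ := exists_rieszPotential_le_of_le (s := 2 + α) (by positivity) (by linarith)
  refine ⟨C1 + C2 + 12 * C3, fun f M m1 m2 h1 h2 => ?_⟩
  have H1 := hC1 f M m1.1 h1 h2
  have H2 := hC2 f M m1.1 h1 h2
  have H3 := hC3 f M m1.1 h1 h2
  have hT := abs_newton_taylor_le α.coe_nonneg hα1'.le m1.1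
    (fun x => ((H1 x).trans_lt ENNReal.coe_lt_top).ne)
    (fun x => ((H2 x).trans_lt ENNReal.coe_lt_top).ne) H3
  have hH : HolderWith (12 * C3 * M) α (newtonField f) := by
    refine holderWith_of_norm_add_sub_le fun x h => ?_
    refine (norm_sub_le_of_taylor α.coe_nonneg hα1'.le hT x h).trans (le_of_eq ?_)
    push_cast
    ring
  have hh : eHolderNorm α (newtonField f) ≤ (12 * C3 * M : ℝ≥0) := hH.eHolderNorm_le
  rw [c1AlphaNorm, gradient_newton m1 m2]
  calc _ ≤ ((C1 * M : ℝ≥0) : ℝ≥0∞) + (C2 * M : ℝ≥0) + (12 * C3 * M : ℝ≥0) := by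
        gcongr
        · exact iSup_le fun x => (enorm_newton_le f x).trans (H1 x)
        · exact iSup_le fun x => (enorm_newtonField_le f x).trans (H2 x)
    _ = _ := by push_cast; ring

/-! ### The Newtonian kernel as fundamental solution. -/

/-- Polar coordinates in `ℝ³`. -/
lemma integral_polar_R3 {F : R3 → ℝ} (hF : Integrable F) :
    ∫ z, F z = ∫ θ : Metric.sphere (0 : R3) 1, (∫ r in Set.Ioi (0 : ℝ), r ^ 2 * F (r • (θ : R3)))
      ∂(volume : Measure R3).toSphere := by
  set Φ := homeomorphUnitSphereProd R3
  set G : Metric.sphere (0 : R3) 1 × Set.Ioi (0 : ℝ) → ℝ := fun p => F ((p.2 : ℝ) • (p.1 : R3))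
  have hmp := (volume : Measure R3).measurePreserving_homeomorphUnitSphereProd
  rw [finrank_R3] at hmp
  have hGΦ : ∀ x : ({0}ᶜ : Set R3), G (Φ x) = F x := by
    intro x
    have hx : ‖(x : R3)‖ ≠ 0 := by
      have := x.2
      simpa [-Subtype.coe_prop] using this
    simp only [G, Φ, homeomorphUnitSphereProd_apply_fst_coe, homeomorphUnitSphereProd_apply_snd_coe]
    rw [smul_inv_smul₀ hx]
  have h1 : ∫ z, F z = ∫ x : ({0}ᶜ : Set R3), F x ∂((volume : Measure R3).comap (↑)) := by
    rw [integral_subtype_comap (measurableSet_singleton _).compl F,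
      restrict_compl_singleton]
  have h2 : ∫ x : ({0}ᶜ : Set R3), F x ∂((volume : Measure R3).comap (↑)) =
      ∫ p, G p ∂((volume : Measure R3).toSphere.prod (Measure.volumeIoiPow (3 - 1))) := by
    rw [← hmp.integral_comp (Homeomorph.measurableEmbedding _)]
    exact integral_congr_ae (ae_of_all _ fun x => (hGΦ x).symm)
  have hint : Integrable G
      ((volume : Measure R3).toSphere.prod (Measure.volumeIoiPow (3 - 1))) := by
    rw [← hmp.integrable_comp_emb (Homeomorph.measurableEmbedding _)]
    have : G ∘ Φ = fun x : ({0}ᶜ : Set R3) => F x := funext hGΦ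
    rw [this]
    have h3 : IntegrableOn F ({0}ᶜ : Set R3) := hF.integrableOn
    rw [integrableOn_iff_comap_subtypeVal (measurableSet_singleton _).compl] at h3
    exact h3
  rw [h1, h2, integral_prod _ hint]
  refine integral_congr_ae (ae_of_all _ fun θ => ?_)
  simp only [Measure.volumeIoiPow, ENNReal.ofReal]
  rw [integral_withDensity_eq_integral_smul
    (measurable_subtype_coe.pow_const _).real_toNNReal,
    integral_subtype_comap measurableSet_Ioi
      fun a => Real.toNNReal (a ^ (3 - 1)) • F (a • (θ : R3))]
  refine setIntegral_congr_fun measurableSet_Ioi fun x hx => ?_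
  rw [NNReal.smul_def, Real.coe_toNNReal _ (pow_nonneg (le_of_lt hx) _), smul_eq_mul]

lemma toSphere_real_univ_R3 :
    (volume : Measure R3).toSphere.real Set.univ = 4 * Real.pi := by
  rw [Measure.toSphere_real_apply_univ, finrank_R3, measureReal_def,
    EuclideanSpace.volume_ball_fin_three]
  simp
  rw [ENNReal.toReal_ofReal (by positivity)]
  ring

lemma IsTestFunction.contDiff_nat {φ : R3 → ℝ} (h : IsTestFunction φ) (n : ℕ) : ContDiff ℝ n φ :=
  contDiff_infty.1 h.1 n

lemma IsTestFunction.memLp {φ : R3 → ℝ} (h : IsTestFunction φ) (p : ℝ≥0∞) : MemLp φ p :=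
  h.1.continuous.memLp_of_hasCompactSupport h.2

lemma IsTestFunction.integrable {φ : R3 → ℝ} (h : IsTestFunction φ) : Integrable φ :=
  memLp_one_iff_integrable.1 (h.memLp 1)

lemma IsTestFunction.fderiv_apply {φ : R3 → ℝ} (h : IsTestFunction φ) (v : R3) :
    IsTestFunction fun x => fderiv ℝ φ x v :=
  ⟨(h.1.fderiv_right (m := (⊤ : ℕ∞)) (by simp)).clm_apply contDiff_const, h.2.fderiv_apply ℝ v⟩

lemma laplacian_eq_sum {φ : R3 → ℝ} (h : ContDiff ℝ 2 φ) (x : R3) :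
    Laplacian.laplacian φ x = ∑ i, fderiv ℝ (fun y => fderiv ℝ φ y (EuclideanSpace.single i 1)) x
      (EuclideanSpace.single i 1) := by
  rw [InnerProductSpace.laplacian_eq_iteratedFDeriv_orthonormalBasis φ
    (EuclideanSpace.basisFun (Fin 3) ℝ)]
  refine Finset.sum_congr rfl fun i _ => ?_
  rw [iteratedFDeriv_two_apply]
  have hd : DifferentiableAt ℝ (fderiv ℝ φ) x :=
    (h.fderiv_right (m := 1) (by norm_num)).differentiable (by norm_num) x
  simp only [EuclideanSpace.basisFun_apply, Matrix.cons_val_zero, Matrix.cons_val_one]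
  rw [fderiv_clm_apply hd (differentiableAt_const _)]
  simp

lemma IsTestFunction.laplacian {φ : R3 → ℝ} (h : IsTestFunction φ) :
    IsTestFunction (Laplacian.laplacian φ) := by
  have e : Laplacian.laplacian φ = fun x => ∑ i : Fin 3,
      fderiv ℝ (fun y => fderiv ℝ φ y (EuclideanSpace.single i 1)) x
        (EuclideanSpace.single i 1) :=
    funext fun x => laplacian_eq_sum (h.contDiff_nat 2) x
  have hi := fun i : Fin 3 =>
    (h.fderiv_apply (EuclideanSpace.single i 1)).fderiv_apply (EuclideanSpace.single i 1)
  rw [e]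
  refine ⟨ContDiff.sum fun i _ => (hi i).1, ?_⟩
  simp only [Fin.sum_univ_three]
  exact ((hi 0).2.add (hi 1).2).add (hi 2).2

lemma locallyIntegrable_newtonKernel : LocallyIntegrable newtonKernel := by
  refine locallyIntegrable_of_norm_le_rpow (C := 1) (α := 1) (by simp) (by simp)
    (ae_of_all _ fun x => ?_) measurable_newtonKernel.aestronglyMeasurable
  rw [Real.norm_of_nonneg (newtonKernel_nonneg x), newtonKernel, Real.rpow_neg_one]
  gcongr
  exact four_pi_inv_le_one

lemma newton_eq_convolution (φ : R3 → ℝ) :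
    newton φ = convolution newtonKernel φ (ContinuousLinearMap.mul ℝ ℝ) volume := by
  ext x
  rw [convolution_eq_swap]
  rfl

lemma contDiff_newton_of_test {φ : R3 → ℝ} (h : IsTestFunction φ) :
    ContDiff ℝ ∞ (newton φ) := by
  rw [newton_eq_convolution]
  exact h.2.contDiff_convolution_right _ locallyIntegrable_newtonKernel h.1

/-- Derivatives may be moved from the kernel onto a test function. -/
lemma newton_fderiv_apply {φ : R3 → ℝ} (h : IsTestFunction φ) (v x : R3) :
    newton (fun y => fderiv ℝ φ y v) x = inner ℝ (newtonField φ x) v := by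
  have h1 := hasGradientAt_newton (h.memLp 1) (h.memLp ⊤) x
  have h1' : ContDiff ℝ 1 φ := h.1.of_le (by exact_mod_cast le_top)
  have h2 := h.2.hasFDerivAt_convolution_right (ContinuousLinearMap.mul ℝ ℝ)
    locallyIntegrable_newtonKernel h1' x
  rw [← newton_eq_convolution] at h2
  rw [← h1.fderiv_apply, h2.fderiv, convolution_precompR_apply _ locallyIntegrable_newtonKernel
    (h.2.fderiv ℝ) (h1'.continuous_fderiv (by norm_num)), newton_eq_convolution]

/-- The Newtonian kernel is the fundamental solution of `-Δ`. -/
lemma newton_laplacian {φ : R3 → ℝ} (h : IsTestFunction φ) (x : R3) :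
    newton (Laplacian.laplacian φ) x = -φ x := by
  have hC1 : ContDiff ℝ 1 φ := h.1.of_le (by exact_mod_cast le_top)
  set e : Fin 3 → R3 := fun i => EuclideanSpace.single i 1
  have hi := fun i : Fin 3 => h.fderiv_apply (e i)
  have hR : ∀ {ψ : R3 → ℝ}, IsTestFunction ψ → ∀ s, 0 ≤ s → s < 3 → rieszPotential s ψ x ≠ ⊤ := by
    intro ψ hψ s hs hs3
    obtain ⟨P, hP⟩ := rieszPotential_lt_top hs hs3 (hψ.memLp 1) (hψ.memLp ⊤)
    exact ((hP x).trans_lt ENNReal.coe_lt_top).ne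
  have hint : ∀ i, Integrable fun y => fderiv ℝ φ y (e i) * inner ℝ (newtonGrad (x - y)) (e i) := by
    intro i
    refine ((integrable_smul_newtonGrad (hi i).integrable.1
      (hR (hi i) 2 (by norm_num) (by norm_num))).const_inner (e i)).congr
      (ae_of_all _ fun y => ?_)
    simp only
    rw [inner_smul_right, real_inner_comm]
  have hsum : ∀ y, ∑ i, fderiv ℝ φ y (e i) * inner ℝ (newtonGrad (x - y)) (e i) =
      fderiv ℝ φ y (newtonGrad (x - y)) := by
    intro y
    conv_rhs => rw [← (EuclideanSpace.basisFun (Fin 3) ℝ).sum_repr' (newtonGrad (x - y))]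
    rw [map_sum]
    refine Finset.sum_congr rfl fun i _ => ?_
    rw [map_smul, smul_eq_mul, EuclideanSpace.basisFun_apply, real_inner_comm, mul_comm]
  -- One of the two derivatives returns to the kernel, whose gradient is still locally integrable,
  -- so no small ball has to be excised.
  have h1 : newton (Laplacian.laplacian φ) x = ∫ y, fderiv ℝ φ y (newtonGrad (x - y)) := by
    calc newton (Laplacian.laplacian φ) x
        = ∑ i, newton (fun y => fderiv ℝ (fun z => fderiv ℝ φ z (e i)) y (e i)) x := by
          simp only [newton]
          rw [← integral_finsetSum _ fun i _ => integrable_newtonKernel_mul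
            ((hi i).fderiv_apply (e i)).integrable.1
            (hR ((hi i).fderiv_apply (e i)) 1 (by norm_num) (by norm_num))]
          refine integral_congr_ae (ae_of_all _ fun y => ?_)
          simp only
          rw [laplacian_eq_sum (h.contDiff_nat 2), Finset.mul_sum]
      _ = ∑ i, ∫ y, fderiv ℝ φ y (e i) * inner ℝ (newtonGrad (x - y)) (e i) := by
          refine Finset.sum_congr rfl fun i _ => ?_
          rw [newton_fderiv_apply (hi i), newtonField, real_inner_comm,
            ← integral_inner (integrable_smul_newtonGrad (hi i).integrable.1
              (hR (hi i) 2 (by norm_num) (by norm_num)))]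
          refine integral_congr_ae (ae_of_all _ fun y => ?_)
          simp only
          rw [inner_smul_right, real_inner_comm]
      _ = _ := by
          rw [← integral_finsetSum _ fun i _ => hint i]
          exact integral_congr_ae (ae_of_all _ hsum)
  have hintF : Integrable fun y => fderiv ℝ φ y (newtonGrad (x - y)) :=
    (integrable_finsetSum _ fun i _ => hint i).congr (ae_of_all _ hsum)
  have h2 : ∫ y, fderiv ℝ φ y (newtonGrad (x - y)) =
      ∫ z, fderiv ℝ φ (x - z) (newtonGrad z) := by
    rw [← integral_sub_left_eq_self (fun z => fderiv ℝ φ (x - z) (newtonGrad z)) volume x]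
    simp
  have hintF2 : Integrable fun z => fderiv ℝ φ (x - z) (newtonGrad z) := by
    have := hintF.comp_sub_left x
    simpa using this
  rw [h1, h2, integral_polar_R3 hintF2]
  -- The Jacobian `r²` cancels the inverse-square field exactly, leaving the integral of a
  -- derivative along the ray from `x`; it is independent of the direction.
  have hradial : ∀ θ : Metric.sphere (0 : R3) 1,
      ∫ r in Set.Ioi (0 : ℝ), r ^ 2 * fderiv ℝ φ (x - r • (θ : R3)) (newtonGrad (r • (θ : R3))) =
        -((4 * Real.pi)⁻¹ * φ x) := by
    intro θ
    have hθ : ‖(θ : R3)‖ = 1 := by simp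
    set ψ : ℝ → ℝ := fun r => φ (x - r • (θ : R3))
    have hψ : ContDiff ℝ 1 ψ := hC1.comp (by fun_prop)
    have hderiv : ∀ r, deriv ψ r = -fderiv ℝ φ (x - r • (θ : R3)) θ := by
      intro r
      have hl : HasDerivAt (fun r : ℝ => x - r • (θ : R3)) (-(θ : R3)) r := by
        simpa using ((hasDerivAt_id r).smul_const (θ : R3)).const_sub x
      have := ((hC1.differentiable (by norm_num)) (x - r • (θ : R3))).hasFDerivAt.comp_hasDerivAt r hl
      rw [map_neg] at this
      exact this.deriv
    have hsupp : HasCompactSupport ψ := by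
      have hce : Topology.IsClosedEmbedding fun r : ℝ => x - r • (θ : R3) := by
        have hiso : Isometry fun r : ℝ => x - r • (θ : R3) := by
          refine Isometry.of_dist_eq fun a b => ?_
          rw [dist_sub_left, dist_eq_norm, ← sub_smul, norm_smul, hθ, mul_one, dist_eq_norm]
        exact hiso.isClosedEmbedding
      exact h.2.comp_isClosedEmbedding hce
    have hI := hsupp.integral_Ioi_deriv_eq hψ 0
    have e0 : ψ 0 = φ x := by simp [ψ]
    rw [e0] at hI
    rw [← mul_neg, ← hI, ← integral_const_mul]
    refine setIntegral_congr_fun measurableSet_Ioi fun r hr => ?_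
    have hr0 : (0 : ℝ) < r := hr
    change r ^ 2 * fderiv ℝ φ (x - r • (θ : R3)) (newtonGrad (r • (θ : R3))) =
      (4 * Real.pi)⁻¹ * deriv ψ r
    rw [hderiv, newtonGrad, norm_smul, hθ, Real.norm_of_nonneg hr0.le, map_smul, map_smul]
    simp only [smul_eq_mul, mul_one]
    field_simp
  simp_rw [hradial]
  rw [integral_const, toSphere_real_univ_R3, smul_eq_mul]
  field_simp

/-! ### Weak equation, Sobolev membership and decay of Newtonian potentials. -/

/-- Fubini's theorem for convolution with a kernel dominated by a Riesz kernel. -/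
lemma integral_kernel_swap_of_lintegral {s c : ℝ} {k : R3 → ℝ} (hk : Measurable k)
    (hks : ∀ z, ‖k z‖ₑ ≤ ENNReal.ofReal c * rieszKernel s z) {f ψ : R3 → ℝ}
    (hf : AEStronglyMeasurable f) (hψ : AEStronglyMeasurable ψ)
    (hfin : ∫⁻ y, rieszPotential s ψ y * ‖f y‖ₑ ≠ ⊤) :
    ∫ x, (∫ y, k (x - y) * f y) * ψ x = ∫ y, f y * ∫ x, k (x - y) * ψ x := by
  have hm : AEStronglyMeasurable (Function.uncurry fun x y => k (x - y) * f y * ψ x)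
      ((volume : Measure R3).prod (volume : Measure R3)) := by
    refine AEStronglyMeasurable.mul (AEStronglyMeasurable.mul ?_ hf.comp_snd) hψ.comp_fst
    exact (by fun_prop : Measurable fun p : R3 × R3 => k (p.1 - p.2)).aestronglyMeasurable
  have hint : Integrable (Function.uncurry fun x y => k (x - y) * f y * ψ x)
      ((volume : Measure R3).prod (volume : Measure R3)) := by
    refine ⟨hm, ?_⟩
    rw [hasFiniteIntegral_iff_enorm, lintegral_prod_symm _ hm.enorm]
    calc ∫⁻ y, ∫⁻ x, ‖k (x - y) * f y * ψ x‖ₑ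
        ≤ ∫⁻ y, ENNReal.ofReal c * (rieszPotential s ψ y * ‖f y‖ₑ) := by
          refine lintegral_mono fun y => ?_
          calc ∫⁻ x, ‖k (x - y) * f y * ψ x‖ₑ
              ≤ ∫⁻ x, (ENNReal.ofReal c * ‖f y‖ₑ) * (rieszKernel s (y - x) * ‖ψ x‖ₑ) := by
                refine lintegral_mono fun x => ?_
                rw [enorm_mul, enorm_mul, rieszKernel_sub_comm s y x]
                calc _ ≤ ENNReal.ofReal c * rieszKernel s (x - y) * ‖f y‖ₑ * ‖ψ x‖ₑ := by
                      gcongr; exact hks _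
                  _ = _ := by ring
            _ = (ENNReal.ofReal c * ‖f y‖ₑ) * rieszPotential s ψ y := by
                rw [lintegral_const_mul' _ _ (by finiteness)]; rfl
            _ = _ := by ring
      _ = ENNReal.ofReal c * ∫⁻ y, rieszPotential s ψ y * ‖f y‖ₑ :=
          lintegral_const_mul' _ _ (by finiteness)
      _ < ⊤ := ENNReal.mul_lt_top (by finiteness) hfin.lt_top
  calc ∫ x, (∫ y, k (x - y) * f y) * ψ x = ∫ x, ∫ y, k (x - y) * f y * ψ x := by
        refine integral_congr_ae (ae_of_all _ fun x => ?_)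
        exact (integral_mul_const _ _).symm
    _ = ∫ y, ∫ x, k (x - y) * f y * ψ x := integral_integral_swap hint
    _ = _ := by
        refine integral_congr_ae (ae_of_all _ fun y => ?_)
        simp only
        rw [← integral_const_mul]
        refine integral_congr_ae (ae_of_all _ fun x => ?_)
        simp only
        ring

lemma integral_kernel_swap {s c : ℝ} {k : R3 → ℝ} (hk : Measurable k)
    (hks : ∀ z, ‖k z‖ₑ ≤ ENNReal.ofReal c * rieszKernel s z) {f ψ : R3 → ℝ} (hf : Integrable f)
    (hψ : AEStronglyMeasurable ψ) {P : ℝ≥0} (hP : ∀ x, rieszPotential s ψ x ≤ P) :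
    ∫ x, (∫ y, k (x - y) * f y) * ψ x = ∫ y, f y * ∫ x, k (x - y) * ψ x := by
  refine integral_kernel_swap_of_lintegral hk hks hf.1 hψ (lt_of_le_of_lt ?_
    (ENNReal.mul_lt_top (ENNReal.coe_lt_top (r := P)) hf.2)).ne
  rw [← lintegral_const_mul' _ _ ENNReal.coe_ne_top]
  exact lintegral_mono fun y => by gcongr; exact hP y

lemma integral_newton_mul {f ψ : R3 → ℝ} (hf : Integrable f) (hψ : AEStronglyMeasurable ψ)
    {P : ℝ≥0} (hP : ∀ x, rieszPotential 1 ψ x ≤ P) :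
    ∫ x, newton f x * ψ x = ∫ y, f y * newton ψ y := by
  have := integral_kernel_swap (s := 1) (c := 1) measurable_newtonKernel
    (fun z => by simpa using enorm_newtonKernel_le z) hf hψ hP
  simp only [newton]
  rw [this]
  refine integral_congr_ae (ae_of_all _ fun y => ?_)
  simp only
  congr 1
  refine integral_congr_ae (ae_of_all _ fun x => ?_)
  simp only
  rw [newtonKernel_sub_comm]

lemma IsTestFunction.exists_rieszPotential_le {φ : R3 → ℝ} (h : IsTestFunction φ) {s : ℝ}
    (hs : 0 ≤ s) (hs3 : s < 3) : ∃ P : ℝ≥0, ∀ x, rieszPotential s φ x ≤ P :=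
  rieszPotential_lt_top hs hs3 (h.memLp 1) (h.memLp ⊤)

lemma memLp_newton {f : R3 → ℝ} (hf : Integrable f) {P : ℝ≥0}
    (hP : ∀ x, rieszPotential 1 f x ≤ P) : MemLp (newton f) 6 := by
  refine ⟨(stronglyMeasurable_newton hf.1).aestronglyMeasurable, ?_⟩
  rw [eLpNorm_lt_top_iff_lintegral_rpow_enorm_lt_top (by simp) (by simp)]
  refine lt_of_le_of_lt (lintegral_mono fun x => ?_)
    (lintegral_rieszPotential_one_pow_six_lt_top hf hP)
  have : (6 : ℝ≥0∞).toReal = (6 : ℕ) := by simp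
  rw [this, ENNReal.rpow_natCast]
  gcongr
  exact enorm_newton_le f x

lemma memLp_newtonField {f : R3 → ℝ} (hf : Integrable f) {P : ℝ≥0}
    (hP : ∀ x, rieszPotential 1 f x ≤ P) : MemLp (newtonField f) 2 := by
  refine ⟨(stronglyMeasurable_newtonField hf.1).aestronglyMeasurable, ?_⟩
  rw [eLpNorm_lt_top_iff_lintegral_rpow_enorm_lt_top (by simp) (by simp)]
  refine lt_of_le_of_lt (lintegral_mono fun x => ?_)
    (lintegral_rieszPotential_two_sq_lt_top hf hP)
  have : (2 : ℝ≥0∞).toReal = (2 : ℕ) := by simp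
  rw [this, ENNReal.rpow_natCast]
  gcongr
  exact enorm_newtonField_le f x

lemma ae_rieszPotential_two_ne_top {f : R3 → ℝ} (hf : Integrable f) {P : ℝ≥0}
    (hP : ∀ x, rieszPotential 1 f x ≤ P) : ∀ᵐ x, rieszPotential 2 f x ≠ ⊤ := by
  have hm := measurable_rieszPotential 2 hf.1
  have := ae_lt_top (hm.pow_const 2) (lintegral_rieszPotential_two_sq_lt_top hf hP).ne
  filter_upwards [this] with x hx h
  simp [h] at hx

/-- Fubini moves both integrals onto `φ`, where the identity is the classical derivative of `newton
φ`; the sign comes from the oddness of `newtonGrad`. -/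
lemma hasWeakGradient_newton {f : R3 → ℝ} (hf : Integrable f) {P : ℝ≥0}
    (hP : ∀ x, rieszPotential 1 f x ≤ P) : HasWeakGradient (newton f) (newtonField f) := by
  refine ⟨(memLp_newton hf hP).locallyIntegrable (by norm_num),
    (memLp_newtonField hf hP).locallyIntegrable (by norm_num), fun φ hφ v => ?_⟩
  obtain ⟨P1, hP1⟩ := (hφ.fderiv_apply v).exists_rieszPotential_le (s := 1) (by norm_num)
    (by norm_num)
  obtain ⟨P2, hP2⟩ := hφ.exists_rieszPotential_le (s := 2) (by norm_num) (by norm_num)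
  rw [integral_newton_mul hf (hφ.fderiv_apply v).integrable.1 hP1]
  have hk : ∀ z, ‖inner ℝ (newtonGrad z) v‖ₑ ≤ ENNReal.ofReal ‖v‖ * rieszKernel 2 z := by
    intro z
    rw [← ofReal_norm, rieszKernel, ← ENNReal.ofReal_mul (norm_nonneg _)]
    refine ENNReal.ofReal_le_ofReal ((norm_inner_le_norm _ _).trans ?_)
    rw [mul_comm]
    gcongr
    exact norm_newtonGrad_le z
  have hsw := integral_kernel_swap (k := fun z => inner ℝ (newtonGrad z) v)
    (by fun_prop) hk hf hφ.integrable.1 hP2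
  have e1 : ∫ x, inner ℝ (newtonField f x) v * φ x =
      ∫ x, (∫ y, inner ℝ (newtonGrad (x - y)) v * f y) * φ x := by
    refine integral_congr_ae ?_
    -- For merely integrable `f` with bounded potential, absolute convergence of the field integral
    -- is known almost everywhere only, by the energy identity.
    filter_upwards [ae_rieszPotential_two_ne_top hf hP] with x hx
    congr 1
    rw [newtonField, real_inner_comm, ← integral_inner (integrable_smul_newtonGrad hf.1 hx)]
    refine integral_congr_ae (ae_of_all _ fun y => ?_)
    simp only
    rw [inner_smul_right, real_inner_comm, mul_comm]
  rw [e1, hsw, ← integral_neg]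
  refine integral_congr_ae (ae_of_all _ fun y => ?_)
  simp only
  rw [newton_fderiv_apply hφ, newtonField, real_inner_comm,
    ← integral_inner (integrable_smul_newtonGrad hφ.integrable.1
      ((hP2 y).trans_lt ENNReal.coe_lt_top).ne), ← mul_neg, ← integral_neg]
  congr 1
  refine integral_congr_ae (ae_of_all _ fun x => ?_)
  simp only
  rw [inner_smul_right, ← neg_sub x y, newtonGrad_neg, inner_neg_right, real_inner_comm]
  ring

lemma memHomSobolev_newton {f : R3 → ℝ} (hf : Integrable f) {P : ℝ≥0}
    (hP : ∀ x, rieszPotential 1 f x ≤ P) : MemHomSobolev (newton f) :=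
  ⟨memLp_newton hf hP, newtonField f, memLp_newtonField hf hP, hasWeakGradient_newton hf hP⟩

lemma isPoissonSolution_newton {f : R3 → ℝ} (hf : Integrable f) {P : ℝ≥0}
    (hP : ∀ x, rieszPotential 1 f x ≤ P) : IsPoissonSolution (newton f) (fun x => -f x) := by
  refine ⟨(memLp_newton hf hP).locallyIntegrable (by norm_num), hf.neg.locallyIntegrable,
    fun φ hφ => ?_⟩
  obtain ⟨P1, hP1⟩ := hφ.laplacian.exists_rieszPotential_le (s := 1) (by norm_num) (by norm_num)
  rw [integral_newton_mul hf hφ.laplacian.integrable.1 hP1]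
  refine integral_congr_ae (ae_of_all _ fun y => ?_)
  simp only
  rw [newton_laplacian hφ]
  ring

/-- The part of the kernel within radius `R` is uniformly small for small `R` by the `L^{5/3}`
bound; for fixed `R` the remaining bounded kernel tends to zero pointwise and dominated convergence
applies. -/
lemma tendsto_newton_cocompact {f : R3 → ℝ} (hf : Integrable f) (h53 : MemLp f (5 / 3)) :
    Tendsto (newton f) (cocompact R3) (𝓝 0) := by
  rw [tendsto_zero_iff_enorm_tendsto_zero]
  obtain ⟨C, hC⟩ := exists_rieszPotential_one_le
  rw [ENNReal.tendsto_nhds_zero]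
  intro ε hε
  have hε2 : 0 < ε / 2 := ENNReal.half_pos hε.ne'
  have hlim : Tendsto (fun R : ℝ => C * ENNReal.ofReal (R ^ (1 / 5 : ℝ)) *
      eLpNorm f (5 / 3) volume) (𝓝[>] 0) (𝓝 0) := by
    have h1 : Tendsto (fun R : ℝ => ENNReal.ofReal (R ^ (1 / 5 : ℝ))) (𝓝 0) (𝓝 0) := by
      have := (ENNReal.continuous_ofReal.comp
        (Real.continuous_rpow_const (q := 1 / 5) (by norm_num))).tendsto 0
      simpa [Real.zero_rpow, Function.comp_def] using this
    have h2 := ENNReal.Tendsto.mul_const (b := eLpNorm f (5 / 3) volume)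
      (ENNReal.Tendsto.const_mul (a := (C : ℝ≥0∞)) h1 (Or.inr ENNReal.coe_ne_top))
      (Or.inr h53.2.ne)
    simpa using h2.mono_left nhdsWithin_le_nhds
  obtain ⟨R, hRε, hR⟩ := ((ENNReal.tendsto_nhds_zero.1 hlim _ hε2).and
    self_mem_nhdsWithin).exists
  have hR : 0 < R := hR
  set t : R3 → ℝ≥0∞ := (Metric.ball (0 : R3) R)ᶜ.indicator (rieszKernel 1)
  have ht : Measurable t := (measurable_rieszKernel 1).indicator measurableSet_ball.compl
  have htR : ∀ z, t z ≤ ENNReal.ofReal (R ^ (-1 : ℝ)) := by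
    intro z
    by_cases hz : z ∈ (Metric.ball (0 : R3) R)ᶜ
    · simp only [t]
      rw [Set.indicator_of_mem hz]
      exact rieszKernel_le_of_le (by norm_num) hR (by simpa using hz)
    · simp only [t]
      rw [Set.indicator_of_notMem hz]
      exact zero_le
  have htlim : ∀ y, Tendsto (fun x => t (x - y)) (cocompact R3) (𝓝 0) := by
    intro y
    have h1 : Tendsto (fun x : R3 => ‖x - y‖) (cocompact R3) atTop :=
      (tendsto_norm_cocompact_atTop (E := R3)).comp
        (Homeomorph.subRight y).isClosedEmbedding.tendsto_cocompact
    have h2 : Tendsto (fun x : R3 => rieszKernel 1 (x - y)) (cocompact R3) (𝓝 0) := by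
      simp_rw [rieszKernel_one_eq]
      simpa using ENNReal.tendsto_ofReal (tendsto_inv_atTop_zero.comp h1)
    refine tendsto_of_tendsto_of_tendsto_of_le_of_le tendsto_const_nhds h2 (fun _ => zero_le)
      fun x => ?_
    exact Set.indicator_le_self' (fun _ _ => zero_le) _
  have : (cocompact R3).IsCountablyGenerated := by
    rw [← Metric.cobounded_eq_cocompact, ← comap_norm_atTop]
    infer_instance
  have hfar : Tendsto (fun x => ∫⁻ y, t (x - y) * ‖f y‖ₑ) (cocompact R3) (𝓝 (∫⁻ (_ : R3), (0 : ℝ≥0∞))) := by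
    refine tendsto_lintegral_filter_of_dominated_convergence'
      (fun y => ENNReal.ofReal (R ^ (-1 : ℝ)) * ‖f y‖ₑ) (Eventually.of_forall fun x => ?_)
      (Eventually.of_forall fun x => ae_of_all _ fun y => ?_) ?_ (ae_of_all _ fun y => ?_)
    · exact (by fun_prop : Measurable fun y => t (x - y)).aemeasurable.mul hf.1.enorm
    · gcongr
      exact htR _
    · rw [lintegral_const_mul' _ _ ENNReal.ofReal_ne_top]
      exact ENNReal.mul_ne_top ENNReal.ofReal_ne_top hf.2.ne
    · simpa using ENNReal.Tendsto.mul_const (htlim y) (Or.inr (by finiteness))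
  rw [lintegral_zero] at hfar
  filter_upwards [ENNReal.tendsto_nhds_zero.1 hfar _ hε2] with x hx
  have hb : AEMeasurable fun y => (Metric.ball (0 : R3) R).indicator (rieszKernel 1) (x - y) * ‖f y‖ₑ :=
    (measurable_nearKernel_sub 1 R x).aemeasurable.mul hf.1.enorm
  calc ‖newton f x‖ₑ ≤ rieszPotential 1 f x := enorm_newton_le f x
    _ = (∫⁻ y, (Metric.ball (0 : R3) R).indicator (rieszKernel 1) (x - y) * ‖f y‖ₑ) +
        ∫⁻ y, t (x - y) * ‖f y‖ₑ := by
        rw [← lintegral_add_left' hb]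
        refine lintegral_congr fun y => ?_
        rw [← add_mul]
        congr 1
        exact (congrFun (Set.indicator_self_add_compl (Metric.ball (0 : R3) R) (rieszKernel 1))
          (x - y)).symm
    _ ≤ ε / 2 + ε / 2 := add_le_add ((hC f hf.1 R hR x).trans hRε) hx
    _ = ε := ENNReal.add_halves ε

/-! ### Uniqueness: harmonic functions vanishing at infinity. -/

/-- The classical Laplacian of a product. -/
lemma laplacian_mul {a b : R3 → ℝ} (ha : ContDiff ℝ 2 a) (hb : ContDiff ℝ 2 b) (x : R3) :
    Laplacian.laplacian (fun y => a y * b y) x =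
      a x * Laplacian.laplacian b x +
        (∑ i : Fin 3, 2 * (fderiv ℝ a x (EuclideanSpace.single i 1) *
          fderiv ℝ b x (EuclideanSpace.single i 1)) + Laplacian.laplacian a x * b x) := by
  have hda := ha.differentiable (by norm_num)
  have hdb := hb.differentiable (by norm_num)
  have hda2 : ∀ v, Differentiable ℝ fun y => fderiv ℝ a y v := fun v =>
    ((ha.fderiv_right (m := 1) (by norm_num)).clm_apply contDiff_const).differentiable (by norm_num)
  have hdb2 : ∀ v, Differentiable ℝ fun y => fderiv ℝ b y v := fun v =>
    ((hb.fderiv_right (m := 1) (by norm_num)).clm_apply contDiff_const).differentiable (by norm_num)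
  rw [laplacian_eq_sum (ha.mul hb), laplacian_eq_sum ha, laplacian_eq_sum hb, Finset.mul_sum,
    Finset.sum_mul, ← Finset.sum_add_distrib, ← Finset.sum_add_distrib]
  refine Finset.sum_congr rfl fun i _ => ?_
  set e : R3 := EuclideanSpace.single i 1
  have h1 : (fun y => fderiv ℝ (fun z => a z * b z) y e) =
      fun y => a y * fderiv ℝ b y e + b y * fderiv ℝ a y e := by
    ext y
    rw [fderiv_fun_mul (hda y) (hdb y)]
    simp
  have d1 : DifferentiableAt ℝ (fun y => a y * fderiv ℝ b y e) x := (hda x).mul (hdb2 e x)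
  have d2 : DifferentiableAt ℝ (fun y => b y * fderiv ℝ a y e) x := (hdb x).mul (hda2 e x)
  rw [h1, fderiv_fun_add d1 d2,
    fderiv_fun_mul (hda x) (hdb2 e x), fderiv_fun_mul (hdb x) (hda2 e x)]
  simp
  ring

lemma newton_fderiv_eq {φ : R3 → ℝ} (h : IsTestFunction φ) (v x : R3) :
    fderiv ℝ (newton φ) x v = newton (fun y => fderiv ℝ φ y v) x := by
  rw [newton_fderiv_apply h, (hasGradientAt_newton (h.memLp 1) (h.memLp ⊤) x).fderiv_apply]

lemma laplacian_newton {φ : R3 → ℝ} (h : IsTestFunction φ) (x : R3) :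
    Laplacian.laplacian (newton φ) x = -φ x := by
  rw [← newton_laplacian h, laplacian_eq_sum (contDiff_infty.1 (contDiff_newton_of_test h) 2)]
  have hi := fun i : Fin 3 => h.fderiv_apply (EuclideanSpace.single i (1 : ℝ))
  have hii := fun i : Fin 3 => (hi i).fderiv_apply (EuclideanSpace.single i (1 : ℝ))
  have e1 : ∀ i : Fin 3, fderiv ℝ (fun y => fderiv ℝ (newton φ) y (EuclideanSpace.single i 1)) x
      (EuclideanSpace.single i 1) = newton (fun z => fderiv ℝ (fun y =>
        fderiv ℝ φ y (EuclideanSpace.single i 1)) z (EuclideanSpace.single i 1)) x := by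
    intro i
    have : (fun y => fderiv ℝ (newton φ) y (EuclideanSpace.single i 1)) =
        newton fun z => fderiv ℝ φ z (EuclideanSpace.single i 1) :=
      funext fun y => newton_fderiv_eq h _ y
    rw [this, newton_fderiv_eq (hi i)]
  simp_rw [e1]
  simp only [newton]
  rw [← integral_finsetSum _ fun i _ => integrable_newtonKernel_mul (hii i).integrable.1 ?_]
  · refine integral_congr_ae (ae_of_all _ fun y => ?_)
    simp only
    rw [laplacian_eq_sum (h.contDiff_nat 2), Finset.mul_sum]
  · obtain ⟨P, hP⟩ := (hii i).exists_rieszPotential_le (s := 1) (by norm_num) (by norm_num)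
    exact ((hP x).trans_lt ENNReal.coe_lt_top).ne

/-- Away from the support of the density the Riesz potential decays like the kernel. -/
lemma rieszPotential_le_of_support {φ : R3 → ℝ} {s R₀ : ℝ} (hs : 0 ≤ s)
    (hφ : AEStronglyMeasurable φ) (hsupp : ∀ y, R₀ < ‖y‖ → φ y = 0) {x : R3} {R : ℝ} (hR : 0 < R)
    (hR₀ : 2 * R₀ ≤ R) (hx : R ≤ ‖x‖) :
    rieszPotential s φ x ≤ ENNReal.ofReal ((R / 2) ^ (-s)) * eLpNorm φ 1 volume := by
  rw [eLpNorm_one_eq_lintegral_enorm, ← lintegral_const_mul'' _ hφ.enorm]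
  refine lintegral_mono fun y => ?_
  by_cases hy : R₀ < ‖y‖
  · simp [hsupp y hy]
  · gcongr
    refine rieszKernel_le_of_le hs (by positivity) ?_
    have := norm_sub_norm_le x y
    push Not at hy
    linarith

lemma fderiv_comp_smul_apply {χ : R3 → ℝ} (hχ : Differentiable ℝ χ) (c : ℝ) (x v : R3) :
    fderiv ℝ (fun y => χ (c • y)) x v = c * fderiv ℝ χ (c • x) v := by
  have h1 : HasFDerivAt (fun y : R3 => c • y) (c • ContinuousLinearMap.id ℝ R3) x :=
    (hasFDerivAt_id x).const_smul c
  have := ((hχ (c • x)).hasFDerivAt.comp x h1).fderiv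
  rw [Function.comp_def] at this
  rw [this]
  simp

lemma laplacian_comp_smul {χ : R3 → ℝ} (hχ : ContDiff ℝ 2 χ) (c : ℝ) (x : R3) :
    Laplacian.laplacian (fun y => χ (c • y)) x = c ^ 2 * Laplacian.laplacian χ (c • x) := by
  have h2 : ContDiff ℝ 2 fun y => χ (c • y) := hχ.comp (by fun_prop)
  rw [laplacian_eq_sum h2, laplacian_eq_sum hχ, Finset.mul_sum]
  refine Finset.sum_congr rfl fun i _ => ?_
  have hd : Differentiable ℝ χ := hχ.differentiable (by norm_num)
  have hd2 : Differentiable ℝ fun y => fderiv ℝ χ y (EuclideanSpace.single i 1) :=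
    ((hχ.fderiv_right (m := 1) (by norm_num)).clm_apply contDiff_const).differentiable (by norm_num)
  simp_rw [fderiv_comp_smul_apply hd]
  have hd3 : DifferentiableAt ℝ (fun y => fderiv ℝ χ (c • y) (EuclideanSpace.single i 1)) x :=
    hd2.comp (by fun_prop : Differentiable ℝ fun y : R3 => c • y) x
  rw [fderiv_const_mul hd3]
  simp only [smul_apply, smul_eq_mul]
  rw [fderiv_comp_smul_apply hd2 c x (EuclideanSpace.single i 1)]
  ring

lemma IsTestFunction.exists_bound {φ : R3 → ℝ} (h : IsTestFunction φ) :
    ∃ B : ℝ, 0 ≤ B ∧ ∀ x, |φ x| ≤ B := by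
  obtain ⟨B, hB⟩ := h.2.exists_bound_of_continuous h.1.continuous
  exact ⟨B, (norm_nonneg _).trans (hB 0), hB⟩

/-- A smooth cutoff at scale one. -/
def cutoff : ContDiffBump (0 : R3) := ⟨1, 2, one_pos, one_lt_two⟩

lemma isTestFunction_cutoff : IsTestFunction cutoff := ⟨cutoff.contDiff, cutoff.hasCompactSupport⟩

lemma cutoff_eq_one {x : R3} (h : ‖x‖ ≤ 1) : cutoff x = 1 :=
  cutoff.one_of_mem_closedBall (by simpa [cutoff] using h)

lemma cutoff_eq_zero {x : R3} (h : 2 ≤ ‖x‖) : cutoff x = 0 :=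
  cutoff.zero_of_le_dist (by simpa [cutoff] using h)

lemma fderiv_cutoff_eq_zero {x : R3} (h : ‖x‖ < 1 ∨ 2 < ‖x‖) : fderiv ℝ cutoff x = 0 := by
  rcases h with h | h
  · have : (cutoff : R3 → ℝ) =ᶠ[𝓝 x] fun _ => 1 := by
      filter_upwards [(isOpen_lt continuous_norm continuous_const).mem_nhds h] with y hy
      exact cutoff_eq_one (le_of_lt hy)
    rw [this.fderiv_eq]; simp
  · have : (cutoff : R3 → ℝ) =ᶠ[𝓝 x] fun _ => 0 := by
      filter_upwards [(isOpen_lt continuous_const continuous_norm).mem_nhds h] with y hy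
      exact cutoff_eq_zero (le_of_lt hy)
    rw [this.fderiv_eq]; simp

lemma laplacian_cutoff_eq_zero {x : R3} (h : ‖x‖ < 1 ∨ 2 < ‖x‖) :
    Laplacian.laplacian (cutoff : R3 → ℝ) x = 0 := by
  rw [laplacian_eq_sum (isTestFunction_cutoff.contDiff_nat 2)]
  refine Finset.sum_eq_zero fun i _ => ?_
  have hopen : IsOpen {y : R3 | ‖y‖ < 1 ∨ 2 < ‖y‖} :=
    (isOpen_lt continuous_norm continuous_const).union (isOpen_lt continuous_const continuous_norm)
  have : (fun y => fderiv ℝ cutoff y (EuclideanSpace.single i 1)) =ᶠ[𝓝 x] fun _ => 0 := by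
    filter_upwards [hopen.mem_nhds h] with y hy
    rw [fderiv_cutoff_eq_zero hy]; simp
  rw [this.fderiv_eq]; simp

/-- The commutator terms in `Δ(χ_R N φ)` are `O(R⁻³)` and live on the annulus `R ≤ ‖x‖ ≤ 2R`. -/
lemma exists_laplacian_cutoff_newton {φ : R3 → ℝ} (hφ : IsTestFunction φ) :
    ∃ (B R₀ : ℝ), 0 < R₀ ∧ 0 ≤ B ∧ ∀ R, R₀ ≤ R →
      IsTestFunction (fun y => cutoff (R⁻¹ • y) * newton φ y) ∧
      ∃ g : R3 → ℝ, Continuous g ∧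
        (∀ x, Laplacian.laplacian (fun y => cutoff (R⁻¹ • y) * newton φ y) x = -φ x + g x) ∧
        (∀ x, |g x| ≤ B * R ^ (-3 : ℝ)) ∧ ∀ x, (‖x‖ < R ∨ 2 * R < ‖x‖) → g x = 0 := by
  obtain ⟨r, hr⟩ := hφ.2.isBounded.subset_closedBall (0 : R3)
  set R₁ : ℝ := max r 1
  have hR₁ : 0 < R₁ := lt_max_of_lt_right one_pos
  have hsupp : ∀ y, R₁ < ‖y‖ → φ y = 0 := by
    intro y hy
    by_contra hne
    have := hr (subset_tsupport φ (Function.mem_support.2 hne))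
    rw [mem_closedBall_zero_iff] at this
    exact absurd (this.trans (le_max_left r 1)) (not_le.2 hy)
  obtain ⟨B₁, hB₁, hb₁⟩ := isTestFunction_cutoff.laplacian.exists_bound
  choose D hD0 hD using fun i : Fin 3 =>
    (isTestFunction_cutoff.fderiv_apply (EuclideanSpace.single i 1)).exists_bound
  set A : ℝ := (eLpNorm φ 1 volume).toReal
  have hA : eLpNorm φ 1 volume = ENNReal.ofReal A :=
    (ENNReal.ofReal_toReal (hφ.memLp 1).2.ne).symm
  have hA0 : 0 ≤ A := ENNReal.toReal_nonneg
  -- The potential decays like `R⁻¹` and its gradient like `R⁻²`; the first and second derivatives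
  -- of the rescaled cutoff supply the missing `R⁻¹` and `R⁻²`.
  have hN : ∀ R x, 2 * R₁ ≤ R → R ≤ ‖x‖ → |newton φ x| ≤ 2 * A * R⁻¹ := by
    intro R x hR hx
    have hR0 : 0 < R := by linarith
    have h1 := (enorm_newton_le φ x).trans (rieszPotential_le_of_support (by norm_num)
      hφ.integrable.1 hsupp hR0 hR hx)
    rw [hA, ← ENNReal.ofReal_mul (by positivity), Real.enorm_eq_ofReal_abs] at h1
    refine ((ENNReal.ofReal_le_ofReal_iff (by positivity)).1 h1).trans (le_of_eq ?_)
    rw [Real.rpow_neg_one]; field_simp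
  have hE : ∀ R x, 2 * R₁ ≤ R → R ≤ ‖x‖ → ‖newtonField φ x‖ ≤ 4 * A * (R ^ 2)⁻¹ := by
    intro R x hR hx
    have hR0 : 0 < R := by linarith
    have h1 := (enorm_newtonField_le φ x).trans (rieszPotential_le_of_support (by norm_num)
      hφ.integrable.1 hsupp hR0 hR hx)
    rw [hA, ← ENNReal.ofReal_mul (by positivity), ← ofReal_norm] at h1
    refine ((ENNReal.ofReal_le_ofReal_iff (by positivity)).1 h1).trans (le_of_eq ?_)
    rw [Real.rpow_neg (by positivity)]
    norm_num
    field_simp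
    ring
  have hNs := contDiff_newton_of_test hφ
  refine ⟨∑ i, 2 * (D i * (4 * A)) + B₁ * (2 * A), 2 * R₁, by positivity,
    add_nonneg (Finset.sum_nonneg fun i _ => ?_) (by positivity), fun R hR => ?_⟩
  · have := hD0 i
    positivity
  have hR0 : 0 < R := by linarith
  have hχs : ContDiff ℝ ∞ fun y : R3 => cutoff (R⁻¹ • y) := cutoff.contDiff.comp (by fun_prop)
  have hχc : HasCompactSupport fun y : R3 => cutoff (R⁻¹ • y) :=
    cutoff.hasCompactSupport.comp_smul (inv_ne_zero hR0.ne')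
  have hC1 : Differentiable ℝ (cutoff : R3 → ℝ) :=
    (isTestFunction_cutoff.contDiff_nat 1).differentiable (by norm_num)
  have hnorm : ∀ x : R3, ‖R⁻¹ • x‖ = R⁻¹ * ‖x‖ := fun x => by
    rw [norm_smul, Real.norm_of_nonneg (by positivity)]
  have hout : ∀ x : R3, (‖x‖ < R ∨ 2 * R < ‖x‖) → (‖R⁻¹ • x‖ < 1 ∨ 2 < ‖R⁻¹ • x‖) := by
    intro x hx
    rw [hnorm, inv_mul_lt_iff₀ hR0, lt_inv_mul_iff₀ hR0]
    rcases hx with h | h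
    · left; linarith
    · right; linarith
  refine ⟨⟨hχs.mul hNs, hχc.mul_right⟩, fun x =>
    ∑ i : Fin 3, 2 * ((R⁻¹ * fderiv ℝ cutoff (R⁻¹ • x) (EuclideanSpace.single i 1)) *
      fderiv ℝ (newton φ) x (EuclideanSpace.single i 1)) +
      ((R⁻¹) ^ 2 * Laplacian.laplacian (cutoff : R3 → ℝ) (R⁻¹ • x)) * newton φ x, ?_, ?_, ?_, ?_⟩
  · have c1 : ∀ i : Fin 3, Continuous fun x =>
        fderiv ℝ cutoff (R⁻¹ • x) (EuclideanSpace.single i 1) := fun i =>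
      (isTestFunction_cutoff.fderiv_apply (EuclideanSpace.single i 1)).1.continuous.comp
        (by fun_prop)
    have c2 : ∀ i : Fin 3, Continuous fun x =>
        fderiv ℝ (newton φ) x (EuclideanSpace.single i 1) := fun i =>
      ((hNs.continuous_fderiv (by simp)).clm_apply continuous_const)
    have c3 : Continuous fun x => Laplacian.laplacian (cutoff : R3 → ℝ) (R⁻¹ • x) :=
      isTestFunction_cutoff.laplacian.1.continuous.comp (by fun_prop)
    have c4 := hNs.continuous
    fun_prop
  · intro x
    rw [laplacian_mul (contDiff_infty.1 hχs 2) (contDiff_infty.1 hNs 2), laplacian_newton hφ,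
      laplacian_comp_smul (isTestFunction_cutoff.contDiff_nat 2)]
    simp_rw [fderiv_comp_smul_apply hC1]
    congr 1
    by_cases hx : R₁ < ‖x‖
    · simp [hsupp x hx]
    · rw [cutoff_eq_one, one_mul]
      rw [hnorm, inv_mul_le_iff₀ hR0]
      push Not at hx
      linarith
  · intro x
    by_cases hx : ‖x‖ < R
    · have h1 := hout x (Or.inl hx)
      simp only [fderiv_cutoff_eq_zero h1, laplacian_cutoff_eq_zero h1]
      have h2 : 0 ≤ ∑ i, 2 * (D i * (4 * A)) := Finset.sum_nonneg fun i _ => by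
        have := hD0 i
        positivity
      simp only [zero_apply, mul_zero, zero_mul, Finset.sum_const_zero,
        add_zero, abs_zero]
      positivity
    push Not at hx
    have hR3 : R ^ (-3 : ℝ) = (R ^ 3)⁻¹ := by
      rw [Real.rpow_neg hR0.le]; norm_num
    have hgrad : ∀ i : Fin 3, |fderiv ℝ (newton φ) x (EuclideanSpace.single i 1)| ≤
        4 * A * (R ^ 2)⁻¹ := by
      intro i
      rw [(hasGradientAt_newton (hφ.memLp 1) (hφ.memLp ⊤) x).fderiv_apply]
      refine (abs_real_inner_le_norm _ _).trans ?_
      simpa using hE R x hR hx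
    rw [hR3, add_mul, Finset.sum_mul]
    refine (abs_add_le _ _).trans (add_le_add ((Finset.abs_sum_le_sum_abs _ _).trans
      (Finset.sum_le_sum fun i _ => ?_)) ?_)
    · rw [abs_mul, abs_mul, abs_mul, abs_of_pos (inv_pos.2 hR0), abs_two]
      calc _ ≤ 2 * (R⁻¹ * D i * (4 * A * (R ^ 2)⁻¹)) := by
            have := hD0 i
            refine mul_le_mul_of_nonneg_left (mul_le_mul ?_ (hgrad i) (abs_nonneg _)
              (by positivity)) (by norm_num)
            exact mul_le_mul_of_nonneg_left (hD i _) (by positivity)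
        _ = _ := by field_simp
    · rw [abs_mul, abs_mul, abs_of_pos (by positivity : 0 < R⁻¹ ^ 2)]
      calc _ ≤ R⁻¹ ^ 2 * B₁ * (2 * A * R⁻¹) := by
            gcongr
            · exact hb₁ _
            · exact hN R x hR hx
        _ = _ := by field_simp
  · intro x hx
    have h1 := hout x hx
    simp only [fderiv_cutoff_eq_zero h1, laplacian_cutoff_eq_zero h1]
    simp

/-- A distributional harmonic function that vanishes at infinity is zero. -/
lemma ae_eq_zero_of_laplacian_eq_zero {d : R3 → ℝ} (hd : LocallyIntegrable d)
    (hlim : Tendsto d (cocompact R3 ⊓ ae volume) (𝓝 0))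
    (hΔ : ∀ φ, IsTestFunction φ → ∫ x, d x * Laplacian.laplacian φ x = 0) :
    d =ᵐ[volume] 0 := by
  refine ae_eq_zero_of_integral_contDiff_smul_eq_zero hd fun φ h1 h2 => ?_
  have hφ : IsTestFunction φ := ⟨h1, h2⟩
  obtain ⟨B, R₀, hR₀, hB, H⟩ := exists_laplacian_cutoff_newton hφ
  -- The volume of a ball of radius `2R` is `V R³`, which cancels the factor `R⁻³` in the bound for
  -- `g`.
  set V : ℝ := 32 * Real.pi / 3
  have hV : 0 < V := by positivity
  have key : ∀ ε : ℝ, 0 < ε → |∫ x, φ x • d x| ≤ ε * (B * V) := by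
    intro ε hε
    have hev : ∀ᶠ x in cocompact R3 ⊓ ae volume, |d x| ≤ ε := by
      filter_upwards [hlim (Metric.closedBall_mem_nhds 0 hε)] with x hx
      simpa using hx
    rw [eventually_inf] at hev
    obtain ⟨S, hS, T, hT, hST⟩ := hev
    obtain ⟨R₁, hR₁⟩ : ∃ R₁ : ℝ, ∀ x : R3, R₁ < ‖x‖ → x ∈ S := by
      obtain ⟨K, hK, hKS⟩ := mem_cocompact.1 hS
      obtain ⟨r, hr⟩ := hK.isBounded.subset_closedBall (0 : R3)
      refine ⟨r, fun x hx => hKS fun hxK => ?_⟩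
      have := hr hxK
      rw [mem_closedBall_zero_iff] at this
      linarith
    set R := max R₀ (R₁ + 1)
    have hR0 : 0 < R := hR₀.trans_le (le_max_left _ _)
    obtain ⟨ht, g, hgc, hg, hgB, hgs⟩ := H R (le_max_left _ _)
    have hz := hΔ _ ht
    simp_rw [hg] at hz
    have i1 : Integrable fun x => d x * φ x := by
      have := hd.integrable_smul_right_of_hasCompactSupport h1.continuous h2
      simpa using this
    have hgcs : HasCompactSupport g := by
      refine HasCompactSupport.intro (isCompact_closedBall (0 : R3) (2 * R)) fun x hx => ?_
      exact hgs x (Or.inr (by simpa using hx))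
    have i2 : Integrable fun x => d x * g x := by
      have := hd.integrable_smul_right_of_hasCompactSupport hgc hgcs
      simpa using this
    -- Testing harmonicity with the cut-off potential leaves only the commutator `g`, supported
    -- where `|d| ≤ ε`.
    have e1 : ∫ x, φ x • d x = ∫ x, d x * g x := by
      have : ∫ x, d x * (-φ x + g x) = -(∫ x, d x * φ x) + ∫ x, d x * g x := by
        rw [← integral_neg, ← integral_add (f := fun x => -(d x * φ x)) i1.neg i2]
        refine integral_congr_ae (ae_of_all _ fun x => ?_)
        simp only; ring
      rw [this] at hz
      have e2 : ∫ x, φ x • d x = ∫ x, d x * φ x :=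
        integral_congr_ae (ae_of_all _ fun x => by simp [mul_comm])
      rw [e2]; linarith
    rw [e1]
    have hb : ∀ᵐ x, ‖d x * g x‖ ≤ (Metric.closedBall (0 : R3) (2 * R)).indicator
        (fun _ => ε * (B * R ^ (-3 : ℝ))) x := by
      filter_upwards [hT] with x hx
      by_cases hxR : ‖x‖ < R ∨ 2 * R < ‖x‖
      · rw [hgs x hxR]
        simp only [mul_zero, norm_zero]
        exact Set.indicator_nonneg (fun _ _ => by positivity) _
      · push Not at hxR
        rw [Set.indicator_of_mem (by simpa using hxR.2), norm_mul]
        have hxS : x ∈ S := hR₁ x (by linarith [le_max_right R₀ (R₁ + 1), hxR.1])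
        have hdx : |d x| ≤ ε := hST x ⟨hxS, hx⟩
        exact mul_le_mul hdx (hgB x) (abs_nonneg _) hε.le
    have hI : Integrable ((Metric.closedBall (0 : R3) (2 * R)).indicator
        fun _ => ε * (B * R ^ (-3 : ℝ))) :=
      (integrable_indicator_iff measurableSet_closedBall).2
        (integrableOn_const measure_closedBall_lt_top.ne)
    refine (norm_integral_le_of_norm_le hI hb).trans (le_of_eq ?_)
    rw [integral_indicator measurableSet_closedBall, setIntegral_const, measureReal_def,
      EuclideanSpace.volume_closedBall_fin_three, Real.rpow_neg hR0.le, ENNReal.toReal_mul,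
      ENNReal.toReal_pow, ENNReal.toReal_ofReal (by positivity),
      ENNReal.toReal_ofReal (by positivity)]
    norm_num
    field_simp
    norm_num [V]
    ring
  have hlim0 : Tendsto (fun ε : ℝ => ε * (B * V)) (𝓝[>] 0) (𝓝 0) := by
    have := (by fun_prop : Continuous fun ε : ℝ => ε * (B * V)).tendsto 0
    simp only [zero_mul] at this
    exact this.mono_left nhdsWithin_le_nhds
  have h0 : |∫ x, φ x • d x| ≤ 0 :=
    ge_of_tendsto hlim0 (by filter_upwards [self_mem_nhdsWithin] with ε hε using key ε hε)
  exact abs_eq_zero.1 (le_antisymm h0 (abs_nonneg _))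

/-! ### Monotone Hammerstein equations in Hilbert space. -/

section Hilbert

variable {H₁ H₂ : Type*} [NormedAddCommGroup H₁] [InnerProductSpace ℝ H₁] [CompleteSpace H₁]
  [NormedAddCommGroup H₂] [InnerProductSpace ℝ H₂] [CompleteSpace H₂]

/-- A Hammerstein equation with positive linear part `D D†` and decreasing Lipschitz nonlinearity
is solvable: a relaxed iteration is a contraction. -/
lemma exists_eq_of_lipschitz_antitone (D : H₂ →L[ℝ] H₁) {n : H₂ → H₂} {L : ℝ} (hL : 0 ≤ L)
    (hn : ∀ a b, ‖n a - n b‖ ≤ L * ‖a - b‖) (hmono : ∀ a b, inner ℝ (n a - n b) (a - b) ≤ 0) :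
    ∃ z : H₁, z = D (n (D.adjoint z)) := by
  set K : ℝ := ‖D‖ * (L * ‖D‖)
  have hK : 0 ≤ K := by positivity
  -- `K` bounds the Lipschitz constant of `z ↦ D (n (D† z))`. This `ε` minimises `(1 - ε)² + ε² K²`,
  -- with minimum `κ = K² / (1 + K²) < 1`.
  set ε : ℝ := (1 + K ^ 2)⁻¹
  have hε : 0 < ε := by positivity
  have hε1 : ε ≤ 1 := inv_le_one_of_one_le₀ (by nlinarith)
  set F : H₁ → H₁ := fun z => (1 - ε) • z + ε • D (n (D.adjoint z))
  set κ : ℝ := K ^ 2 * ε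
  have hκ : 0 ≤ κ := by positivity
  have hκ1 : κ < 1 := by
    simp only [κ, ε]
    rw [← div_eq_mul_inv, div_lt_one (by positivity)]
    linarith
  have hcontr : ∀ z w, ‖F z - F w‖ ≤ Real.sqrt κ * ‖z - w‖ := by
    intro z w
    set δ := z - w with hδ
    set η := n (D.adjoint z) - n (D.adjoint w) with hη
    have e1 : F z - F w = (1 - ε) • δ + ε • D η := by
      simp only [F, hδ, hη, map_sub, smul_sub]
      abel
    have hDη : ‖D η‖ ≤ K * ‖δ‖ := by
      calc ‖D η‖ ≤ ‖D‖ * ‖η‖ := D.le_opNorm _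
        _ ≤ ‖D‖ * (L * ‖D.adjoint z - D.adjoint w‖) := by gcongr; exact hn _ _
        _ ≤ ‖D‖ * (L * (‖D‖ * ‖δ‖)) := by
            gcongr
            rw [← map_sub, ← LinearIsometryEquiv.norm_map ContinuousLinearMap.adjoint D]
            exact ContinuousLinearMap.le_opNorm _ _
        _ = _ := by ring
    -- Moving `D` across the inner product turns this into the monotonicity of `n`. It makes the
    -- cross term of `‖(1 - ε) δ + ε D η‖²` nonpositive, so no smallness of `K` is needed.
    have hin : inner ℝ δ (D η) ≤ 0 := by
      rw [← ContinuousLinearMap.adjoint_inner_left, hδ, map_sub, real_inner_comm]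
      exact hmono _ _
    have hsq : ‖F z - F w‖ ^ 2 ≤ κ * ‖δ‖ ^ 2 := by
      rw [e1, norm_add_sq_real, norm_smul, norm_smul, inner_smul_left, inner_smul_right,
        Real.norm_of_nonneg (by linarith), Real.norm_of_nonneg hε.le]
      have h1 : (ε * ‖D η‖) ^ 2 ≤ (ε * (K * ‖δ‖)) ^ 2 := by gcongr
      have h2 : 2 * ((starRingEnd ℝ) (1 - ε) * (ε * inner ℝ δ (D η))) ≤ 0 := by
        have : 0 ≤ (1 - ε) * ε := by
          have : 0 ≤ 1 - ε := by linarith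
          positivity
        simp only [conj_trivial]
        nlinarith
      have h3 : (1 - ε) ^ 2 + (ε * K) ^ 2 = κ := by
        simp only [κ, ε]
        field_simp
        ring
      calc _ ≤ ((1 - ε) * ‖δ‖) ^ 2 + (ε * (K * ‖δ‖)) ^ 2 := by linarith
        _ = ((1 - ε) ^ 2 + (ε * K) ^ 2) * ‖δ‖ ^ 2 := by ring
        _ = _ := by rw [h3]
    rw [← Real.sqrt_sq (norm_nonneg (F z - F w)), ← Real.sqrt_sq (norm_nonneg δ),
      ← Real.sqrt_mul hκ]
    exact Real.sqrt_le_sqrt hsq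
  have hC : ContractingWith (Real.sqrt κ).toNNReal F := by
    refine ⟨?_, LipschitzWith.of_dist_le_mul fun z w => ?_⟩
    · rw [Real.toNNReal_lt_one, Real.sqrt_lt' one_pos]
      simpa using hκ1
    · rw [dist_eq_norm, dist_eq_norm, Real.coe_toNNReal _ (Real.sqrt_nonneg _)]
      exact hcontr z w
  refine ⟨hC.fixedPoint, ?_⟩
  have h := hC.fixedPoint_isFixedPt
  set z := hC.fixedPoint
  have h' : (1 - ε) • z + ε • D (n (D.adjoint z)) = z := h
  rw [sub_smul, one_smul, sub_add_eq_add_sub, add_sub_assoc, add_eq_left, sub_eq_zero] at h'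
  exact (smul_right_injective H₁ hε.ne' h').symm

/-- Solutions of the Hammerstein equation depend Lipschitz continuously on the coupling. -/
lemma norm_sub_le_of_hammerstein (D : H₂ →L[ℝ] H₁) {m : H₂ → H₂} {B : ℝ}
    (hmono : ∀ a b, inner ℝ (m a - m b) (a - b) ≤ 0) (hB : ∀ a, ‖m a‖ ≤ B) {s t : ℝ} (hs : 0 ≤ s)
    {z w : H₁} (hz : z = D (s • m (D.adjoint z))) (hw : w = D (t • m (D.adjoint w))) :
    ‖z - w‖ ≤ ‖D‖ * B * |s - t| := by
  have hB0 : 0 ≤ B := (norm_nonneg _).trans (hB 0)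
  -- Paired with `z - w`, the first term is nonpositive by monotonicity, so only the change of
  -- coupling contributes.
  have e : z - w = s • D (m (D.adjoint z) - m (D.adjoint w)) +
      (s - t) • D (m (D.adjoint w)) := by
    conv_lhs => rw [hz, hw]
    simp only [map_smul, map_sub, smul_sub, sub_smul]
    abel
  have h1 : ‖z - w‖ * ‖z - w‖ ≤ (‖D‖ * B * |s - t|) * ‖z - w‖ := by
    rw [← real_inner_self_eq_norm_mul_norm]
    nth_rewrite 1 [e]
    rw [inner_add_left, inner_smul_left, inner_smul_left]
    simp only [conj_trivial]
    have h2 : inner ℝ (D (m (D.adjoint z) - m (D.adjoint w))) (z - w) ≤ 0 := by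
      rw [← ContinuousLinearMap.adjoint_inner_right, map_sub]
      exact hmono _ _
    have h3 : (s - t) * inner ℝ (D (m (D.adjoint w))) (z - w) ≤
        (‖D‖ * B * |s - t|) * ‖z - w‖ := by
      calc _ ≤ |(s - t) * inner ℝ (D (m (D.adjoint w))) (z - w)| := le_abs_self _
        _ = |s - t| * |inner ℝ (D (m (D.adjoint w))) (z - w)| := abs_mul _ _
        _ ≤ |s - t| * ((‖D‖ * B) * ‖z - w‖) := by
            gcongr
            refine (abs_real_inner_le_norm _ _).trans ?_
            gcongr
            exact (D.le_opNorm _).trans (by gcongr; exact hB _)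
        _ = _ := by ring
    have h4 := mul_nonpos_of_nonneg_of_nonpos hs h2
    linarith
  rcases (norm_nonneg (z - w)).eq_or_lt with h0 | h0
  · rw [← h0]; positivity
  · exact le_of_mul_le_mul_right h1 h0

end Hilbert

/-! ### Factorisation of the Newtonian potential on a weighted `L²` space. -/

/-- Convolution with the kernel `‖z‖⁻²`, a multiple of the square root of `(-Δ)⁻¹`. -/
def rieszConv (f : R3 → ℝ) (x : R3) : ℝ := ∫ y, ‖x - y‖ ^ (-2 : ℝ) * f y

lemma enorm_rieszConv_le (f : R3 → ℝ) (x : R3) : ‖rieszConv f x‖ₑ ≤ rieszPotential 2 f x := by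
  refine (enorm_integral_le_lintegral_enorm _).trans (le_of_eq ?_)
  refine lintegral_congr fun y => ?_
  rw [enorm_mul, Real.enorm_of_nonneg (by positivity)]
  rfl

lemma rieszConv_congr_ae {f g : R3 → ℝ} (h : f =ᵐ[volume] g) : rieszConv f = rieszConv g := by
  ext x
  refine integral_congr_ae ?_
  filter_upwards [h] with y hy
  rw [hy]

lemma stronglyMeasurable_rieszConv {f : R3 → ℝ} (hf : AEStronglyMeasurable f) :
    StronglyMeasurable (rieszConv f) := by
  rw [rieszConv_congr_ae hf.ae_eq_mk]
  have hm : Measurable (hf.mk f) := hf.stronglyMeasurable_mk.measurable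
  exact StronglyMeasurable.integral_prod_right' (f := fun p : R3 × R3 =>
    ‖p.1 - p.2‖ ^ (-2 : ℝ) * hf.mk f p.2) (by fun_prop : Measurable _).stronglyMeasurable

lemma integrable_rieszConv {f : R3 → ℝ} (hf : AEStronglyMeasurable f) {x : R3}
    (h : rieszPotential 2 f x ≠ ⊤) : Integrable fun y => ‖x - y‖ ^ (-2 : ℝ) * f y := by
  refine ⟨(by fun_prop : Measurable fun y => ‖x - y‖ ^ (-2 : ℝ)).aestronglyMeasurable.mul hf, ?_⟩
  refine lt_of_le_of_lt (lintegral_mono fun y => ?_) h.lt_top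
  rw [enorm_mul, Real.enorm_of_nonneg (by positivity)]
  rfl

lemma enorm_rpow_neg_two (z : R3) :
    ‖‖z‖ ^ (-2 : ℝ)‖ₑ ≤ ENNReal.ofReal 1 * rieszKernel 2 z := by
  rw [Real.enorm_of_nonneg (by positivity), ENNReal.ofReal_one, one_mul]
  rfl

/-- The constant in `‖·‖⁻² * ‖·‖⁻² = κ (4π‖·‖)⁻¹`. -/
def newtonCompConst : ℝ := 4 * Real.pi * rieszCompConst.toReal

lemma newtonCompConst_pos : 0 < newtonCompConst := by
  have := ENNReal.toReal_pos rieszCompConst_ne_zero rieszCompConst_ne_top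
  unfold newtonCompConst
  positivity

lemma integral_rpow_neg_two_mul {y z : R3} (h : z ≠ y) :
    ∫ x, ‖x - z‖ ^ (-2 : ℝ) * ‖y - x‖ ^ (-2 : ℝ) = newtonCompConst * newtonKernel (y - z) := by
  rw [integral_eq_lintegral_of_nonneg_ae (ae_of_all _ fun x => by positivity)
    (by fun_prop : Measurable _).aestronglyMeasurable]
  have : ∀ x, ENNReal.ofReal (‖x - z‖ ^ (-2 : ℝ) * ‖y - x‖ ^ (-2 : ℝ)) =
      rieszKernel 2 (y - x) * rieszKernel 2 (x - z) := by
    intro x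
    rw [mul_comm, ENNReal.ofReal_mul (by positivity)]
    rfl
  rw [lintegral_congr this, rieszKernel_comp h.symm, ENNReal.toReal_mul, rieszKernel_one_eq,
    ENNReal.toReal_ofReal (by positivity), newtonCompConst, newtonKernel]
  field_simp

lemma rieszConv_rieszConv {f : R3 → ℝ} (hf : AEStronglyMeasurable f) {y : R3}
    (hy : rieszPotential 1 f y ≠ ⊤) : rieszConv (rieszConv f) y = newtonCompConst * newton f y := by
  have hψ : AEStronglyMeasurable (fun x => ‖y - x‖ ^ (-2 : ℝ)) (volume : Measure R3) :=
    (by fun_prop : Measurable _).aestronglyMeasurable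
  have n1 : ∀ᵐ z : R3, z ≠ y := by simp [ae_iff]
  -- The potential of `‖y - ·‖⁻²` is a multiple of `‖y - z‖⁻¹`, which is unbounded; the version of
  -- Fubini with a uniform bound does not apply, but finiteness of the potential of `f` at `y`
  -- suffices.
  have hfin : ∫⁻ z, rieszPotential 2 (fun x => ‖y - x‖ ^ (-2 : ℝ)) z * ‖f z‖ₑ ≠ ⊤ := by
    have e1 : ∫⁻ z, rieszPotential 2 (fun x => ‖y - x‖ ^ (-2 : ℝ)) z * ‖f z‖ₑ =
        ∫⁻ z, rieszCompConst * (rieszKernel 1 (y - z) * ‖f z‖ₑ) := by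
      refine lintegral_congr_ae ?_
      filter_upwards [n1] with z hz
      rw [← mul_assoc, rieszKernel_sub_comm, ← rieszKernel_comp hz]
      congr 1
      refine lintegral_congr fun x => ?_
      rw [Real.enorm_of_nonneg (by positivity), rieszKernel_sub_comm 2 x y]
      rfl
    rw [e1, lintegral_const_mul' _ _ rieszCompConst_ne_top]
    exact ENNReal.mul_ne_top rieszCompConst_ne_top hy
  have h := integral_kernel_swap_of_lintegral (k := fun z : R3 => ‖z‖ ^ (-2 : ℝ)) (by fun_prop)
    enorm_rpow_neg_two hf hψ hfin
  calc rieszConv (rieszConv f) y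
      = ∫ x, (∫ z, ‖x - z‖ ^ (-2 : ℝ) * f z) * ‖y - x‖ ^ (-2 : ℝ) :=
        integral_congr_ae (ae_of_all _ fun x => mul_comm _ _)
    _ = ∫ z, f z * ∫ x, ‖x - z‖ ^ (-2 : ℝ) * ‖y - x‖ ^ (-2 : ℝ) := h
    _ = ∫ z, newtonCompConst * (newtonKernel (y - z) * f z) := by
        refine integral_congr_ae ?_
        filter_upwards [n1] with z hz
        rw [integral_rpow_neg_two_mul hz]
        ring
    _ = _ := integral_const_mul _ _

/-- The polarised energy identity; it identifies `D†D` with the Newtonian potential. -/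
lemma integral_rieszConv_mul_rieszConv {f q : R3 → ℝ} (hf : Integrable f) (hq : Integrable q)
    {P : ℝ≥0} (hP : ∀ x, rieszPotential 1 q x ≤ P) :
    ∫ x, rieszConv f x * rieszConv q x = newtonCompConst * ∫ y, f y * newton q y := by
  have hψ := (stronglyMeasurable_rieszConv hq.1).aestronglyMeasurable (μ := volume)
  have hle : ∀ y, rieszPotential 2 (rieszConv q) y ≤ rieszCompConst * P := by
    intro y
    calc rieszPotential 2 (rieszConv q) y
        ≤ ∫⁻ x, rieszKernel 2 (x - y) * rieszPotential 2 q x := by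
          refine lintegral_mono fun x => ?_
          rw [rieszKernel_sub_comm]
          gcongr
          exact enorm_rieszConv_le q x
      _ = rieszCompConst * rieszPotential 1 q y :=
          lintegral_rieszKernel_mul_rieszPotential_two hq.1 y
      _ ≤ _ := by gcongr; exact hP y
  have hc : rieszCompConst * P ≠ ⊤ := ENNReal.mul_ne_top rieszCompConst_ne_top ENNReal.coe_ne_top
  have h := integral_kernel_swap (P := (rieszCompConst * P).toNNReal)
    (k := fun z : R3 => ‖z‖ ^ (-2 : ℝ)) (by fun_prop) enorm_rpow_neg_two hf hψ
    (fun x => (hle x).trans (ENNReal.coe_toNNReal hc).ge)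
  calc ∫ x, rieszConv f x * rieszConv q x
      = ∫ y, f y * ∫ x, ‖x - y‖ ^ (-2 : ℝ) * rieszConv q x := h
    _ = ∫ y, newtonCompConst * (f y * newton q y) := by
        refine integral_congr_ae (ae_of_all _ fun y => ?_)
        have e : ∫ x, ‖x - y‖ ^ (-2 : ℝ) * rieszConv q x = rieszConv (rieszConv q) y := by
          refine integral_congr_ae (ae_of_all _ fun x => ?_)
          simp only
          rw [norm_sub_rev]
        simp only
        rw [e, rieszConv_rieszConv hq.1 ((hP y).trans_lt ENNReal.coe_lt_top).ne]
        ring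
    _ = _ := integral_const_mul _ _

/-- The measure with density `w`. -/
def weightMeasure (w : R3 → ℝ) : Measure R3 := volume.withDensity fun x => ENNReal.ofReal (w x)

lemma lintegral_weightMeasure {w : R3 → ℝ} (hw : Measurable w) {F : R3 → ℝ≥0∞}
    (hF : Measurable F) :
    ∫⁻ x, F x ∂(weightMeasure w) = ∫⁻ x, ENNReal.ofReal (w x) * F x :=
  lintegral_withDensity_eq_lintegral_mul _ hw.ennreal_ofReal hF

lemma integral_weightMeasure {w : R3 → ℝ} (hw : Measurable w) (hw0 : ∀ x, 0 ≤ w x)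
    (F : R3 → ℝ) : ∫ x, F x ∂(weightMeasure w) = ∫ x, w x * F x := by
  rw [weightMeasure, integral_withDensity_eq_integral_toReal_smul hw.ennreal_ofReal
    (ae_of_all _ fun _ => ENNReal.ofReal_lt_top)]
  refine integral_congr_ae (ae_of_all _ fun x => ?_)
  simp only
  rw [ENNReal.toReal_ofReal (hw0 x), smul_eq_mul]

lemma isFiniteMeasure_weightMeasure {w : R3 → ℝ} (hw : Integrable w) :
    IsFiniteMeasure (weightMeasure w) :=
  isFiniteMeasure_withDensity_ofReal hw.2

/-- An identity in the weighted space says nothing where `w = 0`; multiplying by `w` turns it into a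
Lebesgue almost everywhere identity. -/
lemma ae_mul_eq_of_ae_weightMeasure {w : R3 → ℝ} (hw : Measurable w) (hw0 : ∀ x, 0 ≤ w x)
    {p q : R3 → ℝ} (h : p =ᵐ[weightMeasure w] q) :
    (fun x => p x * w x) =ᵐ[volume] fun x => q x * w x := by
  have := (ae_withDensity_iff hw.ennreal_ofReal).1 h
  filter_upwards [this] with x hx
  rcases (hw0 x).eq_or_lt with h0 | h0
  · rw [← h0]; simp
  · rw [hx (by simpa using h0)]

/-- A Schur test: in the energy of `q w` the product `|q(x)| |q(y)|` is at most `q(x)² + q(y)²`, and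
the remaining integration against the kernel gives the potential of `w`, bounded by `P`. -/
lemma lintegral_rieszPotential_two_sq_weight_le {w q : R3 → ℝ} (hw : Measurable w)
    (hw0 : ∀ x, 0 ≤ w x) (hq : Measurable q) {P : ℝ≥0} (hP : ∀ x, rieszPotential 1 w x ≤ P) :
    ∫⁻ x, rieszPotential 2 (fun y => q y * w y) x ^ 2 ≤
      rieszCompConst * (2 * P) * ∫⁻ x, ‖q x‖ₑ ^ 2 ∂(weightMeasure w) := by
  have hqw : Measurable fun y => q y * w y := hq.mul hw
  have hwe : ∀ x, ‖w x‖ₑ = ENNReal.ofReal (w x) := fun x => Real.enorm_of_nonneg (hw0 x)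
  rw [lintegral_rieszPotential_two_sq hqw.aestronglyMeasurable, mul_assoc]
  gcongr
  have hS : ∫⁻ x, ‖q x‖ₑ ^ 2 ∂(weightMeasure w) = ∫⁻ x, ‖q x ^ 2 * w x‖ₑ := by
    rw [lintegral_weightMeasure hw (by fun_prop)]
    refine lintegral_congr fun x => ?_
    rw [enorm_mul, enorm_pow, hwe, mul_comm]
  rw [hS]
  have hsq : ∀ a b : ℝ≥0∞, a * b ≤ a ^ 2 + b ^ 2 := by
    intro a b
    rcases le_total a b with h | h
    · calc a * b ≤ b * b := by gcongr
        _ ≤ _ := by rw [sq b]; exact le_add_self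
    · calc a * b ≤ a * a := by gcongr
        _ ≤ _ := by rw [sq a]; exact le_self_add
  calc ∫⁻ x, rieszPotential 1 (fun y => q y * w y) x * ‖q x * w x‖ₑ
      ≤ ∫⁻ x, (‖w x‖ₑ * (∫⁻ y, rieszKernel 1 (x - y) * ‖q y ^ 2 * w y‖ₑ) +
          rieszPotential 1 w x * ‖q x ^ 2 * w x‖ₑ) := by
        refine lintegral_mono fun x => ?_
        rw [rieszPotential, rieszPotential, ← lintegral_mul_const _ (by fun_prop),
          ← lintegral_const_mul _ (by fun_prop), ← lintegral_mul_const _ (by fun_prop),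
          ← lintegral_add_left (by fun_prop)]
        refine lintegral_mono fun y => ?_
        simp only [enorm_mul, enorm_pow]
        calc rieszKernel 1 (x - y) * (‖q y‖ₑ * ‖w y‖ₑ) * (‖q x‖ₑ * ‖w x‖ₑ)
            = (rieszKernel 1 (x - y) * ‖w y‖ₑ * ‖w x‖ₑ) * (‖q y‖ₑ * ‖q x‖ₑ) := by ring
          _ ≤ (rieszKernel 1 (x - y) * ‖w y‖ₑ * ‖w x‖ₑ) * (‖q y‖ₑ ^ 2 + ‖q x‖ₑ ^ 2) := by
              gcongr; exact hsq _ _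
          _ = _ := by ring
    _ = (∫⁻ y, (∫⁻ x, rieszKernel 1 (x - y) * ‖w x‖ₑ) * ‖q y ^ 2 * w y‖ₑ) +
          ∫⁻ x, rieszPotential 1 w x * ‖q x ^ 2 * w x‖ₑ := by
        have hm : Measurable fun x => rieszPotential 1 w x * ‖q x ^ 2 * w x‖ₑ :=
          (measurable_rieszPotential 1 hw.aestronglyMeasurable).mul (by fun_prop)
        rw [lintegral_add_right _ hm, lintegral_mul_comm_swap
          (f := fun y => q y ^ 2 * w y) (by fun_prop : Measurable _).aestronglyMeasurable
          (measurable_rieszKernel 1) (by fun_prop : Measurable fun x => ‖w x‖ₑ)]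
    _ ≤ (∫⁻ y, P * ‖q y ^ 2 * w y‖ₑ) + ∫⁻ x, P * ‖q x ^ 2 * w x‖ₑ := by
        gcongr with y x
        · refine le_trans (le_of_eq ?_) (hP y)
          refine lintegral_congr fun x => ?_
          rw [rieszKernel_sub_comm]
        · exact hP x
    _ = _ := by
        rw [lintegral_const_mul' _ _ ENNReal.coe_ne_top]
        ring

lemma integrable_mul_weight {w q : R3 → ℝ} (hw : Measurable w) (hwi : Integrable w)
    (hw0 : ∀ x, 0 ≤ w x) (hq : Measurable q) (h2 : MemLp q 2 (weightMeasure w)) :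
    Integrable fun x => q x * w x := by
  have := isFiniteMeasure_weightMeasure hwi
  have h1 : MemLp q 1 (weightMeasure w) := h2.mono_exponent (by norm_num)
  refine ⟨(hq.mul hw).aestronglyMeasurable, ?_⟩
  have h3 := h1.2
  rw [eLpNorm_one_eq_lintegral_enorm, lintegral_weightMeasure hw (by fun_prop)] at h3
  refine lt_of_le_of_lt (le_of_eq ?_) h3
  refine lintegral_congr fun x => ?_
  rw [enorm_mul, Real.enorm_of_nonneg (hw0 x), mul_comm]

lemma eLpNorm_two_eq {α : Type*} [MeasurableSpace α] {μ : Measure α} (f : α → ℝ) :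
    eLpNorm f 2 μ = (∫⁻ x, ‖f x‖ₑ ^ 2 ∂μ) ^ (1 / 2 : ℝ) := by
  rw [eLpNorm_eq_lintegral_rpow_enorm_toReal (by simp) (by simp)]
  have : (2 : ℝ≥0∞).toReal = (2 : ℕ) := by simp
  simp only [this, ENNReal.rpow_natCast]
  simp

lemma eLpNorm_rieszConv_le {w q : R3 → ℝ} (hw : Measurable w) (hw0 : ∀ x, 0 ≤ w x)
    (hq : Measurable q) {P : ℝ≥0} (hP : ∀ x, rieszPotential 1 w x ≤ P) :
    eLpNorm (rieszConv fun y => q y * w y) 2 volume ≤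
      (rieszCompConst * (2 * P)) ^ (1 / 2 : ℝ) * eLpNorm q 2 (weightMeasure w) := by
  rw [eLpNorm_two_eq, eLpNorm_two_eq, ← ENNReal.mul_rpow_of_nonneg _ _ (by norm_num)]
  gcongr
  refine le_trans (lintegral_mono fun x => ?_)
    (lintegral_rieszPotential_two_sq_weight_le hw hw0 hq hP)
  gcongr
  exact enorm_rieszConv_le _ x

/-- Convolution with `‖z‖⁻²` as a bounded operator from `L²(w dx)` to `L²(dx)`. -/
lemma exists_rieszConv_clm {w : R3 → ℝ} (hw : Measurable w) (hwi : Integrable w)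
    (hw0 : ∀ x, 0 ≤ w x) {P : ℝ≥0} (hP : ∀ x, rieszPotential 1 w x ≤ P) :
    ∃ D : Lp ℝ 2 (weightMeasure w) →L[ℝ] Lp ℝ 2 (volume : Measure R3),
      ∀ q, D q =ᵐ[volume] rieszConv fun y => q y * w y := by
  set C : ℝ≥0∞ := (rieszCompConst * (2 * P)) ^ (1 / 2 : ℝ)
  have hC : C ≠ ⊤ := ENNReal.rpow_ne_top_of_nonneg (by norm_num)
    (ENNReal.mul_ne_top rieszCompConst_ne_top (by finiteness))
  have hmeas : ∀ q : Lp ℝ 2 (weightMeasure w), Measurable q := fun q =>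
    (Lp.stronglyMeasurable q).measurable
  have hint : ∀ q : Lp ℝ 2 (weightMeasure w), Integrable fun y => q y * w y := fun q =>
    integrable_mul_weight hw hwi hw0 (hmeas q) (Lp.memLp q)
  have hle : ∀ q : Lp ℝ 2 (weightMeasure w), eLpNorm (rieszConv fun y => q y * w y) 2 volume ≤
      C * eLpNorm q 2 (weightMeasure w) := fun q => eLpNorm_rieszConv_le hw hw0 (hmeas q) hP
  have hmem : ∀ q : Lp ℝ 2 (weightMeasure w), MemLp (rieszConv fun y => q y * w y) 2 volume :=
    fun q => ⟨(stronglyMeasurable_rieszConv (hint q).1).aestronglyMeasurable,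
      (hle q).trans_lt (ENNReal.mul_lt_top hC.lt_top (Lp.memLp q).2)⟩
  have hfin : ∀ q : Lp ℝ 2 (weightMeasure w),
      ∀ᵐ x, rieszPotential 2 (fun y => q y * w y) x ≠ ⊤ := by
    intro q
    have hm := measurable_rieszPotential 2 (hint q).1
    have hlt : ∫⁻ x, rieszPotential 2 (fun y => q y * w y) x ^ 2 ≠ ⊤ := by
      refine ((lintegral_rieszPotential_two_sq_weight_le hw hw0 (hmeas q) hP).trans_lt
        (ENNReal.mul_lt_top (ENNReal.mul_lt_top rieszCompConst_ne_top.lt_top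
          (by finiteness)) ?_)).ne
      have h2 := (Lp.memLp q).2
      rw [eLpNorm_two_eq, ENNReal.rpow_lt_top_iff_of_pos (by norm_num)] at h2
      exact h2
    filter_upwards [ae_lt_top (hm.pow_const 2) hlt] with x hx h
    simp [h] at hx
  refine ⟨LinearMap.mkContinuous
    { toFun := fun q => (hmem q).toLp _
      map_add' := ?_
      map_smul' := ?_ } C.toReal ?_, fun q => (hmem q).coeFn_toLp⟩
  · intro p q
    rw [← MemLp.toLp_add, MemLp.toLp_eq_toLp_iff]
    have e := ae_mul_eq_of_ae_weightMeasure hw hw0 (Lp.coeFn_add p q)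
    rw [rieszConv_congr_ae e]
    -- Additivity needs both integrals to converge absolutely, which holds almost everywhere.
    filter_upwards [hfin p, hfin q] with x hp hq
    simp only [Pi.add_apply, rieszConv]
    rw [← integral_add (integrable_rieszConv (hint p).1 hp) (integrable_rieszConv (hint q).1 hq)]
    refine integral_congr_ae (ae_of_all _ fun y => ?_)
    simp only
    ring
  · intro c q
    rw [RingHom.id_apply, ← MemLp.toLp_const_smul, MemLp.toLp_eq_toLp_iff]
    have e := ae_mul_eq_of_ae_weightMeasure hw hw0 (Lp.coeFn_smul c q)
    rw [rieszConv_congr_ae e]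
    refine ae_of_all _ fun x => ?_
    simp only [Pi.smul_apply, rieszConv, smul_eq_mul]
    rw [← integral_const_mul]
    refine integral_congr_ae (ae_of_all _ fun y => ?_)
    simp only
    ring
  · intro q
    simp only [LinearMap.coe_mk, AddHom.coe_mk]
    rw [Lp.norm_toLp, Lp.norm_def, ← ENNReal.toReal_mul]
    exact ENNReal.toReal_mono (ENNReal.mul_ne_top hC (Lp.memLp q).2.ne) (hle q)

/-- `D†D` is a multiple of the Newtonian potential operator. -/
lemma adjoint_comp_eq_newton {w : R3 → ℝ} (hw : Measurable w) (hwi : Integrable w)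
    (hw0 : ∀ x, 0 ≤ w x) {D : Lp ℝ 2 (weightMeasure w) →L[ℝ] Lp ℝ 2 (volume : Measure R3)}
    (hD : ∀ q, D q =ᵐ[volume] rieszConv fun y => q y * w y) {q : Lp ℝ 2 (weightMeasure w)}
    {P : ℝ≥0} (hP : ∀ x, rieszPotential 1 (fun y => q y * w y) x ≤ P) :
    D.adjoint (D q) =ᵐ[weightMeasure w]
      fun x => newtonCompConst * newton (fun y => q y * w y) x := by
  have := isFiniteMeasure_weightMeasure hwi
  have hint : ∀ q : Lp ℝ 2 (weightMeasure w), Integrable fun y => q y * w y := fun q =>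
    integrable_mul_weight hw hwi hw0 (Lp.stronglyMeasurable q).measurable (Lp.memLp q)
  have hmem : MemLp (fun x => newtonCompConst * newton (fun y => q y * w y) x) 2
      (weightMeasure w) := by
    refine MemLp.const_mul (MemLp.of_bound
      (stronglyMeasurable_newton (hint q).1).aestronglyMeasurable P (ae_of_all _ fun x => ?_)) _
    have := (enorm_newton_le (fun y => q y * w y) x).trans (hP x)
    rw [← ofReal_norm, ENNReal.ofReal_le_coe] at this
    exact this
  suffices h : D.adjoint (D q) = hmem.toLp _ by
    rw [h]; exact hmem.coeFn_toLp
  refine ext_inner_right ℝ fun p => ?_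
  rw [ContinuousLinearMap.adjoint_inner_left, L2.inner_def, L2.inner_def]
  have e1 : ∫ x, inner ℝ (D q x) (D p x) =
      ∫ x, rieszConv (fun y => p y * w y) x * rieszConv (fun y => q y * w y) x := by
    refine integral_congr_ae ?_
    filter_upwards [hD p, hD q] with x hp hq
    rw [hp, hq]
    rfl
  have e2 : ∫ x, inner ℝ (hmem.toLp _ x) (p x) ∂(weightMeasure w) =
      ∫ x, p x * (newtonCompConst * newton (fun y => q y * w y) x) ∂(weightMeasure w) := by
    refine integral_congr_ae ?_
    filter_upwards [hmem.coeFn_toLp] with x hx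
    rw [hx]
    rfl
  rw [e1, e2, integral_rieszConv_mul_rieszConv (hint p) (hint q) hP,
    integral_weightMeasure hw hw0, ← integral_const_mul]
  refine integral_congr_ae (ae_of_all _ fun x => ?_)
  simp only
  ring

/-! ### The mean-field equation with prescribed coupling and with unit charge. -/

/-- Truncating at `v⁺` makes the Gibbs factor bounded and Lipschitz, hence usable on all of `L²`,
and keeps it decreasing. The truncation is harmless because the solutions are nonnegative
potentials. -/
lemma abs_exp_neg_max_sub_le (a b : ℝ) :
    |Real.exp (-max a 0) - Real.exp (-max b 0)| ≤ |a - b| := by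
  have key : ∀ s t : ℝ, 0 ≤ s → s ≤ t → Real.exp (-s) - Real.exp (-t) ≤ t - s := by
    intro s t hs hst
    have h1 : Real.exp (-s) - Real.exp (-t) = Real.exp (-s) * (1 - Real.exp (-(t - s))) := by
      rw [mul_sub, ← Real.exp_add, mul_one]; congr 2; ring
    have h2 : 1 - Real.exp (-(t - s)) ≤ t - s := by linarith [Real.add_one_le_exp (-(t - s))]
    have h3 : Real.exp (-s) ≤ 1 := Real.exp_le_one_iff.2 (by linarith)
    have h4 : 0 ≤ 1 - Real.exp (-(t - s)) := by
      have : Real.exp (-(t - s)) ≤ 1 := Real.exp_le_one_iff.2 (by linarith)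
      linarith
    rw [h1]
    calc _ ≤ 1 * (1 - Real.exp (-(t - s))) := by gcongr
      _ ≤ _ := by linarith
  have hmax : |max a 0 - max b 0| ≤ |a - b| := abs_max_sub_max_le_abs a b 0
  refine le_trans ?_ hmax
  rcases le_total (max a 0) (max b 0) with h | h
  · rw [abs_of_nonneg (sub_nonneg.2 (Real.exp_le_exp.2 (neg_le_neg h))), abs_sub_comm,
      abs_of_nonneg (sub_nonneg.2 h)]
    exact key _ _ (le_max_right _ _) h
  · rw [abs_sub_comm, abs_of_nonneg (sub_nonneg.2 (Real.exp_le_exp.2 (neg_le_neg h))),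
      abs_of_nonneg (sub_nonneg.2 h)]
    exact key _ _ (le_max_right _ _) h

lemma exp_neg_max_sub_mul_nonpos (a b : ℝ) :
    (Real.exp (-max a 0) - Real.exp (-max b 0)) * (a - b) ≤ 0 := by
  rcases le_total a b with h | h
  · refine mul_nonpos_of_nonneg_of_nonpos (sub_nonneg.2 (Real.exp_le_exp.2 (neg_le_neg ?_)))
      (sub_nonpos.2 h)
    exact max_le_max_right 0 h
  · refine mul_nonpos_of_nonpos_of_nonneg (sub_nonpos.2 (Real.exp_le_exp.2 (neg_le_neg ?_)))
      (sub_nonneg.2 h)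
    exact max_le_max_right 0 h

/-- The truncated Gibbs factor `e^{-v⁺}` as a map of `L²`. -/
lemma exists_gibbs_map {α : Type*} [MeasurableSpace α] (μ : Measure α) [IsFiniteMeasure μ] :
    ∃ m : Lp ℝ 2 μ → Lp ℝ 2 μ, (∀ v, m v =ᵐ[μ] fun x => Real.exp (-max (v x) 0)) ∧
      (∀ a b, ‖m a - m b‖ ≤ ‖a - b‖) ∧ (∀ a b, inner ℝ (m a - m b) (a - b) ≤ 0) ∧
      ∃ B, ∀ a, ‖m a‖ ≤ B := by
  have hle : ∀ (v : Lp ℝ 2 μ) x, ‖Real.exp (-max (v x) 0)‖ ≤ 1 := fun v x => by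
    rw [Real.norm_of_nonneg (Real.exp_nonneg _)]
    exact Real.exp_le_one_iff.2 (by simp)
  have hmeas : ∀ v : Lp ℝ 2 μ, AEStronglyMeasurable (fun x => Real.exp (-max (v x) 0)) μ := by
    intro v
    have : Measurable v := (Lp.stronglyMeasurable v).measurable
    exact (by fun_prop : Measurable fun x => Real.exp (-max (v x) 0)).aestronglyMeasurable
  have hmem : ∀ v : Lp ℝ 2 μ, MemLp (fun x => Real.exp (-max (v x) 0)) 2 μ := fun v =>
    MemLp.of_bound (hmeas v) 1 (ae_of_all _ (hle v))
  refine ⟨fun v => (hmem v).toLp _, fun v => (hmem v).coeFn_toLp, fun a b => ?_, fun a b => ?_,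
    (eLpNorm (fun _ : α => (1 : ℝ)) 2 μ).toReal, fun a => ?_⟩
  · refine Lp.norm_le_norm_of_ae_le ?_
    filter_upwards [Lp.coeFn_sub ((hmem a).toLp _) ((hmem b).toLp _), Lp.coeFn_sub a b,
      (hmem a).coeFn_toLp, (hmem b).coeFn_toLp] with x h1 h2 h3 h4
    rw [h1, h2, Pi.sub_apply, Pi.sub_apply, h3, h4]
    exact abs_exp_neg_max_sub_le _ _
  · rw [L2.inner_def]
    refine integral_nonpos_of_ae ?_
    filter_upwards [Lp.coeFn_sub ((hmem a).toLp _) ((hmem b).toLp _), Lp.coeFn_sub a b,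
      (hmem a).coeFn_toLp, (hmem b).coeFn_toLp] with x h1 h2 h3 h4
    rw [h1, h2, Pi.sub_apply, Pi.sub_apply, h3, h4]
    simp only [Pi.zero_apply]
    rw [real_inner_comm]
    exact exp_neg_max_sub_mul_nonpos _ _
  · rw [Lp.norm_toLp]
    refine ENNReal.toReal_mono (memLp_const (1 : ℝ)).2.ne (eLpNorm_mono fun x => ?_)
    simpa only [norm_one] using hle a x

lemma rieszPotential_le_of_abs_le {s : ℝ} {f g : R3 → ℝ} {c : ℝ} {x : R3} {P : ℝ≥0}
    (hfg : ∀ᵐ y, |f y| ≤ c * |g y|) (hc : 0 ≤ c) (hP : rieszPotential s g x ≤ P) :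
    rieszPotential s f x ≤ (c.toNNReal * P : ℝ≥0) := by
  calc rieszPotential s f x ≤ ∫⁻ y, ENNReal.ofReal c * (rieszKernel s (x - y) * ‖g y‖ₑ) := by
        refine lintegral_mono_ae ?_
        filter_upwards [hfg] with y hy
        calc rieszKernel s (x - y) * ‖f y‖ₑ
            ≤ rieszKernel s (x - y) * (ENNReal.ofReal c * ‖g y‖ₑ) := by
              gcongr
              rw [Real.enorm_eq_ofReal_abs, Real.enorm_eq_ofReal_abs, ← ENNReal.ofReal_mul hc]
              exact ENNReal.ofReal_le_ofReal hy
          _ = _ := by ring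
    _ = ENNReal.ofReal c * rieszPotential s g x := lintegral_const_mul' _ _ ENNReal.ofReal_ne_top
    _ ≤ ENNReal.ofReal c * P := by gcongr
    _ = _ := by rw [ENNReal.coe_mul]; rfl

lemma newton_const_mul (c : ℝ) (f : R3 → ℝ) (x : R3) :
    newton (fun y => c * f y) x = c * newton f x := by
  rw [newton, newton, ← integral_const_mul]
  refine integral_congr_ae (ae_of_all _ fun y => ?_)
  simp only
  ring

set_option maxHeartbeats 1000000 in
/-- Solutions of `v = (-Δ)⁻¹(λ w e^{-v})` for every coupling `λ ≥ 0`, with total charge depending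
continuously on `λ`. -/
lemma exists_mean_field_family {w : R3 → ℝ} (hw : Measurable w) (hwi : Integrable w)
    (hw0 : ∀ x, 0 ≤ w x) {P : ℝ≥0} (hP : ∀ x, rieszPotential 1 w x ≤ P) :
    ∃ v : ℝ → R3 → ℝ,
      (∀ t, 0 ≤ t → ∀ x, v t x = newton (fun y => t * (w y * Real.exp (-v t y))) x) ∧
      (∀ t, 0 ≤ t → Measurable (v t)) ∧
      ContinuousOn (fun t => ∫ x, w x * Real.exp (-v t x)) (Set.Ici 0) := by
  have := isFiniteMeasure_weightMeasure hwi
  obtain ⟨D, hD⟩ := exists_rieszConv_clm hw hwi hw0 hP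
  obtain ⟨m, hm, hmL, hmono, B, hB⟩ := exists_gibbs_map (weightMeasure w)
  have hκ := newtonCompConst_pos
  -- The factor `newtonCompConst⁻¹` compensates for `D†D` being `newtonCompConst` times the
  -- Newtonian potential.
  have hex : ∀ t : ℝ, ∃ z, 0 ≤ t → z = D ((newtonCompConst⁻¹ * t) • m (D.adjoint z)) := by
    intro t
    by_cases ht : 0 ≤ t
    · have hc : 0 ≤ newtonCompConst⁻¹ * t := by positivity
      obtain ⟨z, hz⟩ := exists_eq_of_lipschitz_antitone D
        (n := fun a => (newtonCompConst⁻¹ * t) • m a) hc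
        (fun a b => by
          rw [← smul_sub, norm_smul, Real.norm_of_nonneg hc]
          gcongr
          exact hmL a b)
        (fun a b => by
          rw [← smul_sub, inner_smul_left]
          exact mul_nonpos_of_nonneg_of_nonpos hc (hmono a b))
      exact ⟨z, fun _ => hz⟩
    · exact ⟨0, fun h => absurd h ht⟩
  choose z hz using hex
  set V : ℝ → Lp ℝ 2 (weightMeasure w) := fun t => D.adjoint (z t) with hV
  set f : ℝ → R3 → ℝ := fun t y => t * (w y * Real.exp (-max (V t y) 0)) with hf
  have hVm : ∀ t, Measurable (V t) := fun t => (Lp.stronglyMeasurable _).measurable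
  have hfm : ∀ t, Measurable (f t) := fun t => by
    have := hVm t
    fun_prop
  have hexp : ∀ t y, Real.exp (-max (V t y) 0) ≤ 1 := fun t y =>
    Real.exp_le_one_iff.2 (by simp)
  have hVeq : ∀ t, 0 ≤ t → V t =ᵐ[weightMeasure w] newton (f t) := by
    intro t ht
    set c := newtonCompConst⁻¹ * t with hc
    have hc0 : 0 ≤ c := by positivity
    have hq := ae_mul_eq_of_ae_weightMeasure hw hw0 ((Lp.coeFn_smul c (m (V t))).trans
      ((hm (V t)).fun_comp (fun s => c * s)))
    have hq' : (fun y => (c • m (V t) : Lp ℝ 2 (weightMeasure w)) y * w y) =ᵐ[volume]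
        fun y => newtonCompConst⁻¹ * f t y := by
      refine hq.trans (ae_of_all _ fun y => ?_)
      simp only [hf, hc, Function.comp_apply]
      ring
    have hP' : ∀ x, rieszPotential 1 (fun y => (c • m (V t) : Lp ℝ 2 (weightMeasure w)) y * w y) x ≤
        (c.toNNReal * P : ℝ≥0) := by
      intro x
      refine rieszPotential_le_of_abs_le ?_ hc0 (hP x)
      filter_upwards [hq'] with y hy
      rw [hy, abs_of_nonneg (hw0 y), abs_of_nonneg]
      · simp only [hf, hc]
        have := mul_le_of_le_one_right (hw0 y) (hexp t y)
        have h2 := mul_le_mul_of_nonneg_left this hc0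
        simp only [hc] at h2
        linarith
      · have := hw0 y
        simp only [hf]
        positivity
    have hA := adjoint_comp_eq_newton hw hwi hw0 hD hP'
    have e1 : D.adjoint (D (c • m (V t))) = V t := by
      rw [hV]
      simp only
      conv_rhs => rw [hz t ht]
    rw [e1] at hA
    refine hA.trans (ae_of_all _ fun x => ?_)
    simp only
    rw [newton_congr_ae hq', newton_const_mul, mul_inv_cancel_left₀ hκ.ne']
  have hf0 : ∀ t, 0 ≤ t → ∀ y, 0 ≤ f t y := fun t ht y => by
    have := hw0 y
    simp only [hf]
    positivity
  -- The truncation is removed here: `V t` agrees with the potential of a nonnegative density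
  -- wherever the weight charges.
  have hwe : ∀ t, 0 ≤ t → (fun y => w y * Real.exp (-newton (f t) y)) =ᵐ[volume]
      fun y => w y * Real.exp (-max (V t y) 0) := by
    intro t ht
    have h1 : (fun y => Real.exp (-newton (f t) y)) =ᵐ[weightMeasure w]
        fun y => Real.exp (-max (V t y) 0) := by
      filter_upwards [hVeq t ht] with y hy
      rw [hy, max_eq_left (newton_nonneg (ae_of_all _ (hf0 t ht)) y)]
    filter_upwards [ae_mul_eq_of_ae_weightMeasure hw hw0 h1] with y hy
    rw [mul_comm, hy, mul_comm]
  -- `V t` is undetermined where `w = 0`; the potential `newton (f t)` is defined everywhere and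
  -- satisfies the equation at every point.
  refine ⟨fun t => newton (f t), fun t ht x => ?_,
    fun t _ => (stronglyMeasurable_newton (hfm t).aestronglyMeasurable).measurable, ?_⟩
  · refine congrFun (newton_congr_ae (f := f t) ?_) x
    filter_upwards [hwe t ht] with y hy
    rw [hy]
  · have hone : MemLp (fun _ : R3 => (1 : ℝ)) 2 (weightMeasure w) := memLp_const _
    -- As a pairing with the constant one in the weighted space, the integral inherits continuity
    -- from `z`, `D†` and `m`.
    have e : ∀ t ∈ Set.Ici (0 : ℝ), ∫ x, w x * Real.exp (-newton (f t) x) =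
        inner ℝ (hone.toLp _) (m (V t)) := by
      intro t ht
      rw [integral_congr_ae (hwe t ht), ← integral_weightMeasure hw hw0, L2.inner_def]
      refine integral_congr_ae ?_
      filter_upwards [hm (V t), hone.coeFn_toLp] with x h1 h2
      rw [h1, h2]
      simp
    refine ContinuousOn.congr ?_ e
    have hB0 : 0 ≤ B := (norm_nonneg _).trans (hB 0)
    have hzc : ContinuousOn z (Set.Ici 0) := by
      refine LipschitzOnWith.continuousOn (K := (‖D‖ * B * newtonCompConst⁻¹).toNNReal)
        (LipschitzOnWith.of_dist_le_mul fun s hs t ht => ?_)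
      rw [Real.coe_toNNReal _ (by positivity), dist_eq_norm, Real.dist_eq]
      refine (norm_sub_le_of_hammerstein D hmono hB (mul_nonneg (by positivity) hs)
        (hz s hs) (hz t ht)).trans (le_of_eq ?_)
      rw [← mul_sub, abs_mul, abs_of_pos (inv_pos.2 hκ)]
      ring
    have hmc : Continuous m := by
      refine LipschitzWith.continuous (K := 1) (LipschitzWith.of_dist_le_mul fun a b => ?_)
      rw [dist_eq_norm, dist_eq_norm, NNReal.coe_one, one_mul]
      exact hmL a b
    exact ((continuous_const.inner (hmc.comp D.adjoint.continuous)).comp_continuousOn hzc)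

/-- Existence of the mean-field potential with unit charge. The bound on the coupling `λ` involves
only a lower bound `g` for the weight. -/
lemma exists_mean_field {w g : R3 → ℝ} (hw : Measurable w) (hwi : Integrable w) {P : ℝ≥0}
    (hP : ∀ x, rieszPotential 1 w x ≤ P) (hg : Measurable g) (hgi : Integrable g)
    (hg0 : ∀ x, 0 ≤ g x) (hgw : ∀ x, g x ≤ w x) {Q : ℝ≥0} (hQ : ∀ x, rieszPotential 1 g x ≤ Q)
    (hM : 0 < ∫ x, g x) :
    ∃ (t : ℝ) (v : R3 → ℝ), 0 ≤ t ∧ t ≤ Real.exp (Q / ∫ x, g x) / ∫ x, g x ∧ Measurable v ∧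
      (∀ x, 0 ≤ v x) ∧ (∀ x, v x = newton (fun y => t * (w y * Real.exp (-v y))) x) ∧
      t * ∫ x, w x * Real.exp (-v x) = 1 := by
  have hw0 : ∀ x, 0 ≤ w x := fun x => (hg0 x).trans (hgw x)
  obtain ⟨v, hv, hvm, hvc⟩ := exists_mean_field_family hw hwi hw0 hP
  set M := ∫ x, g x
  -- `τ` will bound the `g`-average of `v T`; then `T` is chosen so that `T e^{-τ} M = 1`.
  set τ : ℝ := Q / M
  have hτ : 0 ≤ τ := by positivity
  set T : ℝ := Real.exp τ / M
  have hT : 0 ≤ T := by positivity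
  set Φ : ℝ → ℝ := fun t => t * ∫ x, w x * Real.exp (-v t x)
  have hΦc : ContinuousOn Φ (Set.Icc 0 T) :=
    continuousOn_id.mul (hvc.mono Set.Icc_subset_Ici_self)
  have hv0 : ∀ t, 0 ≤ t → ∀ x, 0 ≤ v t x := by
    intro t ht x
    rw [hv t ht x]
    exact newton_nonneg (ae_of_all _ fun y => by have := hw0 y; positivity) x
  have hΦT : 1 ≤ Φ T := by
    by_contra! hlt
    have hvT := hvm T hT
    have hexp : ∀ x, Real.exp (-v T x) ≤ 1 := fun x =>
      Real.exp_le_one_iff.2 (by linarith [hv0 T hT x])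
    have i1 : Integrable fun x => w x * Real.exp (-v T x) := by
      refine hwi.mono (by fun_prop : Measurable _).aestronglyMeasurable (ae_of_all _ fun x => ?_)
      rw [norm_mul, Real.norm_of_nonneg (Real.exp_nonneg _)]
      exact mul_le_of_le_one_right (norm_nonneg _) (hexp x)
    have i2 : Integrable fun x => g x * Real.exp (-v T x) := by
      refine hgi.mono (by fun_prop : Measurable _).aestronglyMeasurable (ae_of_all _ fun x => ?_)
      rw [norm_mul, Real.norm_of_nonneg (Real.exp_nonneg _)]
      exact mul_le_of_le_one_right (norm_nonneg _) (hexp x)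
    set F : R3 → ℝ := fun y => T * (w y * Real.exp (-v T y)) with hF
    have iF : Integrable F := i1.const_mul T
    have hF0 : ∀ y, 0 ≤ F y := fun y => by have := hw0 y; simp only [hF]; positivity
    have hFΦ : ∫ y, F y = Φ T := integral_const_mul _ _
    have hNg : ∀ y, newton g y ≤ Q := by
      intro y
      have := (enorm_newton_le g y).trans (hQ y)
      rw [← ofReal_norm, ENNReal.ofReal_le_coe] at this
      exact (Real.le_norm_self _).trans this
    have hFP : ∀ x, rieszPotential 1 F x ≤ (T.toNNReal * P : ℝ≥0) := fun x => by
      refine rieszPotential_le_of_abs_le (ae_of_all _ fun y => ?_) hT (hP x)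
      rw [abs_of_nonneg (hF0 y), abs_of_nonneg (hw0 y)]
      simp only [hF]
      gcongr
      exact mul_le_of_le_one_right (hw0 y) (hexp y)
    -- Symmetry of the kernel puts the potential on `g`, where it is at most `Q`; the total charge
    -- of `F` is below one by assumption. No size of `w` enters.
    have hgv : ∫ x, g x * v T x = ∫ y, F y * newton g y := by
      have e0 : ∀ x, v T x = newton F x := hv T hT
      simp_rw [e0]
      have := integral_newton_mul iF hgi.1 hQ
      rw [← this]
      exact integral_congr_ae (ae_of_all _ fun x => mul_comm _ _)
    have igv : Integrable fun x => g x * v T x := by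
      have hb : ∀ᵐ x, ‖v T x‖ ≤ (T.toNNReal * P : ℝ≥0) := ae_of_all _ fun x => by
        have := (enorm_newton_le F x).trans (hFP x)
        rw [← ofReal_norm, ENNReal.ofReal_le_coe, ← hv T hT x] at this
        exact this
      exact hgi.mul_bdd (c := ((T.toNNReal * P : ℝ≥0) : ℝ)) hvT.aestronglyMeasurable hb
    have hgvQ : ∫ x, g x * v T x ≤ Q := by
      rw [hgv]
      calc ∫ y, F y * newton g y ≤ ∫ y, F y * Q := by
            refine integral_mono_of_nonneg (ae_of_all _ fun y => ?_) (iF.mul_const _)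
              (ae_of_all _ fun y => ?_)
            · exact mul_nonneg (hF0 y) (newton_nonneg (ae_of_all _ hg0) y)
            · exact mul_le_mul_of_nonneg_left (hNg y) (hF0 y)
        _ = Φ T * Q := by rw [integral_mul_const, hFΦ]
        _ ≤ 1 * Q := by gcongr
        _ = Q := one_mul _
    have hjensen : Real.exp (-τ) * M ≤ ∫ x, g x * Real.exp (-v T x) := by
      -- The tangent line of `e^{-v}` at `v = τ`, which is Jensen's inequality after integration.
      have hpt : ∀ x, Real.exp (-τ) * ((1 + τ) * g x - g x * v T x) ≤ g x * Real.exp (-v T x) := by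
        intro x
        have h1 := Real.add_one_le_exp (τ - v T x)
        have h2 : Real.exp (-v T x) = Real.exp (-τ) * Real.exp (τ - v T x) := by
          rw [← Real.exp_add]; congr 1; ring
        rw [h2]
        have h3 := mul_le_mul_of_nonneg_left h1 (mul_nonneg (hg0 x) (Real.exp_nonneg (-τ)))
        linarith
      have hi := integral_mono (((hgi.const_mul (1 + τ)).sub igv).const_mul (Real.exp (-τ))) i2 hpt
      rw [integral_const_mul] at hi
      simp only [Pi.sub_apply] at hi
      rw [integral_sub (hgi.const_mul (1 + τ)) igv, integral_const_mul] at hi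
      refine le_trans ?_ hi
      gcongr
      have : τ * M = Q := div_mul_cancel₀ _ hM.ne'
      change M ≤ (1 + τ) * M - _
      linarith
    have hfin : 1 ≤ Φ T := by
      calc 1 = T * (Real.exp (-τ) * M) := by
            simp only [T]
            rw [Real.exp_neg]
            field_simp
        _ ≤ T * ∫ x, w x * Real.exp (-v T x) := by
            gcongr
            refine hjensen.trans (integral_mono i2 i1 fun x => ?_)
            exact mul_le_mul_of_nonneg_right (hgw x) (Real.exp_nonneg _)
    linarith
  have h0 : Φ 0 = 0 := zero_mul _
  obtain ⟨t, ht, hΦt⟩ := intermediate_value_Icc hT hΦc (show (1 : ℝ) ∈ Set.Icc (Φ 0) (Φ T) by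
    rw [h0]; exact ⟨zero_le_one, hΦT⟩)
  exact ⟨t, v t, ht.1, ht.2, hvm t ht.1, hv0 t ht.1, hv t ht.1, hΦt⟩

/-! ### Assembly of the solution and of its bounds. -/

/-- Clamping between zero and the essential supremum makes the bounds hold at every point. -/
lemma exists_measurable_representative {g : R3 → ℝ} (h0 : ∀ᵐ x, 0 ≤ g x) (hg : MemLp g ⊤) :
    ∃ g' : R3 → ℝ, Measurable g' ∧ g' =ᵐ[volume] g ∧ (∀ x, 0 ≤ g' x) ∧
      ∀ x, g' x ≤ (eLpNorm g ⊤ volume).toReal := by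
  have hm : Measurable (hg.1.mk g) := hg.1.stronglyMeasurable_mk.measurable
  refine ⟨fun x => min (max (hg.1.mk g x) 0) (eLpNorm g ⊤ volume).toReal, by fun_prop, ?_,
    fun x => le_min (le_max_right _ _) ENNReal.toReal_nonneg, fun x => min_le_right _ _⟩
  filter_upwards [h0, hg.1.ae_eq_mk, ae_le_eLpNormEssSup (f := g) (μ := volume)] with x hx h1 h2
  rw [← h1, max_eq_left hx, min_eq_left]
  rw [← eLpNorm_exponent_top] at h2
  have := ENNReal.toReal_mono hg.2.ne h2
  rw [toReal_enorm, Real.norm_of_nonneg hx] at this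
  exact this

/-- A unit charge in `L^{5/3}` has a bounded potential. -/
lemma exists_rieszPotential_le_five_thirds :
    ∃ C : ℝ≥0, ∀ ρ : R3 → ℝ, eLpNorm ρ 1 volume = 1 → MemLp ρ (5 / 3) → ∀ x,
      rieszPotential 1 ρ x ≤
        (C * (eLpNorm ρ (5 / 3) volume).toNNReal ^ (5 / 6 : ℝ) : ℝ≥0) := by
  obtain ⟨C, hC⟩ := exists_rieszPotential_one_le
  refine ⟨C + 1, fun ρ h1 h53 x => ?_⟩
  set q : ℝ≥0 := (eLpNorm ρ (5 / 3) volume).toNNReal with hq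
  have hqe : eLpNorm ρ (5 / 3) volume = ENNReal.ofReal q := by
    rw [hq, ENNReal.ofReal_coe_nnreal, ENNReal.coe_toNNReal h53.2.ne]
  have hq0 : 0 < (q : ℝ) := by
    rw [NNReal.coe_pos, pos_iff_ne_zero, hq, Ne, ENNReal.toNNReal_eq_zero_iff, not_or]
    refine ⟨fun h => ?_, h53.2.ne⟩
    rw [eLpNorm_eq_zero_iff h53.1 (by norm_num)] at h
    rw [eLpNorm_congr_ae h] at h1
    simp at h1
  -- This radius equalises the near term `R^{1/5} q` and the far term `R⁻¹`, both then `q^{5/6}`.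
  -- The unit mass guarantees `q > 0`.
  set R : ℝ := (q : ℝ) ^ (-(5 / 6) : ℝ) with hR
  have hR0 : 0 < R := by positivity
  have e1 : R ^ (1 / 5 : ℝ) * q = (q : ℝ) ^ (5 / 6 : ℝ) := by
    rw [hR, ← Real.rpow_mul hq0.le]
    nth_rewrite 2 [← Real.rpow_one (q : ℝ)]
    rw [← Real.rpow_add hq0]
    norm_num
  have e2 : R ^ (-1 : ℝ) = (q : ℝ) ^ (5 / 6 : ℝ) := by
    rw [hR, ← Real.rpow_mul hq0.le]
    norm_num
  refine (rieszPotential_le_near_add zero_le_one hR0 h53.1 x).trans ?_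
  refine (add_le_add_left (hC ρ h53.1 R hR0 x) _).trans (le_of_eq ?_)
  have e3 : ((q ^ (5 / 6 : ℝ) : ℝ≥0) : ℝ≥0∞) = ENNReal.ofReal ((q : ℝ) ^ (5 / 6 : ℝ)) := by
    rw [← NNReal.coe_rpow, ENNReal.ofReal_coe_nnreal]
  rw [h1, e2, hqe, mul_one, mul_assoc, ← ENNReal.ofReal_mul (by positivity), e1, ENNReal.coe_mul, e3]
  push_cast
  ring

lemma isSingularPotential_newton {ρ : R3 → ℝ} (h1 : Integrable ρ) (h53 : MemLp ρ (5 / 3)) {P : ℝ≥0}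
    (hP : ∀ x, rieszPotential 1 ρ x ≤ P) : IsSingularPotential ρ (newton ρ) :=
  ⟨memHomSobolev_newton h1 hP, isPoissonSolution_newton h1 hP,
    (tendsto_newton_cocompact h1 h53).mono_left inf_le_left⟩

/-- The difference is harmonic in the sense of distributions and tends to zero at infinity. -/
lemma IsSingularPotential.ae_eq {ρ U V : R3 → ℝ} (hU : IsSingularPotential ρ U)
    (hV : IsSingularPotential ρ V) : V =ᵐ[volume] U := by
  have hlim := hV.2.2.sub hU.2.2
  rw [sub_zero] at hlim
  have := ae_eq_zero_of_laplacian_eq_zero (d := fun x => V x - U x)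
    (hV.2.1.1.sub hU.2.1.1) hlim fun φ hφ => by
      have hi : ∀ W : R3 → ℝ, LocallyIntegrable W →
          Integrable fun x => W x * Laplacian.laplacian φ x := fun W hW => by
        have := hW.integrable_smul_right_of_hasCompactSupport hφ.laplacian.1.continuous
          hφ.laplacian.2
        simpa only [smul_eq_mul] using this
      simp_rw [sub_mul]
      rw [integral_sub (hi V hV.2.1.1) (hi U hU.2.1.1), hV.2.1.2.2 φ hφ, hU.2.1.2.2 φ hφ, sub_self]
  filter_upwards [this] with x hx
  exact sub_eq_zero.1 hx

/-- The unit charge density produced by the mean field. -/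
lemma exists_unit_charge {g N : R3 → ℝ} (hg : Measurable g) (hgi : Integrable g)
    (hg0 : ∀ x, 0 ≤ g x) {G : ℝ} (hgG : ∀ x, g x ≤ G) {Q : ℝ≥0}
    (hQ : ∀ x, rieszPotential 1 g x ≤ Q) (hM : 0 < ∫ x, g x) (hN : Measurable N)
    (hN0 : ∀ x, 0 ≤ N x) {K : ℝ} (hNK : ∀ x, N x ≤ K) :
    ∃ f U : R3 → ℝ, Measurable f ∧ (∀ x, 0 ≤ f x) ∧ Integrable f ∧ ∫ x, f x = 1 ∧
      (∀ x, f x ≤ G * (Real.exp (Q / ∫ x, g x) / ∫ x, g x) * Real.exp K) ∧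
      U = newton (fun x => -f x) ∧ Integrable (fun x => g x * Real.exp (U x + N x)) ∧
      0 < ∫ x, g x * Real.exp (U x + N x) ∧
      ∀ x, f x = g x * Real.exp (U x + N x) / ∫ y, g y * Real.exp (U y + N y) := by
  set w : R3 → ℝ := fun x => g x * Real.exp (N x) with hwdef
  have hw : Measurable w := by fun_prop
  -- Positivity of `N` makes `g` a lower bound for the weight, so the bound on the coupling involves
  -- `g` alone.
  have hgw : ∀ x, g x ≤ w x := fun x =>
    le_mul_of_one_le_right (hg0 x) (Real.one_le_exp (hN0 x))
  have hwg : ∀ x, |w x| ≤ Real.exp K * |g x| := fun x => by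
    rw [hwdef, abs_mul, abs_of_pos (Real.exp_pos _), mul_comm]
    gcongr
    exact hNK x
  have hwi : Integrable w := (hgi.const_mul (Real.exp K)).mono hw.aestronglyMeasurable
    (ae_of_all _ fun x => by
      rw [norm_mul (Real.exp K), Real.norm_of_nonneg (Real.exp_nonneg K)]
      exact hwg x)
  obtain ⟨t, v, ht0, htT, hv, hv0, hvN, ht1⟩ := exists_mean_field hw hwi
    (fun x => rieszPotential_le_of_abs_le (ae_of_all _ hwg) (Real.exp_nonneg K) (hQ x))
    hg hgi hg0 hgw hQ hM
  have hG0 : 0 ≤ G := (hg0 0).trans (hgG 0)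
  have hexp : ∀ x, Real.exp (-v x) ≤ 1 := fun x => Real.exp_le_one_iff.2 (by linarith [hv0 x])
  have hi : Integrable fun x => w x * Real.exp (-v x) := by
    refine hwi.mono (by fun_prop : Measurable _).aestronglyMeasurable (ae_of_all _ fun x => ?_)
    rw [norm_mul, Real.norm_of_nonneg (Real.exp_nonneg _)]
    exact mul_le_of_le_one_right (norm_nonneg _) (hexp x)
  have hwe : ∀ x, g x * Real.exp (-v x + N x) = w x * Real.exp (-v x) := fun x => by
    rw [Real.exp_add]
    simp only [hwdef]
    ring
  -- Since `newton` inverts `-Δ`, the sought potential is that of the negative charge.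
  have hU : (fun x => -v x) = newton (fun x => -(t * (w x * Real.exp (-v x)))) := by
    ext x
    have := newton_const_mul (-1) (fun y => t * (w y * Real.exp (-v y))) x
    simp only [neg_one_mul] at this
    rw [this, ← hvN x]
  have hZ : ∫ x, w x * Real.exp (-v x) ≠ 0 := fun h => by simp [h] at ht1
  have hZ0 : 0 ≤ ∫ x, w x * Real.exp (-v x) := integral_nonneg fun x =>
    mul_nonneg ((hg0 x).trans (hgw x)) (Real.exp_nonneg _)
  refine ⟨fun x => t * (w x * Real.exp (-v x)), fun x => -v x, by fun_prop, fun x => ?_,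
    hi.const_mul t, ?_, fun x => ?_, hU, ?_, ?_, fun x => ?_⟩
  · exact mul_nonneg ht0 (mul_nonneg ((hg0 x).trans (hgw x)) (Real.exp_nonneg _))
  · rw [integral_const_mul, ht1]
  · calc t * (w x * Real.exp (-v x)) ≤ (Real.exp (Q / ∫ x, g x) / ∫ x, g x) * (w x * 1) := by
          have := (hg0 x).trans (hgw x)
          gcongr
          exact hexp x
      _ ≤ (Real.exp (Q / ∫ x, g x) / ∫ x, g x) * ((G * Real.exp K) * 1) := by
          gcongr
          exact mul_le_mul (hgG x) (Real.exp_le_exp.2 (hNK x)) (Real.exp_nonneg _) hG0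
      _ = _ := by ring
  · simp_rw [hwe]
    exact hi
  · simp_rw [hwe]
    exact lt_of_le_of_ne hZ0 hZ.symm
  · simp_rw [hwe]
    rw [eq_div_iff hZ, mul_right_comm, ht1, one_mul]

lemma IsPoissonSolution.congr_right {u f h : R3 → ℝ} (hu : IsPoissonSolution u f)
    (hfh : f =ᵐ[volume] h) : IsPoissonSolution u h := by
  refine ⟨hu.1, hu.2.1.congr hfh, fun φ hφ => (hu.2.2 φ hφ).trans (integral_congr_ae ?_)⟩
  filter_upwards [hfh] with x hx
  rw [hx]

lemma weakLpNorm_le_of_rieszPotential {F : Type*} [NormedAddCommGroup F] {u : R3 → F} {f : R3 → ℝ}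
    {s p : ℝ} (hsp : s / 3 = 1 / p) (hs : 0 ≤ s) (hu : ∀ x, ‖u x‖ₑ ≤ rieszPotential s f x) {C : ℝ≥0}
    (hC : ∀ t : ℝ≥0, (t : ℝ≥0∞) * volume {x | (t : ℝ≥0∞) < rieszPotential s f x} ^ (s / 3) ≤ C) :
    weakLpNorm p u ≤ C := by
  refine iSup_le fun t => le_trans ?_ (hC t)
  rw [← hsp]
  gcongr with x
  exact hu x

end VPME

open VPME

theorem proposition2p7 :
    ∃ C : ℝ≥0, ∀ g : VPME.R3 → ℝ,
      (∀ᵐ x, 0 ≤ g x) → MemLp g 1 → MemLp g ∞ → 0 < ∫ x, g x →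
      ∃ Cg : ℝ≥0 → ℝ≥0, ∀ ρ : VPME.R3 → ℝ,
        (∀ᵐ x, 0 ≤ ρ x) → eLpNorm ρ 1 volume = 1 → MemLp ρ (5 / 3) →
        (∃ Ubar : VPME.R3 → ℝ, VPME.IsSingularPotential ρ Ubar ∧
          ∀ V : VPME.R3 → ℝ, VPME.IsSingularPotential ρ V → V =ᵐ[volume] Ubar) ∧
        ∀ Ubar : VPME.R3 → ℝ, VPME.IsSingularPotential ρ Ubar →
          ∃ Uhat : VPME.R3 → ℝ,
            VPME.IsFixedChargeSolution g Ubar Uhat ∧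
            VPME.weakLpNorm 3 Uhat ≤ C ∧
            ContDiff ℝ 1 Uhat ∧
            VPME.weakLpNorm (3 / 2) (VPME.electricField Uhat) ≤ C ∧
            ∀ α : ℝ≥0, 0 < α → α < 1 →
              VPME.c1AlphaNorm α Uhat ≤ ENNReal.ofReal (Real.exp
                (Cg α * (1 + (eLpNorm ρ (5 / 3) volume).toReal ^ (5 / 6 : ℝ)))) := by
  obtain ⟨C₁, hC₁⟩ := exists_weak_rieszPotential_le (s := 1) (by norm_num) (by norm_num)
  obtain ⟨C₂, hC₂⟩ := exists_weak_rieszPotential_le (s := 2) (by norm_num) (by norm_num)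
  obtain ⟨c, hc⟩ := exists_rieszPotential_le_five_thirds
  refine ⟨max C₁ C₂, fun g hg0 hg1 hgt hgpos => ?_⟩
  obtain ⟨g', hg'm, hgg', hg'0, hg'G⟩ := exists_measurable_representative hg0 hgt
  have hg'1 : MemLp g' 1 := (memLp_congr_ae hgg').2 hg1
  have hg't : MemLp g' ⊤ := (memLp_congr_ae hgg').2 hgt
  obtain ⟨Q, hQ⟩ := rieszPotential_lt_top (s := 1) (by norm_num) (by norm_num) hg'1 hg't
  have hM : 0 < ∫ x, g' x := by rwa [integral_congr_ae hgg']
  set G : ℝ := (eLpNorm g ⊤ volume).toReal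
  have hG0 : 0 ≤ G := ENNReal.toReal_nonneg
  set A : ℝ := G * (Real.exp (Q / ∫ x, g' x) / ∫ x, g' x)
  have hA : 0 ≤ A := by positivity
  have hex : ∀ α : ℝ≥0, ∃ D : ℝ≥0, α < 1 → ∀ (f : R3 → ℝ) (M : ℝ≥0), MemLp f 1 → MemLp f ⊤ →
      eLpNorm f 1 volume ≤ M → eLpNorm f ⊤ volume ≤ M →
      c1AlphaNorm α (newton f) ≤ (D * M : ℝ≥0) := fun α => by
    by_cases hα : α < 1
    · obtain ⟨D, hD⟩ := exists_c1AlphaNorm_newton_le hα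
      exact ⟨D, fun _ => hD⟩
    · exact ⟨0, fun h => absurd h hα⟩
  choose D hD using hex
  -- The first summand absorbs the prefactor of the Hölder estimate through `x ≤ e^x`; `c` is the
  -- rate in the bound for the potential of `ρ`.
  refine ⟨fun α => D α * (1 + A.toNNReal) + c, fun ρ hρ0 hρ1 hρ => ?_⟩
  have hρi : Integrable ρ :=
    memLp_one_iff_integrable.1 ⟨hρ.1, by rw [hρ1]; exact ENNReal.one_lt_top⟩
  have hP := hc ρ hρ1 hρ
  have hsing := isSingularPotential_newton hρi hρ hP
  refine ⟨⟨newton ρ, hsing, fun V hV => hsing.ae_eq hV⟩, fun Ubar hUbar => ?_⟩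
  have hUN : Ubar =ᵐ[volume] newton ρ := hsing.ae_eq hUbar
  set r : ℝ := (eLpNorm ρ (5 / 3) volume).toReal ^ (5 / 6 : ℝ)
  have hr : 0 ≤ r := by positivity
  have hNK : ∀ x, newton ρ x ≤ c * r := fun x => by
    have := (enorm_newton_le ρ x).trans (hP x)
    rw [← ofReal_norm, ENNReal.ofReal_le_coe] at this
    refine (Real.le_norm_self _).trans (this.trans (le_of_eq ?_))
    rw [NNReal.coe_mul, NNReal.coe_rpow]
    rfl
  obtain ⟨f, U, hfm, hf0, hfi, hf1, hfA, hU, hi, hZ, hfe⟩ := exists_unit_charge hg'm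
    (memLp_one_iff_integrable.1 hg'1) hg'0 hg'G hQ hM (stronglyMeasurable_newton hρ.1).measurable
    (newton_nonneg hρ0) hNK
  have hae : (fun x => g x * Real.exp (U x + Ubar x)) =ᵐ[volume]
      fun x => g' x * Real.exp (U x + newton ρ x) := by
    filter_upwards [hgg', hUN] with x h1 h2
    rw [h1, h2]
  -- `1 + A` instead of `A` lets a single number dominate both the mass, equal to one, and the
  -- supremum of `f`.
  set B : ℝ := (1 + A) * Real.exp (c * r) with hB
  have he1 : 1 ≤ Real.exp (c * r) := Real.one_le_exp (by positivity)
  have hB1 : 1 ≤ B := by nlinarith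
  have hfB : ∀ x, f x ≤ B := fun x => (hfA x).trans (by rw [hB]; gcongr; linarith)
  have hm1 : MemLp (fun x => -f x) 1 := memLp_one_iff_integrable.2 hfi.neg
  have hbd : ∀ᵐ x, ‖-f x‖ ≤ B := ae_of_all _ fun x => by
    rw [norm_neg, Real.norm_of_nonneg (hf0 x)]
    exact hfB x
  have hmt : MemLp (fun x => -f x) ⊤ := memLp_top_of_bound hm1.1 B hbd
  have hn1 : eLpNorm (fun x => -f x) 1 volume = 1 := by
    rw [eLpNorm_one_eq_lintegral_enorm, ← ENNReal.ofReal_one, ← hf1,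
      ofReal_integral_eq_lintegral_ofReal hfi (ae_of_all _ hf0)]
    refine lintegral_congr fun x => ?_
    rw [enorm_neg, Real.enorm_of_nonneg (hf0 x)]
  have hnt : eLpNorm (fun x => -f x) ⊤ volume ≤ B.toNNReal := by
    rw [eLpNorm_exponent_top]
    refine eLpNormEssSup_le_of_ae_bound ?_
    simpa using hbd
  obtain ⟨P, hPf⟩ := rieszPotential_lt_top (s := 1) (by norm_num) (by norm_num) hm1 hmt
  have hmi := memLp_one_iff_integrable.1 hm1
  refine ⟨U, ⟨hU ▸ memHomSobolev_newton hmi hPf, hi.congr hae.symm, ?_, ?_⟩, ?_,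
    hU ▸ contDiff_newton hm1 hmt, ?_, fun α hα hα1 => ?_⟩
  · rwa [integral_congr_ae hae]
  · have hs : IsPoissonSolution U _ := hU ▸ isPoissonSolution_newton hmi hPf
    refine hs.congr_right ?_
    rw [integral_congr_ae hae]
    filter_upwards [hae] with x hx
    rw [hx, neg_neg, hfe x]
  · refine (weakLpNorm_le_of_rieszPotential (s := 1) (by norm_num) (by norm_num)
      (fun x => hU ▸ enorm_newton_le _ x) (hC₁ _ hm1.1 hn1.le)).trans ?_
    exact_mod_cast le_max_left C₁ C₂
  · refine (weakLpNorm_le_of_rieszPotential (s := 2) (by norm_num) (by norm_num)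
      (fun x => ?_) (hC₂ _ hm1.1 hn1.le)).trans ?_
    · rw [electricField, enorm_neg, hU, gradient_newton hm1 hmt]
      exact enorm_newtonField_le _ x
    · exact_mod_cast le_max_right C₁ C₂
  · have hb := hD α hα1 _ B.toNNReal hm1 hmt
      (hn1.le.trans (by simpa using hB1)) hnt
    rw [← hU] at hb
    refine hb.trans ?_
    rw [← ENNReal.ofReal_coe_nnreal]
    refine ENNReal.ofReal_le_ofReal ?_
    push_cast
    rw [Real.coe_toNNReal _ hA, Real.coe_toNNReal _ (by linarith), hB]
    have h1 : (D α : ℝ) * (1 + A) ≤ Real.exp (D α * (1 + A)) := by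
      linarith [Real.add_one_le_exp (D α * (1 + A))]
    calc (D α : ℝ) * ((1 + A) * Real.exp (c * r)) = D α * (1 + A) * Real.exp (c * r) := by ring
      _ ≤ Real.exp (D α * (1 + A)) * Real.exp (c * r) := by gcongr
      _ = Real.exp (D α * (1 + A) + c * r) := (Real.exp_add _ _).symm
      _ ≤ _ := by
        refine Real.exp_le_exp.2 ?_
        have : 0 ≤ (D α : ℝ) * (1 + A) * r := by positivity
        have hc0 : (0 : ℝ) ≤ c := c.2
        linarith

end
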